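/- Work in local coordinates over $\mathbb{C}$ with the usual $\mathbb{Z}_2$-graded sign rule; $\mathsf{p}$ denotes parity. Let $\mathcal{E}=\{F^\ell=0\}$ be a system of finitely many differential equations, each $F^\ell$ homogeneous in parity, for $m_0$ even unknowns $u^k$ and $m_1$ odd unknowns $\xi^a$ depending on $n$ even independent variables $x^1,\dots,x^n$. The $F^\ell$ are superfunctions (smooth functions with values in a Grassmann algebra, each depending on finitely many coordinates) on an open domain of the infinite jet space with coordinates $x^i,u^k_I,\xi^a_I$. Let $\mathcal{E}^\infty$ be the infinite prolongation: $C^\infty(\mathcal{E}^\infty)=\Lambda^0(\mathcal{E}^\infty)$ is the algebra of superfunctions modulo the ideal generated by all differential consequences $D_{x^{i_1}}\cdots D_{x^{i_s}}F^\ell$ ($s\ge 0$), $\bar D_{x^i}$ are the induced total derivatives, $\bar d_h=\sum_i dx^i\,\bar D_{x^i}$ is the horizontal differential on functions, and $\Lambda^1(\mathcal{E}^\infty)\otimes V$ below stands for the horizontal one-forms $\sum_i dx^i\,\beta_i$, $\beta_i\in\Lambda^0(\mathcal{E}^\infty)\otimes V$. Let $\mathfrak{g}\subseteq\mathfrak{gl}(k_0+1\,|\,k_1)$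 be a Lie superalgebra with homogeneous basis $(e_k)$, let $\rho\colon\mathfrak{g}\to\mathrm{Mat}(k_0+1\,|\,k_1)$ be a faithful matrix representation, and let $\varrho\colon\mathfrak{g}\to\mathrm{Vect}(W;\mathrm{poly})$ be a representation by vector fields with polynomial coefficients on the $(k_0|k_1)$-dimensional superspace $W$ with even coordinates $w^1,\dots,w^{k_0}$ and odd coordinates $f^1,\dots,f^{k_1}$. Both $\rho$ and $\varrho$ are extended $\Lambda^0(\mathcal{E}^\infty)$-linearly, $q^k\otimes e_k\mapsto q^k\rho(e_k)$ and $q^k\otimes e_k\mapsto q^k\varrho(e_k)$, and to horizontal one-forms componentwise. Let $\alpha=\sum_i dx^i\,\alpha_i$ be an even $\mathfrak{g}$-valued zero-curvature representation for $\mathcal{E}$, i.e. $\bar d_h\alpha=\tfrac12[\alpha,\alpha]$, or in components $\bar D_{x^i}\alpha_j-\bar D_{x^j}\alpha_i=[\alpha_i,\alpha_j]$ (if $\alpha=\alpha_\lambda$ depends on a parameter, $\lambda$ is fixed). Let $\tilde{\mathcal{E}}=W\times\mathcal{E}^\infty\to\mathcal{E}^\infty$ be the covering with the total derivatives $$\tilde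 D_{x^i}=\bar D_{x^i}-\varrho(\alpha_i),\qquad\text{i.e.}\quad w^p_{x^i}=-\varrho(\alpha_i)(w^p),\quad f^q_{x^i}=-\varrho(\alpha_i)(f^q),$$ and let $U\in D(\Lambda^1(\tilde{\mathcal{E}}))$ be its characteristic element (connection form), $U(h)=dh-\sum_i dx^i\,\tilde D_{x^i}(h)$. Here $D(\Lambda^r(\tilde{\mathcal{E}}))$ denotes the graded derivations of $C^\infty(\tilde{\mathcal{E}})$ with values in $r$-forms on $\tilde{\mathcal{E}}$. Put $$\partial_\alpha=\bar d_h-[\rho(\alpha),\cdot\,]\colon\ \Lambda^0(\mathcal{E}^\infty)\otimes\mathrm{Mat}(k_0+1|k_1)\to\Lambda^1(\mathcal{E}^\infty)\otimes\mathrm{Mat}(k_0+1|k_1),$$ $$\partial_U=[\,\cdot\,,U]^{\mathrm{FN}}\colon\ D(\Lambda^0(\tilde{\mathcal{E}}))\to D(\Lambda^1(\tilde{\mathcal{E}})),$$ where $[X,\Theta]^{\mathrm{FN}}(h)=L_X(\Theta(h))-(-1)^{\mathsf{p}(X)\mathsf{p}(\Theta)}L_\Theta(X(h))$ is the Frölicher–Nijenhuis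 bracket and $L=i\circ d+d\circ i$; and let $\nabla=\varrho\circ\rho^{-1}$ on $\Lambda^r(\mathcal{E}^\infty)\otimes\rho(\mathfrak{g})$, $r=0,1$. Then for every $\gamma\in\Lambda^0(\mathcal{E}^\infty)\otimes\mathfrak{g}$ one has $\nabla(\rho(\gamma))=\varrho(\gamma)$, the form $\partial_\alpha(\rho(\gamma))$ lies in $\Lambda^1(\mathcal{E}^\infty)\otimes\rho(\mathfrak{g})$, and $$\nabla\bigl(\partial_\alpha(\rho(\gamma))\bigr)=\partial_U(\varrho(\gamma)).$$ In particular this holds for the projective substitution: for every real $\mu\ne0$ the assignment $$g\mapsto X_g=\boldsymbol{w}\,g\,\partial_{\boldsymbol{w}},\qquad \boldsymbol{w}=(\mu,w^1,\dots,w^{k_0},f^1,\dots,f^{k_1}),$$ $$\partial_{\boldsymbol{w}}=\Bigl(-\tfrac1\mu\bigl(\textstyle\sum_p w^p\partial_{w^p}+\sum_q f^q\partial_{f^q}\bigr),\partial_{w^1},\dots,\partial_{w^{k_0}},\partial_{f^1},\dots,\partial_{f^{k_1}}\Bigr)^{\mathrm t},$$ is a representation $\varrho$ of $\mathfrak{g}$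 of the kind considered above. -/

import Mathlib

open scoped TensorProduct
open TopologicalSpace

noncomputable section

namespace SuperGeom

/-- A `ℤ/2`-graded complex vector space, the grading being recorded by its parity involution:
the even (odd) vectors are those with `par v = v` (with `par v = -v`). -/
class Superspace (V : Type*) [AddCommGroup V] [Module ℂ V] where
  par : V →ₗ[ℂ] V
  par_par : ∀ v, par (par v) = v

section Superspace
variable {V : Type*} [AddCommGroup V] [Module ℂ V] [Superspace V]

/-- The parity involution. -/
def par : V →ₗ[ℂ] V := Superspace.par

@[simp] theorem par_par (v : V) : par (par v) = v := Superspace.par_par v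

/-- The even component. -/
def ev : V →ₗ[ℂ] V := (2⁻¹ : ℂ) • (LinearMap.id + par)

/-- The odd component. -/
def od : V →ₗ[ℂ] V := (2⁻¹ : ℂ) • (LinearMap.id - par)

theorem ev_apply (v : V) : ev v = (2⁻¹ : ℂ) • (v + par v) := rfl
theorem od_apply (v : V) : od v = (2⁻¹ : ℂ) • (v - par v) := rfl

theorem ev_add_od (v : V) : ev v + od v = v := by
  rw [ev_apply, od_apply]; module
theorem par_eq (v : V) : par v = ev v - od v := by
  rw [ev_apply, od_apply]; module
theorem par_ev (v : V) : par (ev v) = ev v := by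
  simp only [ev_apply, map_smul, map_add, par_par]; module
theorem par_od (v : V) : par (od v) = -od v := by
  simp only [od_apply, map_smul, map_sub, par_par]; module

/-- The parity involution of linear endomorphisms. -/
instance : Superspace (Module.End ℂ V) where
  par :=
    { toFun := fun X => par ∘ₗ X ∘ₗ par
      map_add' := fun X Y => by ext; simp
      map_smul' := fun c X => by ext; simp }
  par_par := fun X => by ext; simp

theorem par_end_apply (X : Module.End ℂ V) (v : V) : par X v = par (X (par v)) := rfl

end Superspace

/-- An associative superalgebra over `ℂ`. -/
class Superalgebra (A : Type*) [Ring A] [Algebra ℂ A] extends Superspace A where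
  par_mul : ∀ a b : A, par (a * b) = par a * par b

/-- Supercommutativity `a b = (-1)^{p(a)p(b)} b a`. -/
class Supercommutative (A : Type*) [Ring A] [Algebra ℂ A] [Superalgebra A] : Prop where
  comm : ∀ a b : A, a * b = b * ev a + par b * od a

section Superalgebra
variable {A : Type*} [Ring A] [Algebra ℂ A] [Superalgebra A]

theorem par_mul (a b : A) : par (a * b) = par a * par b := Superalgebra.par_mul a b

theorem par_one : par (1 : A) = 1 := by
  have h := par_mul (1 : A) (par 1)
  rw [one_mul, par_par, mul_one] at h
  exact h.symm

theorem ev_mul (a b : A) : ev (a * b) = ev a * ev b + od a * od b := by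
  simp only [ev_apply, od_apply, par_mul, smul_mul_smul_comm]
  rw [← smul_add]
  have : (a + par a) * (b + par b) + (a - par a) * (b - par b)
    = (2 : ℂ) • (a * b + par a * par b) := by
    rw [two_smul]; noncomm_ring
  rw [this, smul_smul]; norm_num

theorem od_mul (a b : A) : od (a * b) = ev a * od b + od a * ev b := by
  simp only [ev_apply, od_apply, par_mul, smul_mul_smul_comm]
  rw [← smul_add]
  have : (a + par a) * (b - par b) + (a - par a) * (b + par b)
    = (2 : ℂ) • (a * b - par a * par b) := by
    rw [two_smul]; noncomm_ring
  rw [this, smul_smul]; norm_num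

/-- The supercommutator `[a, b] = a b - (-1)^{p(a)p(b)} b a`, extended bilinearly. -/
def superBracket : A →ₗ[ℂ] A →ₗ[ℂ] A :=
  LinearMap.mul ℂ A - (LinearMap.mul ℂ A).flip ∘ₗ ev
    - ((LinearMap.mul ℂ A).flip ∘ₗ od).compl₂ par

theorem superBracket_apply (a b : A) :
    superBracket a b = a * b - b * ev a - par b * od a := rfl

end Superalgebra

instance {V : Type*} [AddCommGroup V] [Module ℂ V] [Superspace V] :
    Superalgebra (Module.End ℂ V) where
  par_mul := fun X Y => by
    ext v
    change par (X (Y (par v))) = par (X (par (par (Y (par v)))))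
    rw [par_par]

/-! ### Derivations, one-forms and the Frölicher–Nijenhuis bracket -/

section Forms
variable (A : Type*) [Ring A] [Algebra ℂ A] [Superalgebra A]

/-- `D(A)`, the graded derivations of `A`:
`X (a b) = X(a) b + (-1)^{p(X)p(a)} a X(b)` for homogeneous `X` and `a`. -/
def Der : Submodule ℂ (Module.End ℂ A) where
  carrier := {X | ∀ a b, X (a * b) = X a * b + a * (ev X) b + par a * (od X) b}
  add_mem' := fun {X Y} hX hY a b => by
    simp only [Set.mem_ofPred_eq, map_add, LinearMap.add_apply] at *
    rw [hX, hY]; noncomm_ring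
  zero_mem' := fun a b => by simp
  smul_mem' := fun c X hX a b => by
    simp only [Set.mem_ofPred_eq, map_smul, LinearMap.smul_apply] at *
    rw [hX, smul_add, smul_add, smul_mul_assoc, mul_smul_comm, mul_smul_comm]

variable {A}

theorem mem_der {X : Module.End ℂ A} :
    X ∈ Der A ↔ ∀ a b, X (a * b) = X a * b + a * (ev X) b + par a * (od X) b := Iff.rfl

theorem mem_der_of_even {X : Module.End ℂ A} (hp : par X = X)
    (h : ∀ a b, X (a * b) = X a * b + a * X b) : X ∈ Der A := fun a b => by
  have h1 : ev X = X := by rw [ev_apply, hp]; module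
  have h2 : od X = 0 := by rw [od_apply, hp]; module
  rw [h1, h2, h]; simp

theorem mem_der_of_odd {X : Module.End ℂ A} (hp : par X = -X)
    (h : ∀ a b, X (a * b) = X a * b + par a * X b) : X ∈ Der A := fun a b => by
  have h1 : ev X = 0 := by rw [ev_apply, hp]; module
  have h2 : od X = X := by rw [od_apply, hp]; module
  rw [h1, h2, h]; simp

theorem par_mem_der {X : Module.End ℂ A} (hX : X ∈ Der A) : par X ∈ Der A := fun a b => by
  have h1 : ev (par X) = ev X := by rw [ev_apply, ev_apply, par_par, add_comm]
  have h2 : od (par X) = -od X := by rw [od_apply, od_apply, par_par]; module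
  have e1 : par (ev X) = ev X := par_ev X
  have e2 : par (od X) = -od X := par_od X
  have f1 : par ((ev X) (par b)) = (ev X) b := by rw [← par_end_apply, e1]
  have f2 : par ((od X) (par b)) = -(od X) b := by rw [← par_end_apply, e2]; rfl
  rw [h1, h2, par_end_apply, par_mul, hX, map_add, map_add, par_mul, par_mul, par_mul, par_par,
    par_par, f1, f2, par_end_apply]
  simp

theorem ev_mem_der {X : Module.End ℂ A} (hX : X ∈ Der A) : ev X ∈ Der A :=
  (Der A).smul_mem _ ((Der A).add_mem hX (par_mem_der hX))

theorem od_mem_der {X : Module.End ℂ A} (hX : X ∈ Der A) : od X ∈ Der A :=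
  (Der A).smul_mem _ ((Der A).sub_mem hX (par_mem_der hX))

theorem der_even_mul {X : Module.End ℂ A} (hX : X ∈ Der A) (a b : A) :
    (ev X) (a * b) = (ev X) a * b + a * (ev X) b := by
  have h := ev_mem_der hX a b
  have h1 : ev (ev X) = ev X := by
    rw [ev_apply (ev X), par_ev]; module
  have h2 : od (ev X) = 0 := by rw [od_apply, par_ev]; module
  rw [h1, h2] at h
  simpa using h

theorem der_odd_mul {X : Module.End ℂ A} (hX : X ∈ Der A) (a b : A) :
    (od X) (a * b) = (od X) a * b + par a * (od X) b := by
  have h := od_mem_der hX a b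
  have h1 : ev (od X) = 0 := by rw [ev_apply, par_od]; module
  have h2 : od (od X) = od X := by
    rw [od_apply (od X), par_od]; module
  rw [h1, h2] at h
  simpa using h

instance : Superspace (Der A) where
  par := (par (V := Module.End ℂ A)).restrict fun _ h => par_mem_der h
  par_par := fun X => Subtype.ext (par_par (X : Module.End ℂ A))

theorem superBracket_mem_der {X Y : Module.End ℂ A} (hX : X ∈ Der A) (hY : Y ∈ Der A) :
    superBracket X Y ∈ Der A := by
  have key : ∀ {X Y : Module.End ℂ A}, X ∈ Der A → Y ∈ Der A →
      (par X = X ∨ par X = -X) → (par Y = Y ∨ par Y = -Y) → superBracket X Y ∈ Der A := by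
    intro X Y hX hY pX pY
    have hpar : ∀ {Z : Module.End ℂ A}, Z ∈ Der A →
        (par Z = Z → ev Z = Z ∧ od Z = 0) ∧ (par Z = -Z → ev Z = 0 ∧ od Z = Z) := by
      intro Z _
      refine ⟨fun h => ⟨?_, ?_⟩, fun h => ⟨?_, ?_⟩⟩ <;> simp only [ev_apply, od_apply, h] <;> module
    have hev : ∀ {Z : Module.End ℂ A}, Z ∈ Der A → par Z = Z →
        ∀ a b, Z (a * b) = Z a * b + a * Z b := by
      intro Z hZ h a b
      have := der_even_mul hZ a b
      rwa [((hpar hZ).1 h).1] at this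
    have hod : ∀ {Z : Module.End ℂ A}, Z ∈ Der A → par Z = -Z →
        ∀ a b, Z (a * b) = Z a * b + par a * Z b := by
      intro Z hZ h a b
      have := der_odd_mul hZ a b
      rwa [((hpar hZ).2 h).2] at this
    have pev : ∀ {Z : Module.End ℂ A}, par Z = Z → ∀ a, par (Z a) = Z (par a) := by
      intro Z h a
      have := par_end_apply Z (par a)
      rw [h, par_par] at this; exact this.symm
    have pod : ∀ {Z : Module.End ℂ A}, par Z = -Z → ∀ a, par (Z a) = -Z (par a) := by
      intro Z h a
      have := par_end_apply Z (par a)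
      rw [h, par_par] at this; rw [← this]; rfl
    rcases pX with pX | pX <;> rcases pY with pY | pY
    · have e : superBracket X Y = X * Y - Y * X := by
        rw [superBracket_apply, ((hpar hX).1 pX).1, ((hpar hX).1 pX).2]; simp
      rw [e]
      refine mem_der_of_even (by rw [map_sub, par_mul, par_mul, pX, pY]) fun a b => ?_
      simp only [LinearMap.sub_apply, Module.End.mul_apply, hev hX pX, hev hY pY, map_add]
      noncomm_ring
    · have e : superBracket X Y = X * Y - Y * X := by
        rw [superBracket_apply, ((hpar hX).1 pX).1, ((hpar hX).1 pX).2]; simp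
      rw [e]
      refine mem_der_of_odd (by
        rw [map_sub, par_mul, par_mul, pX, pY]
        ext v; simp; abel)
        fun a b => ?_
      simp only [LinearMap.sub_apply, Module.End.mul_apply, hev hX pX, hod hY pY, map_add,
        pev pX]
      noncomm_ring
    · have e : superBracket X Y = X * Y - Y * X := by
        rw [superBracket_apply, ((hpar hX).2 pX).1, ((hpar hX).2 pX).2, pY]; simp
      rw [e]
      refine mem_der_of_odd (by
        rw [map_sub, par_mul, par_mul, pX, pY]
        ext v; simp; abel)
        fun a b => ?_
      simp only [LinearMap.sub_apply, Module.End.mul_apply, hod hX pX, hev hY pY, map_add,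
        pev pY]
      noncomm_ring
    · have e : superBracket X Y = X * Y + Y * X := by
        rw [superBracket_apply, ((hpar hX).2 pX).1, ((hpar hX).2 pX).2, pY]
        ext v; simp
      rw [e]
      refine mem_der_of_even (by
        rw [map_add, par_mul, par_mul, pX, pY]
        ext v; simp)
        fun a b => ?_
      simp only [LinearMap.add_apply, Module.End.mul_apply, hod hX pX, hod hY pY, map_add,
        pod pX, pod pY, par_par]
      noncomm_ring
  rw [← ev_add_od X, ← ev_add_od Y]
  simp only [map_add, LinearMap.add_apply]
  have a1 := ev_mem_der hX
  have a2 := od_mem_der hX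
  have b1 := ev_mem_der hY
  have b2 := od_mem_der hY
  exact (Der A).add_mem
    ((Der A).add_mem (key a1 b1 (.inl (par_ev _)) (.inl (par_ev _)))
      (key a2 b1 (.inr (par_od _)) (.inl (par_ev _))))
    ((Der A).add_mem (key a1 b2 (.inl (par_ev _)) (.inr (par_od _)))
      (key a2 b2 (.inr (par_od _)) (.inr (par_od _))))

/-- The bracket of vector fields. -/
def derBracket : Der A →ₗ[ℂ] Der A →ₗ[ℂ] Der A :=
  LinearMap.mk₂ ℂ (fun X Y => ⟨superBracket (X : Module.End ℂ A) (Y : Module.End ℂ A),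
      superBracket_mem_der X.2 Y.2⟩)
    (fun _ _ _ => Subtype.ext (by simp)) (fun _ _ _ => Subtype.ext (by simp))
    (fun _ _ _ => Subtype.ext (by simp)) (fun _ _ _ => Subtype.ext (by simp))

/-- The multiplication of vector fields by functions from the left. -/
def derSMul [Supercommutative A] : A →ₗ[ℂ] Der A →ₗ[ℂ] Der A :=
  LinearMap.mk₂ ℂ (fun a X => ⟨LinearMap.mulLeft ℂ a ∘ₗ (X : Module.End ℂ A), fun b c => by
      have hev : ev (LinearMap.mulLeft ℂ a ∘ₗ (X : Module.End ℂ A)) c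
          = ev a * (ev (X : Module.End ℂ A)) c + od a * (od (X : Module.End ℂ A)) c := by
        simp only [ev_apply, od_apply, LinearMap.smul_apply, LinearMap.add_apply,
          LinearMap.sub_apply, par_end_apply, LinearMap.comp_apply, LinearMap.mulLeft_apply,
          par_mul, smul_mul_smul_comm]
        rw [← smul_add]
        have : ∀ x y z w : A, (x + y) * (z + w) + (x - y) * (z - w)
            = (2 : ℂ) • (x * z + y * w) := by
          intro x y z w; rw [two_smul]; noncomm_ring
        rw [this, smul_smul]; norm_num
      have hod : od (LinearMap.mulLeft ℂ a ∘ₗ (X : Module.End ℂ A)) c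
          = ev a * (od (X : Module.End ℂ A)) c + od a * (ev (X : Module.End ℂ A)) c := by
        simp only [ev_apply, od_apply, LinearMap.smul_apply, LinearMap.add_apply,
          LinearMap.sub_apply, par_end_apply, LinearMap.comp_apply, LinearMap.mulLeft_apply,
          par_mul, smul_mul_smul_comm]
        rw [← smul_add]
        have : ∀ x y z w : A, (x + y) * (z - w) + (x - y) * (z + w)
            = (2 : ℂ) • (x * z - y * w) := by
          intro x y z w; rw [two_smul]; noncomm_ring
        rw [this, smul_smul]; norm_num
      have h1 : a * b = b * ev a + par b * od a := Supercommutative.comm a b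
      have h2 : a * par b = par b * ev a + b * od a := by
        rw [Supercommutative.comm a (par b), par_par]
      rw [hev, hod, LinearMap.comp_apply, LinearMap.mulLeft_apply, X.2, mul_add, mul_add,
        ← mul_assoc a b, ← mul_assoc a (par b), h1, h2, LinearMap.comp_apply,
        LinearMap.mulLeft_apply]
      noncomm_ring⟩)
    (fun _ _ _ => Subtype.ext (by ext; simp [add_mul]))
    (fun _ _ _ => Subtype.ext (by ext; simp))
    (fun _ _ _ => Subtype.ext (by ext; simp [mul_add]))
    (fun _ _ _ => Subtype.ext (by ext; simp))

variable (A) in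
/-- Linear functionals on vector fields; `ω Y` is the substitution `i_Y ω`. -/
abbrev Functional : Type _ := Der A →ₗ[ℂ] A

/-- The one-form `dg · a`, that is, `i_Y (dg · a) = Y(g) a`. -/
def dMul : A →ₗ[ℂ] A →ₗ[ℂ] Functional A :=
  LinearMap.mk₂ ℂ (fun g a => LinearMap.mulRight ℂ a ∘ₗ LinearMap.applyₗ g ∘ₗ (Der A).subtype)
    (fun _ _ _ => by ext; simp [add_mul]) (fun _ _ _ => by ext; simp)
    (fun _ _ _ => by ext; simp [mul_add]) (fun _ _ _ => by ext; simp)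

variable (A) in
/-- `Λ¹(A)`: finite sums of forms `dg · a`. When `A` consists of functions of given coordinates
`s`, these are the finite sums `∑ ds · a_s`, a one-form being determined by its substitutions. -/
def OneForm : Submodule ℂ (Functional A) :=
  Submodule.span ℂ {ω | ∃ g a, ω = dMul g a}

/-- The differential of functions, `i_Y (dg) = Y(g)`. -/
def dFun (g : A) : Functional A := dMul g 1

/-- The product `a · ω` of a one-form with a function from the left:
`i_Y (a ω) = (-1)^{p(a)p(Y)} a i_Y ω`. -/
def mulForm (a : A) (ω : Functional A) : Functional A :=
  LinearMap.mulLeft ℂ (ev a) ∘ₗ ω + LinearMap.mulLeft ℂ (od a) ∘ₗ ω ∘ₗ par (V := Der A)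

/-- The product `ω · a` of a one-form with a function from the right. -/
def formMul (ω : Functional A) (a : A) : Functional A := LinearMap.mulRight ℂ a ∘ₗ ω

/-- `i_Y i_X dω` for a one-form `ω`, which for homogeneous `X`, `Y` is
`(-1)^{p(X)p(Y)} (X(i_Y ω) - i_{[X,Y]} ω) - Y(i_X ω)`. -/
def dForm (ω : Functional A) (X : Der A) : Functional A :=
  (((ev X : Der A) : Module.End ℂ A) ∘ₗ ω - ω ∘ₗ derBracket (ev X))
    + (((od X : Der A) : Module.End ℂ A) ∘ₗ ω - ω ∘ₗ derBracket (od X)) ∘ₗ par (V := Der A)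
    - LinearMap.applyₗ (ω X) ∘ₗ (Der A).subtype

/-- The Lie derivative `L_X ω = i_X dω + d i_X ω` of one-forms. -/
def lieForm (X : Der A) (ω : Functional A) : Functional A := dForm ω X + dFun (ω X)

/-- The parity involution of linear maps `Θ : A → Λ¹(A)`. -/
instance : Superspace (A →ₗ[ℂ] Functional A) where
  par :=
    { toFun := fun Θ =>
        LinearMap.mk₂ ℂ (fun g Y => par (Θ (par g) (par Y)))
          (fun _ _ _ => by simp) (fun _ _ _ => by simp)
          (fun _ _ _ => by simp) (fun _ _ _ => by simp)
      map_add' := fun _ _ => by ext; simp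
      map_smul' := fun _ _ => by ext; simp }
  par_par := fun Θ => by ext; simp

variable (A) in
/-- `D(Λ¹(A))`: the graded derivations `Θ : A → Λ¹(A)`,
`Θ(a b) = Θ(a) b + (-1)^{p(Θ)p(a)} a Θ(b)`. -/
def DerForm : Submodule ℂ (A →ₗ[ℂ] Functional A) where
  carrier := {Θ | (∀ g, Θ g ∈ OneForm A) ∧ ∀ a b,
    Θ (a * b) = formMul (Θ a) b + mulForm a (ev Θ b) + mulForm (par a) (od Θ b)}
  add_mem' := fun {Θ Ξ} hΘ hΞ => by
    refine ⟨fun g => (OneForm A).add_mem (hΘ.1 g) (hΞ.1 g), fun a b => ?_⟩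
    rw [LinearMap.add_apply, hΘ.2, hΞ.2]
    ext Y
    simp [formMul, mulForm, add_mul, mul_add]
    abel
  zero_mem' := ⟨fun g => (OneForm A).zero_mem, fun a b => by
    ext Y; simp [formMul, mulForm]⟩
  smul_mem' := fun c Θ hΘ => by
    refine ⟨fun g => (OneForm A).smul_mem c (hΘ.1 g), fun a b => ?_⟩
    rw [LinearMap.smul_apply, hΘ.2]
    ext Y
    simp [formMul, mulForm]

instance : AddCommGroup (DerForm A) :=
  @Submodule.addCommGroup ℂ (A →ₗ[ℂ] Functional A) _ _ _ (DerForm A)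

variable (A) in
/-- The differential `d` as an element of `D(Λ¹)`. -/
def dDer [Supercommutative A] : DerForm A :=
  ⟨dMul.flip 1, fun g => Submodule.subset_span ⟨g, 1, rfl⟩, fun a b => by
    have hp : par (V := A →ₗ[ℂ] Functional A) (dMul.flip 1) = dMul.flip 1 := by
      ext g Y
      change par (par ((Y : Module.End ℂ A) (par (par g))) * 1) = (Y : Module.End ℂ A) g * 1
      rw [mul_one, mul_one, par_par, par_par]
    have h1 : ev (V := A →ₗ[ℂ] Functional A) (dMul.flip 1) = dMul.flip 1 := by
      rw [ev_apply, hp]; module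
    have h2 : od (V := A →ₗ[ℂ] Functional A) (dMul.flip 1) = 0 := by
      rw [od_apply, hp]; module
    rw [h1, h2]
    ext Y
    have h3 : (Y : Module.End ℂ A) (a * b) = (Y : Module.End ℂ A) a * b
        + (ev a * (Y : Module.End ℂ A) b + od a * (par (Y : Module.End ℂ A)) b) := by
      rw [Y.2, add_assoc]
      congr 1
      have hy : (Y : Module.End ℂ A) b
          = (ev (Y : Module.End ℂ A)) b + (od (Y : Module.End ℂ A)) b := by
        rw [← LinearMap.add_apply, ev_add_od]
      rw [hy, par_eq a, par_eq (Y : Module.End ℂ A), LinearMap.sub_apply]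
      conv_lhs => enter [1, 1]; rw [← ev_add_od a]
      noncomm_ring
    change (Y : Module.End ℂ A) (a * b) * 1 = (Y : Module.End ℂ A) a * 1 * b
      + (ev a * ((Y : Module.End ℂ A) b * 1) + od a * ((par (Y : Module.End ℂ A)) b * 1))
      + (ev (par a) * 0 + od (par a) * 0)
    rw [h3]
    simp only [mul_one, mul_zero, add_zero]⟩

/-- The form-valued vector field `dx · X`, `g ↦ dx · X(g)`, for an even function `x`. -/
def dMulDer [Supercommutative A] (x : A) (hx : par x = x) : Der A →ₗ[ℂ] DerForm A where
  toFun := fun X => ⟨dMul x ∘ₗ (X : Module.End ℂ A), fun g => Submodule.subset_span ⟨x, _, rfl⟩,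
    fun a b => by
      have hp : par (V := A →ₗ[ℂ] Functional A) (dMul x ∘ₗ (X : Module.End ℂ A))
          = dMul x ∘ₗ (par (X : Module.End ℂ A)) := by
        ext g Y
        change par (par ((Y : Module.End ℂ A) (par x)) * (X : Module.End ℂ A) (par g))
          = (Y : Module.End ℂ A) x * par ((X : Module.End ℂ A) (par g))
        rw [par_mul, par_par, hx]
      have h1 : ev (V := A →ₗ[ℂ] Functional A) (dMul x ∘ₗ (X : Module.End ℂ A))
          = dMul x ∘ₗ (ev (X : Module.End ℂ A)) := by
        rw [ev_apply, ev_apply, hp, LinearMap.comp_smul, LinearMap.comp_add]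
      have h2 : od (V := A →ₗ[ℂ] Functional A) (dMul x ∘ₗ (X : Module.End ℂ A))
          = dMul x ∘ₗ (od (X : Module.End ℂ A)) := by
        rw [od_apply, od_apply, hp, LinearMap.comp_smul, LinearMap.comp_sub]
      have h3 : ∀ (c : A) (y : A), ev c * y + od c * par y = y * c := by
        intro c y
        rw [Supercommutative.comm y c]
        nth_rw 1 [← ev_add_od y]
        rw [par_eq y, par_eq c]
        nth_rw 3 [← ev_add_od c]
        noncomm_ring
      rw [h1, h2]
      ext Y
      change (Y : Module.End ℂ A) x * (X : Module.End ℂ A) (a * b)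
        = (Y : Module.End ℂ A) x * (X : Module.End ℂ A) a * b
        + (ev a * ((Y : Module.End ℂ A) x * (ev (X : Module.End ℂ A)) b)
          + od a * (par ((Y : Module.End ℂ A) (par x)) * (ev (X : Module.End ℂ A)) b))
        + (ev (par a) * ((Y : Module.End ℂ A) x * (od (X : Module.End ℂ A)) b)
          + od (par a) * (par ((Y : Module.End ℂ A) (par x)) * (od (X : Module.End ℂ A)) b))
      rw [hx, ← mul_assoc (ev a), ← mul_assoc (od a), ← mul_assoc (ev (par a)),
        ← mul_assoc (od (par a)), ← add_mul, ← add_mul, h3, h3, X.2]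
      noncomm_ring⟩
  map_add' := fun X Y => Subtype.ext (by simp [LinearMap.comp_add])
  map_smul' := fun c X => Subtype.ext (by simp [LinearMap.comp_smul])

/-- The Frölicher–Nijenhuis bracket of `X ∈ D(Λ⁰)` and `Θ ∈ D(Λ¹)`,
`[X, Θ](g) = L_X(Θ(g)) - (-1)^{p(X)p(Θ)} L_Θ(X(g))`; here `L_Θ h = i_Θ dh = Θ(h)` on functions. -/
def fnBracket (X : Der A) (Θ : DerForm A) : A →ₗ[ℂ] Functional A where
  toFun := fun g => lieForm X ((Θ : A →ₗ[ℂ] Functional A) g)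
    - ((Θ : A →ₗ[ℂ] Functional A) (((ev X : Der A) : Module.End ℂ A) g)
    + (par (Θ : A →ₗ[ℂ] Functional A)) (((od X : Der A) : Module.End ℂ A) g))
  map_add' := fun g h => by
    ext Y
    simp [lieForm, dForm, dFun]
    abel
  map_smul' := fun c g => by
    ext Y
    simp [lieForm, dForm, dFun, smul_sub]

end Forms

/-! ### Quotients by graded ideals -/

section Quotient
variable {A : Type*} [Ring A] [Algebra ℂ A]

/-- The linear map of `A ⧸ I` into `B ⧸ J` induced by a linear map of `A` into `B`. -/
def quotMap {B : Type*} [Ring B] [Algebra ℂ B] (I : Ideal A) (J : Ideal B)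
    [I.IsTwoSided] [J.IsTwoSided] (X : A →ₗ[ℂ] B) (h : ∀ a ∈ I, X a ∈ J) :
    (A ⧸ I) →ₗ[ℂ] (B ⧸ J) where
  toFun := Quotient.map X fun a b hab => by
    have : a - b ∈ I := (Submodule.quotientRel_def I).1 hab
    refine (Submodule.quotientRel_def J).2 ?_
    rw [← map_sub]; exact h _ this
  map_add' := fun x y => by
    obtain ⟨a, rfl⟩ := Ideal.Quotient.mk_surjective x
    obtain ⟨b, rfl⟩ := Ideal.Quotient.mk_surjective y
    exact congrArg (Ideal.Quotient.mk J) (map_add X a b)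
  map_smul' := fun c x => by
    obtain ⟨a, rfl⟩ := Ideal.Quotient.mk_surjective x
    exact congrArg (Ideal.Quotient.mk J) (map_smul X c a)

theorem quotMap_mk {B : Type*} [Ring B] [Algebra ℂ B] (I : Ideal A) (J : Ideal B)
    [I.IsTwoSided] [J.IsTwoSided] (X : A →ₗ[ℂ] B) (h : ∀ a ∈ I, X a ∈ J) (a : A) :
    quotMap I J X h (Ideal.Quotient.mk I a) = Ideal.Quotient.mk J (X a) := rfl

variable [Superalgebra A]

/-- A two-sided ideal stable under the parity involution. -/
class IsSuperIdeal (I : Ideal A) : Prop extends I.IsTwoSided where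
  par_mem : ∀ a ∈ I, par a ∈ I

theorem isSuperIdeal_span [Supercommutative A] {S : Set A} (hS : ∀ a ∈ S, par a ∈ Ideal.span S) :
    IsSuperIdeal (Ideal.span S) := by
  have hpar : ∀ a ∈ Ideal.span S, par a ∈ Ideal.span S := fun a ha => by
    induction ha using Submodule.span_induction with
    | mem a ha => exact hS a ha
    | zero => simp
    | add a b _ _ ha hb => rw [map_add]; exact add_mem ha hb
    | smul c a _ ha => rw [smul_eq_mul, par_mul]; exact Ideal.mul_mem_left _ _ ha
  have hsm : ∀ (c : ℂ), ∀ a ∈ Ideal.span S, c • a ∈ Ideal.span S := fun c a ha => by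
    rw [← one_mul a, ← smul_mul_assoc]; exact Ideal.mul_mem_left _ _ ha
  refine { mul_mem_of_left := fun {a} b ha => ?_, par_mem := hpar }
  rw [Supercommutative.comm a b, ev_apply, od_apply]
  exact add_mem (Ideal.mul_mem_left _ _ (hsm _ _ (add_mem ha (hpar a ha))))
    (Ideal.mul_mem_left _ _ (hsm _ _ (sub_mem ha (hpar a ha))))

instance (I : Ideal A) [IsSuperIdeal I] : Superalgebra (A ⧸ I) where
  par := quotMap I I par IsSuperIdeal.par_mem
  par_par := fun x => by
    obtain ⟨a, rfl⟩ := Ideal.Quotient.mk_surjective x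
    rw [quotMap_mk, quotMap_mk, par_par]
  par_mul := fun x y => by
    obtain ⟨a, rfl⟩ := Ideal.Quotient.mk_surjective x
    obtain ⟨b, rfl⟩ := Ideal.Quotient.mk_surjective y
    rw [← map_mul]
    change quotMap I I par IsSuperIdeal.par_mem _ = quotMap I I par IsSuperIdeal.par_mem _
      * quotMap I I par IsSuperIdeal.par_mem _
    rw [quotMap_mk, quotMap_mk, quotMap_mk, par_mul, map_mul]

theorem par_mk (I : Ideal A) [IsSuperIdeal I] (a : A) :
    par (Ideal.Quotient.mk I a) = Ideal.Quotient.mk I (par a) := rfl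

theorem ev_mk (I : Ideal A) [IsSuperIdeal I] (a : A) :
    ev (Ideal.Quotient.mk I a) = Ideal.Quotient.mk I (ev a) := rfl

theorem od_mk (I : Ideal A) [IsSuperIdeal I] (a : A) :
    od (Ideal.Quotient.mk I a) = Ideal.Quotient.mk I (od a) := rfl

instance (I : Ideal A) [IsSuperIdeal I] [Supercommutative A] : Supercommutative (A ⧸ I) where
  comm := fun x y => by
    obtain ⟨a, rfl⟩ := Ideal.Quotient.mk_surjective x
    obtain ⟨b, rfl⟩ := Ideal.Quotient.mk_surjective y
    rw [par_mk, ev_mk, od_mk, ← map_mul, ← map_mul, ← map_mul, ← map_add,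
      Supercommutative.comm a b]

/-- A vector field tangent to the subspace cut out by `I` restricts to it. -/
def Der.restrict (I : Ideal A) [IsSuperIdeal I] (X : Der A)
    (h : ∀ a ∈ I, (X : Module.End ℂ A) a ∈ I) : Der (A ⧸ I) :=
  ⟨quotMap I I (X : Module.End ℂ A) h, fun x y => by
    obtain ⟨a, rfl⟩ := Ideal.Quotient.mk_surjective x
    obtain ⟨b, rfl⟩ := Ideal.Quotient.mk_surjective y
    have h1 : ev (V := Module.End ℂ (A ⧸ I)) (quotMap I I (X : Module.End ℂ A) h)
        (Ideal.Quotient.mk I b) = Ideal.Quotient.mk I ((ev (X : Module.End ℂ A)) b) := rfl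
    have h2 : od (V := Module.End ℂ (A ⧸ I)) (quotMap I I (X : Module.End ℂ A) h)
        (Ideal.Quotient.mk I b) = Ideal.Quotient.mk I ((od (X : Module.End ℂ A)) b) := rfl
    rw [h1, h2, par_mk, ← map_mul, quotMap_mk, quotMap_mk, X.2, map_add, map_add, map_mul,
      map_mul, map_mul]⟩

/-- A derivation that maps generators of a graded ideal into the ideal preserves the ideal. -/
theorem Der.map_span_mem {S : Set A} [IsSuperIdeal (Ideal.span S)] (X : Der A)
    (hS : ∀ a ∈ S, (X : Module.End ℂ A) a ∈ Ideal.span S ∧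
      (X : Module.End ℂ A) (par a) ∈ Ideal.span S) :
    ∀ a ∈ Ideal.span S, (X : Module.End ℂ A) a ∈ Ideal.span S := by
  have hsm : ∀ (c : ℂ), ∀ a ∈ Ideal.span S, c • a ∈ Ideal.span S := fun c a ha => by
    rw [← one_mul a, ← smul_mul_assoc]; exact Ideal.mul_mem_left _ _ ha
  suffices h : ∀ a ∈ Ideal.span S, (X : Module.End ℂ A) a ∈ Ideal.span S ∧
      (X : Module.End ℂ A) (par a) ∈ Ideal.span S from fun a ha => (h a ha).1
  have step : ∀ c a, a ∈ Ideal.span S → (X : Module.End ℂ A) a ∈ Ideal.span S →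
      (X : Module.End ℂ A) (par a) ∈ Ideal.span S →
      (X : Module.End ℂ A) (c * a) ∈ Ideal.span S := by
    intro c a ha h1 h2
    rw [X.2]
    have e1 : (ev (X : Module.End ℂ A)) a ∈ Ideal.span S := by
      rw [ev_apply, LinearMap.smul_apply, LinearMap.add_apply, par_end_apply]
      exact hsm _ _ (add_mem h1 (IsSuperIdeal.par_mem _ h2))
    have e2 : (od (X : Module.End ℂ A)) a ∈ Ideal.span S := by
      rw [od_apply, LinearMap.smul_apply, LinearMap.sub_apply, par_end_apply]
      exact hsm _ _ (sub_mem h1 (IsSuperIdeal.par_mem _ h2))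
    exact add_mem (add_mem (Ideal.mul_mem_left _ _ ha) (Ideal.mul_mem_left _ _ e1))
      (Ideal.mul_mem_left _ _ e2)
  intro a ha
  induction ha using Submodule.span_induction with
  | mem a ha => exact hS a ha
  | zero => simp
  | add a b _ _ ha hb =>
    simp only [map_add]
    exact ⟨add_mem ha.1 hb.1, add_mem ha.2 hb.2⟩
  | smul c a hm ha =>
    rw [smul_eq_mul, par_mul]
    refine ⟨step c a hm ha.1 ha.2, step (par c) (par a) (IsSuperIdeal.par_mem a hm) ha.2 ?_⟩
    rw [par_par]; exact ha.1

end Quotient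
/-! ### Smooth functions of finitely many of possibly infinitely many even coordinates -/

section Smooth
variable {S S' : Type*}

/-- The function `f` on `O` is presented by the smooth function `g` of the coordinates in `T`. -/
def Presents {O : Opens (S → ℝ)} (T : Finset S) (g : (T → ℝ) → ℂ) (f : O → ℂ) : Prop :=
  ∀ p : O, ContDiffAt ℝ ((⊤ : ℕ∞) : WithTop ℕ∞) g (T.restrict (p : S → ℝ)) ∧
    f p = g (T.restrict (p : S → ℝ))

theorem Presents.mono {O : Opens (S → ℝ)} {T T' : Finset S} (hT : T ⊆ T') {g : (T → ℝ) → ℂ}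
    {f : O → ℂ} (h : Presents T g f) :
    Presents T' (fun q => g (Finset.restrict₂ (π := fun _ => ℝ) hT q)) f := fun p => by
  refine ⟨?_, (h p).2⟩
  have hc : ContDiff ℝ ((⊤ : ℕ∞) : WithTop ℕ∞) (Finset.restrict₂ (π := fun _ => ℝ) hT) :=
    contDiff_pi.2 fun t => contDiff_apply ℝ ℝ (⟨t, hT t.2⟩ : T')
  exact ContDiffAt.comp (T'.restrict (p : S → ℝ)) (h p).1 hc.contDiffAt

/-- Complex-valued functions on `O ⊆ ℝ^S` that depend smoothly on finitely many coordinates. -/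
def smoothFn (O : Opens (S → ℝ)) : Subalgebra ℂ (O → ℂ) where
  carrier := {f | ∃ (T : Finset S) (g : (T → ℝ) → ℂ), Presents T g f}
  add_mem' := by
    classical
    rintro f f' ⟨T, g, h⟩ ⟨T', g', h'⟩
    have h1 := h.mono (Finset.subset_union_left (s₂ := T'))
    have h2 := h'.mono (Finset.subset_union_right (s₁ := T))
    exact ⟨_, _, fun p => ⟨(h1 p).1.add (h2 p).1, by rw [Pi.add_apply, (h1 p).2, (h2 p).2]⟩⟩
  mul_mem' := by
    classical
    rintro f f' ⟨T, g, h⟩ ⟨T', g', h'⟩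
    have h1 := h.mono (Finset.subset_union_left (s₂ := T'))
    have h2 := h'.mono (Finset.subset_union_right (s₁ := T))
    exact ⟨_, _, fun p => ⟨(h1 p).1.mul (h2 p).1, by rw [Pi.mul_apply, (h1 p).2, (h2 p).2]⟩⟩
  algebraMap_mem' := fun c => ⟨∅, fun _ => c, fun _ => ⟨contDiffAt_const, rfl⟩⟩

open Classical in
/-- Extension by zero. -/
def extendZero {O : Opens (S → ℝ)} (f : O → ℂ) (q : S → ℝ) : ℂ :=
  if h : q ∈ O then f ⟨q, h⟩ else 0

open Classical in
/-- The value at `p` of the partial derivative with respect to the coordinate `s`. -/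
def partialAt {O : Opens (S → ℝ)} (s : S) (f : O → ℂ) (p : O) : ℂ :=
  deriv (fun x : ℝ => extendZero f (Function.update (p : S → ℝ) s x)) ((p : S → ℝ) s)

open Classical in
theorem line_eventually {O : Opens (S → ℝ)} (s : S) (p : O) :
    ∀ᶠ x in nhds ((p : S → ℝ) s), Function.update (p : S → ℝ) s x ∈ O := by
  have hc : Continuous fun x : ℝ => Function.update (p : S → ℝ) s x :=
    continuous_const.update s continuous_id
  refine hc.continuousAt.eventually_mem (O.isOpen.mem_nhds ?_)
  rw [Function.update_eq_self]; exact p.2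

open Classical in
theorem Presents.hasDerivAt {O : Opens (S → ℝ)} {T : Finset S} {g : (T → ℝ) → ℂ} {f : O → ℂ}
    (h : Presents T g f) (t : T) (p : O) :
    HasDerivAt (fun x : ℝ => extendZero f (Function.update (p : S → ℝ) t x))
      (fderiv ℝ g (T.restrict (p : S → ℝ)) (Pi.single t 1)) ((p : S → ℝ) t) := by
  have hg : HasFDerivAt g (fderiv ℝ g (T.restrict (p : S → ℝ))) (T.restrict (p : S → ℝ)) :=
    ((h p).1.differentiableAt (by simp)).hasFDerivAt
  have hu : HasDerivAt (fun x : ℝ => Function.update (T.restrict (p : S → ℝ)) t x)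
      (Pi.single t 1) ((p : S → ℝ) t) := hasDerivAt_update _ _ _
  have hg' : HasFDerivAt g (fderiv ℝ g (T.restrict (p : S → ℝ)))
      (Function.update (T.restrict (p : S → ℝ)) t ((p : S → ℝ) t)) := by
    have : Function.update (T.restrict (p : S → ℝ)) t ((p : S → ℝ) t)
      = T.restrict (p : S → ℝ) := Function.update_eq_self t _
    rw [this]; exact hg
  refine (hg'.comp_hasDerivAt _ hu).congr_of_eventuallyEq ?_
  filter_upwards [line_eventually (t : S) p] with x hx
  rw [extendZero, dif_pos hx, (h ⟨_, hx⟩).2, Function.comp_apply]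
  congr 1
  ext u
  by_cases hut : u = t
  · subst hut; simp
  · have : (u : S) ≠ t := fun e => hut (Subtype.ext e)
    simp [Function.update_of_ne hut, Function.update_of_ne this]

theorem Presents.partialAt_of_notMem {O : Opens (S → ℝ)} {T : Finset S} {g : (T → ℝ) → ℂ}
    {f : O → ℂ} (h : Presents T g f) {s : S} (hs : s ∉ T) (p : O) : partialAt s f p = 0 := by
  classical
  have : (fun x : ℝ => extendZero f (Function.update (p : S → ℝ) s x))
      =ᶠ[nhds ((p : S → ℝ) s)] fun _ => f p := by
    filter_upwards [line_eventually s p] with x hx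
    rw [extendZero, dif_pos hx, (h ⟨_, hx⟩).2, (h p).2]
    congr 1
    ext u
    have : (u : S) ≠ s := fun e => hs (e ▸ u.2)
    simp [Function.update_of_ne this]
  rw [partialAt, Filter.EventuallyEq.deriv_eq (by convert this), deriv_const]

open Classical in
theorem hasDerivAt_line {O : Opens (S → ℝ)} (s : S) (f : smoothFn O) (p : O) :
    HasDerivAt (fun x : ℝ => extendZero (f : O → ℂ) (Function.update (p : S → ℝ) s x))
      (partialAt s (f : O → ℂ) p) ((p : S → ℝ) s) := by
  obtain ⟨T, g, h⟩ := f.2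
  have h' := h.mono (Finset.subset_insert s T)
  exact (h'.hasDerivAt ⟨s, Finset.mem_insert_self s T⟩ p).differentiableAt.hasDerivAt

theorem partialAt_mem {O : Opens (S → ℝ)} (s : S) (f : smoothFn O) :
    partialAt s (f : O → ℂ) ∈ smoothFn O := by
  classical
  obtain ⟨T, g, h⟩ := f.2
  have h' := h.mono (Finset.subset_insert s T)
  refine ⟨_, fun q => fderiv ℝ _ q (Pi.single ⟨s, Finset.mem_insert_self s T⟩ 1), fun p => ⟨?_,
    (h'.hasDerivAt ⟨s, Finset.mem_insert_self s T⟩ p).deriv⟩⟩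
  exact ((h' p).1.fderiv_right (by simp)).clm_apply contDiffAt_const

/-- The partial derivative of smooth functions with respect to the coordinate `s`. -/
def smoothPartial {O : Opens (S → ℝ)} (s : S) : smoothFn O →ₗ[ℂ] smoothFn O where
  toFun := fun f => ⟨partialAt s (f : O → ℂ), partialAt_mem s f⟩
  map_add' := fun f f' => by
    classical
    ext p
    refine (((hasDerivAt_line s f p).add (hasDerivAt_line s f' p)).congr_of_eventuallyEq ?_).deriv
    filter_upwards [line_eventually s p] with x hx
    simp [extendZero, dif_pos hx]
  map_smul' := fun c f => by
    classical
    ext p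
    refine (((hasDerivAt_line s f p).const_smul c).congr_of_eventuallyEq ?_).deriv
    filter_upwards [line_eventually s p] with x hx
    simp [extendZero, dif_pos hx]

theorem smoothPartial_mul {O : Opens (S → ℝ)} (s : S) (f f' : smoothFn O) :
    smoothPartial s (f * f') = smoothPartial s f * f' + f * smoothPartial s f' := by
  classical
  ext p
  refine (((hasDerivAt_line s f p).mul (hasDerivAt_line s f' p)).congr_of_eventuallyEq
    ?_).deriv.trans ?_
  · filter_upwards [line_eventually s p] with x hx
    simp [extendZero, dif_pos hx]
  · have : ∀ f : O → ℂ, extendZero f (p : S → ℝ) = f p := fun f => dif_pos p.2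
    simp [Function.update_eq_self, this]
    rfl

theorem smoothPartial_support {O : Opens (S → ℝ)} (f : smoothFn O) :
    {s | smoothPartial s f ≠ 0}.Finite := by
  obtain ⟨T, g, h⟩ := f.2
  refine T.finite_toSet.subset fun s hs => ?_
  by_contra hsT
  exact hs (Subtype.ext (funext fun p => h.partialAt_of_notMem (by simpa using hsT) p))

/-- The coordinate function `s`. -/
def smoothCoord (O : Opens (S → ℝ)) (s : S) : smoothFn O :=
  ⟨fun p => ((p : S → ℝ) s : ℂ), {s}, fun q => ((q ⟨s, Finset.mem_singleton_self s⟩ : ℝ) : ℂ),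
    fun _ => ⟨(Complex.ofRealCLM.contDiff.comp (contDiff_apply ℝ ℝ _)).contDiffAt, rfl⟩⟩

/-- The pull-back of functions along the projection `ℝ^S' → ℝ^S` given by `j : S → S'`. -/
def smoothPull (O : Opens (S → ℝ)) (O' : Opens (S' → ℝ)) (j : S → S')
    (hO : ∀ p ∈ O', p ∘ j ∈ O) : smoothFn O →ₐ[ℂ] smoothFn O' where
  toFun := fun f => ⟨fun p => (f : O → ℂ) ⟨(p : S' → ℝ) ∘ j, hO p p.2⟩, by
    classical
    obtain ⟨T, g, h⟩ := f.2
    refine ⟨T.image j, fun q => g fun t => q ⟨j t, Finset.mem_image_of_mem j t.2⟩, fun p =>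
      ⟨?_, (h ⟨(p : S' → ℝ) ∘ j, hO p p.2⟩).2⟩⟩
    have hc : ContDiff ℝ ((⊤ : ℕ∞) : WithTop ℕ∞) (fun (q : T.image j → ℝ) (t : T) =>
        q ⟨j t, Finset.mem_image_of_mem j t.2⟩) := contDiff_pi.2 fun t => contDiff_apply ℝ ℝ _
    exact ContDiffAt.comp _ (h ⟨(p : S' → ℝ) ∘ j, hO p p.2⟩).1 hc.contDiffAt⟩
  map_one' := rfl
  map_mul' := fun _ _ => rfl
  map_zero' := rfl
  map_add' := fun _ _ => rfl
  commutes' := fun _ => rfl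

theorem smoothPartial_pull {O : Opens (S → ℝ)} {O' : Opens (S' → ℝ)} {j : S → S'}
    (hj : Function.Injective j) (hO : ∀ p ∈ O', p ∘ j ∈ O) (s : S) (f : smoothFn O) :
    smoothPartial (j s) (smoothPull O O' j hO f) = smoothPull O O' j hO (smoothPartial s f) := by
  classical
  ext p
  change deriv _ _ = deriv _ _
  refine Filter.EventuallyEq.deriv_eq ?_
  filter_upwards [line_eventually (j s) p] with x hx
  have e : Function.update (p : S' → ℝ) (j s) x ∘ j
      = Function.update ((p : S' → ℝ) ∘ j) s x := Function.update_comp_eq_of_injective _ hj s x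
  have h2 : Function.update ((p : S' → ℝ) ∘ j) s x ∈ O := e ▸ hO _ hx
  rw [extendZero, dif_pos hx, extendZero, dif_pos h2]
  exact congrArg (f : O → ℂ) (Subtype.ext e)

theorem smoothPartial_pull_of_notMem {O : Opens (S → ℝ)} {O' : Opens (S' → ℝ)} {j : S → S'}
    (hO : ∀ p ∈ O', p ∘ j ∈ O) (s : S') (hs : s ∉ Set.range j) (f : smoothFn O) :
    smoothPartial s (smoothPull O O' j hO f) = 0 := by
  classical
  ext p
  change deriv _ _ = 0
  have : (fun x : ℝ => extendZero ((smoothPull O O' j hO f : smoothFn O') : O' → ℂ)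
      (Function.update (p : S' → ℝ) s x)) =ᶠ[nhds ((p : S' → ℝ) s)]
      fun _ => ((smoothPull O O' j hO f : smoothFn O') : O' → ℂ) p := by
    filter_upwards [line_eventually s p] with x hx
    rw [extendZero, dif_pos hx]
    exact congrArg (f : O → ℂ) (Subtype.ext (funext fun u =>
      Function.update_of_ne (fun e => hs ⟨u, e⟩) _ _))
  rw [Filter.EventuallyEq.deriv_eq (by convert this), deriv_const]

end Smooth
/-! ### Superfunctions: smooth functions with values in a Grassmann algebra -/

section Grassmann
variable {S₁ S₁' : Type*}

/-- The complex Grassmann algebra with the generators `S₁`. -/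
abbrev Grassmann (S₁ : Type*) : Type _ := ExteriorAlgebra ℂ (S₁ →₀ ℂ)

instance : Superalgebra (Grassmann S₁) where
  par := (CliffordAlgebra.involute (Q := (0 : QuadraticForm ℂ (S₁ →₀ ℂ)))).toLinearMap
  par_par := fun g => CliffordAlgebra.involute_involute g
  par_mul := fun g h =>
    map_mul (CliffordAlgebra.involute (Q := (0 : QuadraticForm ℂ (S₁ →₀ ℂ)))) g h

theorem par_grassmann (g : Grassmann S₁) :
    par g = CliffordAlgebra.involute (Q := (0 : QuadraticForm ℂ (S₁ →₀ ℂ))) g := rfl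

theorem par_ι (v : S₁ →₀ ℂ) : par (ExteriorAlgebra.ι ℂ v) = -ExteriorAlgebra.ι ℂ v :=
  CliffordAlgebra.involute_ι v

instance : Supercommutative (Grassmann S₁) where
  comm := fun a => by
    induction a using ExteriorAlgebra.induction with
    | algebraMap c =>
      intro b
      have h : par (algebraMap ℂ (Grassmann S₁) c) = algebraMap ℂ _ c := by
        rw [par_grassmann]; exact AlgHom.commutes _ c
      have h1 : ev (algebraMap ℂ (Grassmann S₁) c) = algebraMap ℂ _ c := by
        rw [ev_apply, h]; module
      have h2 : od (algebraMap ℂ (Grassmann S₁) c) = 0 := by rw [od_apply, h]; module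
      rw [h1, h2, mul_zero, add_zero, Algebra.commutes]
    | ι v =>
      intro b
      have h1 : ev (ExteriorAlgebra.ι ℂ v) = 0 := by rw [ev_apply, par_ι]; module
      have h2 : od (ExteriorAlgebra.ι ℂ v) = ExteriorAlgebra.ι ℂ v := by
        rw [od_apply, par_ι]; module
      rw [h1, h2, mul_zero, zero_add]
      induction b using ExteriorAlgebra.induction with
      | algebraMap c =>
        have h : par (algebraMap ℂ (Grassmann S₁) c) = algebraMap ℂ _ c := by
          rw [par_grassmann]; exact AlgHom.commutes _ c
        rw [h, Algebra.commutes]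
      | ι w =>
        have := ExteriorAlgebra.ι_add_mul_swap (R := ℂ) v w
        rw [par_ι, neg_mul, eq_neg_iff_add_eq_zero, this]
      | mul b b' hb hb' => rw [par_mul, ← mul_assoc, hb, mul_assoc, hb', mul_assoc]
      | add b b' hb hb' => rw [map_add, mul_add, add_mul, hb, hb']
    | mul a a' ha ha' =>
      intro b
      rw [mul_assoc, ha' b, mul_add, ← mul_assoc, ← mul_assoc, ha b, ha (par b), par_par, ev_mul,
        od_mul]
      noncomm_ring
    | add a a' ha ha' =>
      intro b
      rw [add_mul, ha, ha', map_add, map_add]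
      noncomm_ring

/-- The left derivative `∂/∂θ^a` of the Grassmann algebra. -/
def oddPartial (a : S₁) : Grassmann S₁ →ₗ[ℂ] Grassmann S₁ :=
  CliffordAlgebra.contractLeft (Q := (0 : QuadraticForm ℂ (S₁ →₀ ℂ))) (Finsupp.lapply a)

theorem oddPartial_ι (a : S₁) (v : S₁ →₀ ℂ) :
    oddPartial a (ExteriorAlgebra.ι ℂ v) = algebraMap ℂ _ (v a) :=
  CliffordAlgebra.contractLeft_ι _ _ v

theorem oddPartial_algebraMap (a : S₁) (c : ℂ) :
    oddPartial a (algebraMap ℂ (Grassmann S₁) c) = 0 :=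
  CliffordAlgebra.contractLeft_algebraMap _ _ c

theorem oddPartial_ι_mul (a : S₁) (v : S₁ →₀ ℂ) (g : Grassmann S₁) :
    oddPartial a (ExteriorAlgebra.ι ℂ v * g)
      = v a • g - ExteriorAlgebra.ι ℂ v * oddPartial a g :=
  CliffordAlgebra.contractLeft_ι_mul _ v g

theorem oddPartial_mul (a : S₁) (g h : Grassmann S₁) :
    oddPartial a (g * h) = oddPartial a g * h + par g * oddPartial a h := by
  induction g using ExteriorAlgebra.induction generalizing h with
  | algebraMap c =>
    have hc : par (algebraMap ℂ (Grassmann S₁) c) = algebraMap ℂ _ c := by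
      rw [par_grassmann]; exact AlgHom.commutes _ c
    rw [oddPartial_algebraMap, hc, ← Algebra.smul_def, ← Algebra.smul_def, map_smul, zero_mul,
      zero_add]
  | ι v => rw [oddPartial_ι_mul, oddPartial_ι, par_ι, ← Algebra.smul_def, neg_mul, sub_eq_add_neg]
  | mul g g' hg hg' =>
    rw [mul_assoc, hg, hg', hg g', par_mul]; noncomm_ring
  | add g g' hg hg' =>
    rw [add_mul, map_add, hg, hg', map_add, map_add]; noncomm_ring

theorem par_oddPartial (a : S₁) (g : Grassmann S₁) :
    par (oddPartial a g) = -oddPartial a (par g) := by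
  induction g using ExteriorAlgebra.induction with
  | algebraMap c =>
    have hc : par (algebraMap ℂ (Grassmann S₁) c) = algebraMap ℂ _ c := by
      rw [par_grassmann]; exact AlgHom.commutes _ c
    rw [hc, oddPartial_algebraMap, map_zero, neg_zero]
  | ι v =>
    rw [par_ι, map_neg, neg_neg, oddPartial_ι, par_grassmann]; exact AlgHom.commutes _ _
  | mul g g' hg hg' =>
    rw [par_mul, oddPartial_mul, oddPartial_mul, map_add, par_mul, par_mul, hg, hg']
    noncomm_ring
  | add g g' hg hg' => simp only [map_add, hg, hg']; abel

theorem oddPartial_support (g : Grassmann S₁) : {a | oddPartial a g ≠ 0}.Finite := by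
  induction g using ExteriorAlgebra.induction with
  | algebraMap c => simp [oddPartial_algebraMap]
  | ι v =>
    refine v.support.finite_toSet.subset fun a ha => ?_
    by_contra h
    have : v a = 0 := by simpa using h
    exact ha (by rw [oddPartial_ι, this, map_zero])
  | mul g g' hg hg' =>
    refine (hg.union hg').subset fun a ha => ?_
    by_contra h
    simp only [Set.mem_union, Set.mem_ofPred_eq, not_or, not_not] at h
    exact ha (by rw [oddPartial_mul, h.1, h.2, zero_mul, mul_zero, add_zero])
  | add g g' hg hg' =>
    refine (hg.union hg').subset fun a ha => ?_
    by_contra h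
    simp only [Set.mem_union, Set.mem_ofPred_eq, not_or, not_not] at h
    exact ha (by rw [map_add, h.1, h.2, add_zero])

/-- The homomorphism of Grassmann algebras given by a map of the generators. -/
def grassmannPull (j : S₁ → S₁') : Grassmann S₁ →ₐ[ℂ] Grassmann S₁' :=
  ExteriorAlgebra.map (Finsupp.lmapDomain ℂ ℂ j)

theorem par_grassmannPull (j : S₁ → S₁') (g : Grassmann S₁) :
    par (grassmannPull j g) = grassmannPull j (par g) := by
  induction g using ExteriorAlgebra.induction with
  | algebraMap c =>
    have h : par (algebraMap ℂ (Grassmann S₁) c) = algebraMap ℂ _ c := by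
      rw [par_grassmann]; exact AlgHom.commutes _ c
    have h' : par (algebraMap ℂ (Grassmann S₁') c) = algebraMap ℂ _ c := by
      rw [par_grassmann]; exact AlgHom.commutes _ c
    rw [AlgHom.commutes, h, h', AlgHom.commutes]
  | ι v =>
    rw [par_ι, map_neg, grassmannPull, ExteriorAlgebra.map_apply_ι, par_ι]
  | mul g g' hg hg' => simp only [par_mul, map_mul, hg, hg']
  | add g g' hg hg' => simp only [map_add, hg, hg']

theorem oddPartial_pull {j : S₁ → S₁'} (hj : Function.Injective j) (a : S₁) (g : Grassmann S₁) :
    oddPartial (j a) (grassmannPull j g) = grassmannPull j (oddPartial a g) := by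
  induction g using ExteriorAlgebra.induction with
  | algebraMap c =>
    rw [AlgHom.commutes, oddPartial_algebraMap, oddPartial_algebraMap, map_zero]
  | ι v =>
    rw [grassmannPull, ExteriorAlgebra.map_apply_ι, oddPartial_ι, oddPartial_ι, AlgHom.commutes,
      Finsupp.lmapDomain_apply, Finsupp.mapDomain_apply hj]
  | mul g g' hg hg' =>
    simp only [map_mul, map_add, oddPartial_mul, hg, hg', par_grassmannPull]
  | add g g' hg hg' => simp only [map_add, hg, hg']

theorem oddPartial_pull_of_notMem {j : S₁ → S₁'} (a : S₁') (ha : a ∉ Set.range j)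
    (g : Grassmann S₁) : oddPartial a (grassmannPull j g) = 0 := by
  induction g using ExteriorAlgebra.induction with
  | algebraMap c => rw [AlgHom.commutes, oddPartial_algebraMap]
  | ι v =>
    rw [grassmannPull, ExteriorAlgebra.map_apply_ι, oddPartial_ι, Finsupp.lmapDomain_apply,
      Finsupp.mapDomain_of_notMem_range _ _ ha, map_zero]
  | mul g g' hg hg' => rw [map_mul, oddPartial_mul, hg, hg', zero_mul, mul_zero, add_zero]
  | add g g' hg hg' => rw [map_add, map_add, hg, hg', add_zero]

end Grassmann

section SuperFn
variable {S₀ S₀' : Type*} (S₁ : Type*) {S₁' : Type*}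

/-- The functions on the superdomain with the even coordinates `S₀`, ranging over the open set
`O ⊆ ℝ^S₀`, and with the odd coordinates `S₁`. -/
def SuperFn (O : Opens (S₀ → ℝ)) : Type _ := smoothFn O ⊗[ℂ] Grassmann S₁

instance (O : Opens (S₀ → ℝ)) : Ring (SuperFn S₁ O) :=
  inferInstanceAs (Ring (smoothFn O ⊗[ℂ] Grassmann S₁))

instance (O : Opens (S₀ → ℝ)) : Algebra ℂ (SuperFn S₁ O) :=
  inferInstanceAs (Algebra ℂ (smoothFn O ⊗[ℂ] Grassmann S₁))

variable {S₁}

/-- The product of a smooth function of the even coordinates and an element of the Grassmann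
algebra. -/
def SuperFn.tmul {O : Opens (S₀ → ℝ)} (f : smoothFn O) (g : Grassmann S₁) : SuperFn S₁ O :=
  f ⊗ₜ[ℂ] g

@[elab_as_elim]
theorem SuperFn.induction {O : Opens (S₀ → ℝ)} {P : SuperFn S₁ O → Prop} (a : SuperFn S₁ O)
    (zero : P 0) (tmul : ∀ f g, P (SuperFn.tmul f g)) (add : ∀ a b, P a → P b → P (a + b)) :
    P a :=
  TensorProduct.induction_on (motive := P) a zero tmul add

theorem SuperFn.tmul_mul_tmul {O : Opens (S₀ → ℝ)} (f f' : smoothFn O) (g g' : Grassmann S₁) :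
    tmul f g * tmul f' g' = tmul (f * f') (g * g') :=
  Algebra.TensorProduct.tmul_mul_tmul f f' g g'

theorem SuperFn.tmul_add {O : Opens (S₀ → ℝ)} (f : smoothFn O) (g g' : Grassmann S₁) :
    tmul f (g + g') = tmul f g + tmul f g' := TensorProduct.tmul_add f g g'

theorem SuperFn.tmul_neg {O : Opens (S₀ → ℝ)} (f : smoothFn O) (g : Grassmann S₁) :
    tmul f (-g) = -tmul f g := TensorProduct.tmul_neg f g

theorem SuperFn.add_tmul {O : Opens (S₀ → ℝ)} (f f' : smoothFn O) (g : Grassmann S₁) :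
    tmul (f + f') g = tmul f g + tmul f' g := TensorProduct.add_tmul f f' g

theorem SuperFn.tmul_smul {O : Opens (S₀ → ℝ)} (c : ℂ) (f : smoothFn O) (g : Grassmann S₁) :
    tmul f (c • g) = c • tmul f g := TensorProduct.tmul_smul c f g

theorem SuperFn.zero_tmul {O : Opens (S₀ → ℝ)} (g : Grassmann S₁) :
    tmul (0 : smoothFn O) g = 0 := TensorProduct.zero_tmul _ g

theorem SuperFn.tmul_zero {O : Opens (S₀ → ℝ)} (f : smoothFn O) :
    tmul f (0 : Grassmann S₁) = 0 := TensorProduct.tmul_zero _ f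

/-- The parity involution of superfunctions. -/
def SuperFn.parLin {O : Opens (S₀ → ℝ)} : Module.End ℂ (SuperFn S₁ O) :=
  LinearMap.lTensor (smoothFn O) (Superspace.par (V := Grassmann S₁))

instance (O : Opens (S₀ → ℝ)) : Superspace (SuperFn S₁ O) where
  par := SuperFn.parLin
  par_par := fun a => by
    induction a using SuperFn.induction with
    | zero => simp
    | tmul f g => exact congrArg (SuperFn.tmul f) (par_par g)
    | add a b ha hb => rw [map_add, map_add, ha, hb]

theorem SuperFn.par_tmul {O : Opens (S₀ → ℝ)} (f : smoothFn O) (g : Grassmann S₁) :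
    par (tmul f g) = tmul f (par g) := rfl

instance (O : Opens (S₀ → ℝ)) : Superalgebra (SuperFn S₁ O) where
  par_mul := fun a b => by
    change par (a * b) = par a * par b
    induction a using SuperFn.induction with
    | zero => simp
    | tmul f g =>
      induction b using SuperFn.induction with
      | zero => simp
      | tmul f' g' =>
        simp only [SuperFn.tmul_mul_tmul, SuperFn.par_tmul, par_mul]
      | add a b ha hb => rw [map_add, mul_add, map_add, mul_add, ha, hb]
    | add a b ha hb => rw [map_add, add_mul, map_add, add_mul, ha, hb]

theorem SuperFn.ev_tmul {O : Opens (S₀ → ℝ)} (f : smoothFn O) (g : Grassmann S₁) :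
    ev (tmul f g) = tmul f (ev g) := by
  rw [ev_apply, ev_apply, par_tmul, tmul_smul, tmul_add]

theorem SuperFn.od_tmul {O : Opens (S₀ → ℝ)} (f : smoothFn O) (g : Grassmann S₁) :
    od (tmul f g) = tmul f (od g) := by
  rw [od_apply, od_apply, par_tmul, tmul_smul, sub_eq_add_neg, sub_eq_add_neg, tmul_add, tmul_neg]

instance (O : Opens (S₀ → ℝ)) : Supercommutative (SuperFn S₁ O) where
  comm := fun a b => by
    induction a using SuperFn.induction with
    | zero => simp
    | tmul f g =>
      induction b using SuperFn.induction with
      | zero => simp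
      | tmul f' g' =>
        simp only [SuperFn.par_tmul, SuperFn.ev_tmul, SuperFn.od_tmul, SuperFn.tmul_mul_tmul]
        rw [Supercommutative.comm g g', SuperFn.tmul_add, mul_comm f f']
      | add a b ha hb => rw [map_add, mul_add, ha, hb]; noncomm_ring
    | add a b ha hb => rw [map_add, map_add, add_mul, ha, hb]; noncomm_ring

/-- The coordinate functions. -/
def SuperFn.coord (O : Opens (S₀ → ℝ)) : S₀ ⊕ S₁ → SuperFn S₁ O
  | .inl s => tmul (smoothCoord O s) 1
  | .inr a => tmul 1 (ExteriorAlgebra.ι ℂ (Finsupp.single a 1))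

/-- The left partial derivatives. -/
def SuperFn.partialLin {O : Opens (S₀ → ℝ)} : S₀ ⊕ S₁ → Module.End ℂ (SuperFn S₁ O)
  | .inl s => LinearMap.rTensor (Grassmann S₁) (smoothPartial (O := O) s)
  | .inr a => LinearMap.lTensor (smoothFn O) (oddPartial a)

theorem SuperFn.partialLin_inl {O : Opens (S₀ → ℝ)} (s : S₀) (f : smoothFn O) (g : Grassmann S₁) :
    partialLin (.inl s) (tmul f g) = tmul (smoothPartial s f) g := rfl

theorem SuperFn.partialLin_inr {O : Opens (S₀ → ℝ)} (a : S₁) (f : smoothFn O) (g : Grassmann S₁) :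
    partialLin (.inr a) (tmul f g) = tmul f (oddPartial a g) := rfl

/-- The left partial derivatives as vector fields. -/
def SuperFn.partialDer {O : Opens (S₀ → ℝ)} (s : S₀ ⊕ S₁) : Der (SuperFn S₁ O) :=
  ⟨partialLin s, by
    cases s with
    | inl s =>
      refine mem_der_of_even ?_ fun a b => ?_
      · refine LinearMap.ext fun a => ?_
        rw [par_end_apply]
        induction a using SuperFn.induction with
        | zero => simp
        | tmul f g => rw [par_tmul, partialLin_inl, par_tmul, par_par, partialLin_inl]
        | add a b ha hb => simp only [map_add, ha, hb]
      · induction a using SuperFn.induction with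
        | zero => simp
        | tmul f g =>
          induction b using SuperFn.induction with
          | zero => simp
          | tmul f' g' =>
            simp only [tmul_mul_tmul, partialLin_inl, smoothPartial_mul, add_tmul]
          | add a b ha hb => simp only [map_add, mul_add, ha, hb]; abel
        | add a b ha hb => simp only [map_add, add_mul, ha, hb]; abel
    | inr s =>
      refine mem_der_of_odd ?_ fun a b => ?_
      · refine LinearMap.ext fun a => ?_
        rw [par_end_apply, LinearMap.neg_apply]
        induction a using SuperFn.induction with
        | zero => simp
        | tmul f g =>
          rw [par_tmul, partialLin_inr, par_tmul, par_oddPartial, par_par, partialLin_inr,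
            tmul_neg]
        | add a b ha hb => simp only [map_add, ha, hb]; abel
      · induction a using SuperFn.induction with
        | zero => simp
        | tmul f g =>
          induction b using SuperFn.induction with
          | zero => simp
          | tmul f' g' =>
            simp only [tmul_mul_tmul, partialLin_inr, oddPartial_mul, tmul_add, par_tmul]
          | add a b ha hb => simp only [map_add, mul_add, ha, hb]; abel
        | add a b ha hb => simp only [map_add, add_mul, ha, hb]; abel⟩

theorem SuperFn.partial_support {O : Opens (S₀ → ℝ)} (a : SuperFn S₁ O) :
    {s | partialLin s a ≠ 0}.Finite := by
  induction a using SuperFn.induction with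
  | zero => simp
  | tmul f g =>
    refine (((smoothPartial_support f).image Sum.inl).union
      ((oddPartial_support g).image Sum.inr)).subset fun s hs => ?_
    cases s with
    | inl s =>
      refine .inl ⟨s, fun h => hs ?_, rfl⟩
      rw [partialLin_inl, h, zero_tmul]
    | inr s =>
      refine .inr ⟨s, fun h => hs ?_, rfl⟩
      rw [partialLin_inr, h, tmul_zero]
  | add a b ha hb =>
    refine (ha.union hb).subset fun s hs => ?_
    by_contra h
    simp only [Set.mem_union, Set.mem_ofPred_eq, not_or, not_not] at h
    exact hs (by rw [map_add, h.1, h.2, add_zero])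

theorem SuperFn.summand_support {O : Opens (S₀ → ℝ)} (X : S₀ ⊕ S₁ → SuperFn S₁ O)
    (a : SuperFn S₁ O) : (Function.support fun s => X s * partialLin s a).Finite :=
  (partial_support a).subset fun s hs h => hs (by simp only [h, mul_zero])

/-- The action of the vector field `∑ X^s ∂_s`; the sum over `s` has finitely many non-zero
terms on every function. -/
def SuperFn.fieldLin {O : Opens (S₀ → ℝ)} (X : S₀ ⊕ S₁ → SuperFn S₁ O) :
    Module.End ℂ (SuperFn S₁ O) where
  toFun := fun a => ∑ᶠ s, X s * partialLin s a
  map_add' := fun a b => by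
    rw [← finsum_add_distrib (summand_support X a) (summand_support X b)]
    simp only [map_add, mul_add]
  map_smul' := fun c a => by
    rw [RingHom.id_apply, smul_finsum' c (summand_support X a)]
    simp only [map_smul, mul_smul_comm]

theorem SuperFn.fieldLin_apply {O : Opens (S₀ → ℝ)} (X : S₀ ⊕ S₁ → SuperFn S₁ O)
    (a : SuperFn S₁ O) : fieldLin X a = ∑ᶠ s, X s * partialLin s a := rfl

/-- The vector field `∑ X^s ∂_s`. -/
def SuperFn.field {O : Opens (S₀ → ℝ)} (X : S₀ ⊕ S₁ → SuperFn S₁ O) : Der (SuperFn S₁ O) :=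
  ⟨fieldLin X, fun a b => by
    classical
    set F : Finset (S₀ ⊕ S₁) := ((partial_support a).toFinset ∪ (partial_support b).toFinset) ∪
      ((partial_support (a * b)).toFinset ∪ (partial_support (par b)).toFinset) with hF
    set Y : Der (SuperFn S₁ O) := ∑ s ∈ F, derSMul (X s) (SuperFn.partialDer s) with hY
    have hYc : ∀ c : SuperFn S₁ O, (partial_support c).toFinset ⊆ F →
        fieldLin X c = (Y : Module.End ℂ (SuperFn S₁ O)) c := by
      intro c hc
      have h1 : (Y : Module.End ℂ (SuperFn S₁ O)) c = ∑ s ∈ F, X s * partialLin s c := by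
        rw [hY, Submodule.coe_sum, LinearMap.sum_apply]; rfl
      rw [h1, fieldLin_apply]
      refine finsum_eq_sum_of_support_subset _ fun s hs => hc ?_
      rw [Set.Finite.mem_toFinset]
      exact fun h => hs (by simp only [h, mul_zero])
    have ha := hYc a (by rw [hF]; grind)
    have hb := hYc b (by rw [hF]; grind)
    have hab := hYc (a * b) (by rw [hF]; grind)
    have hpb := hYc (par b) (by rw [hF]; grind)
    have he : (ev (fieldLin X)) b = (ev (Y : Module.End ℂ (SuperFn S₁ O))) b := by
      simp only [ev_apply, LinearMap.smul_apply, LinearMap.add_apply, par_end_apply, hb, hpb]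
    have ho : (od (fieldLin X)) b = (od (Y : Module.End ℂ (SuperFn S₁ O))) b := by
      simp only [od_apply, LinearMap.smul_apply, LinearMap.sub_apply, par_end_apply, hb, hpb]
    rw [ha, hab, he, ho, Y.2]⟩

/-- The pull-back of functions along the projection of superdomains given by injections of the
coordinates. -/
def SuperFn.pull (O : Opens (S₀ → ℝ)) (O' : Opens (S₀' → ℝ)) (j₀ : S₀ → S₀') (j₁ : S₁ → S₁')
    (hO : ∀ p ∈ O', p ∘ j₀ ∈ O) : SuperFn S₁ O →ₐ[ℂ] SuperFn S₁' O' :=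
  Algebra.TensorProduct.map (smoothPull O O' j₀ hO) (grassmannPull j₁)

section Pull
variable {O : Opens (S₀ → ℝ)} {O' : Opens (S₀' → ℝ)} {j₀ : S₀ → S₀'} {j₁ : S₁ → S₁'}
  {hO : ∀ p ∈ O', p ∘ j₀ ∈ O}

theorem SuperFn.pull_tmul (f : smoothFn O) (g : Grassmann S₁) :
    pull O O' j₀ j₁ hO (tmul f g) = tmul (smoothPull O O' j₀ hO f) (grassmannPull j₁ g) := rfl

theorem SuperFn.par_pull (a : SuperFn S₁ O) :
    par (pull O O' j₀ j₁ hO a) = pull O O' j₀ j₁ hO (par a) := by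
  induction a using SuperFn.induction with
  | zero => simp
  | tmul f g => rw [pull_tmul, par_tmul, par_tmul, pull_tmul, par_grassmannPull]
  | add a b ha hb => simp only [map_add, ha, hb]

theorem SuperFn.partial_pull (h₀ : Function.Injective j₀) (h₁ : Function.Injective j₁)
    (s : S₀ ⊕ S₁) (a : SuperFn S₁ O) :
    partialLin (Sum.map j₀ j₁ s) (pull O O' j₀ j₁ hO a)
      = pull O O' j₀ j₁ hO (partialLin s a) := by
  induction a using SuperFn.induction with
  | zero => simp
  | tmul f g =>
    cases s with
    | inl s =>
      rw [pull_tmul, Sum.map_inl, partialLin_inl, partialLin_inl, pull_tmul, smoothPartial_pull h₀]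
    | inr s =>
      rw [pull_tmul, Sum.map_inr, partialLin_inr, partialLin_inr, pull_tmul, oddPartial_pull h₁]
  | add a b ha hb => simp only [map_add, ha, hb]

theorem SuperFn.partial_pull_of_notMem (s : S₀' ⊕ S₁') (hs : s ∉ Set.range (Sum.map j₀ j₁))
    (a : SuperFn S₁ O) : partialLin s (pull O O' j₀ j₁ hO a) = 0 := by
  induction a using SuperFn.induction with
  | zero => simp
  | tmul f g =>
    cases s with
    | inl s =>
      rw [pull_tmul, partialLin_inl, smoothPartial_pull_of_notMem hO s, zero_tmul]
      rintro ⟨t, rfl⟩; exact hs ⟨.inl t, rfl⟩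
    | inr s =>
      rw [pull_tmul, partialLin_inr, oddPartial_pull_of_notMem s, tmul_zero]
      rintro ⟨t, rfl⟩; exact hs ⟨.inr t, rfl⟩
  | add a b ha hb => simp only [map_add, ha, hb, add_zero]

/-- If the coefficients of `X'` along the base are pulled back from those of `X`, then `X'`
projects to `X`. -/
theorem SuperFn.field_pull (h₀ : Function.Injective j₀) (h₁ : Function.Injective j₁)
    {X : S₀ ⊕ S₁ → SuperFn S₁ O} {X' : S₀' ⊕ S₁' → SuperFn S₁' O'}
    (hX : ∀ s, X' (Sum.map j₀ j₁ s) = pull O O' j₀ j₁ hO (X s)) (a : SuperFn S₁ O) :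
    fieldLin X' (pull O O' j₀ j₁ hO a) = pull O O' j₀ j₁ hO (fieldLin X a) := by
  have hinj : Function.Injective (Sum.map j₀ j₁) := h₀.sumMap h₁
  have e1 : pull O O' j₀ j₁ hO (fieldLin X a)
      = ∑ᶠ s, pull O O' j₀ j₁ hO (X s * partialLin s a) :=
    AddMonoidHom.map_finsum (pull O O' j₀ j₁ hO : SuperFn S₁ O →+ SuperFn S₁' O')
      (summand_support X a)
  classical
  have e2 : ∑ᶠ s, X' s * partialLin s (pull O O' j₀ j₁ hO a)
      = ∑ᶠ (s) (_ : s ∈ Set.range (Sum.map j₀ j₁)),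
        X' s * partialLin s (pull O O' j₀ j₁ hO a) := by
    refine finsum_congr fun s => ?_
    by_cases hs : s ∈ Set.range (Sum.map j₀ j₁)
    · rw [finsum_eq_if, if_pos hs]
    · rw [finsum_eq_if, if_neg hs, partial_pull_of_notMem s hs, mul_zero]
  rw [e1, fieldLin_apply, e2, finsum_mem_range hinj]
  refine finsum_congr fun s => ?_
  rw [partial_pull h₀ h₁, hX, map_mul]

end Pull

end SuperFn
/-! ### Jets, differential equations and coverings -/

section Jets

/-- Even coordinates on the jet space: the independent variables `x^i` and the jets `u^k_I` of the
even unknowns. -/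
abbrev JetEven (n m₀ : ℕ) : Type := Fin n ⊕ (Fin m₀ × (Fin n →₀ ℕ))

/-- Odd coordinates on the jet space: the jets `ξ^a_I` of the odd unknowns. -/
abbrev JetOdd (n m₁ : ℕ) : Type := Fin m₁ × (Fin n →₀ ℕ)

variable {n m₀ m₁ : ℕ}

/-- The coefficients of the total derivative
`D_i = ∂/∂x^i + ∑ u^k_{I+1_i} ∂/∂u^k_I + ∑ ξ^a_{I+1_i} ∂/∂ξ^a_I`. -/
def totalCoeff (O : Opens (JetEven n m₀ → ℝ)) (i : Fin n) :
    JetEven n m₀ ⊕ JetOdd n m₁ → SuperFn (JetOdd n m₁) O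
  | .inl (.inl j) => if j = i then 1 else 0
  | .inl (.inr (k, I)) => SuperFn.coord O (.inl (.inr (k, I + Finsupp.single i 1)))
  | .inr (a, I) => SuperFn.coord O (.inr (a, I + Finsupp.single i 1))

/-- The total derivative `D_i`. -/
def totalDer (O : Opens (JetEven n m₀ → ℝ)) (i : Fin n) : Der (SuperFn (JetOdd n m₁) O) :=
  SuperFn.field (totalCoeff O i)

theorem par_coord_inl {S₀ S₁ : Type*} (O : Opens (S₀ → ℝ)) (s : S₀) :
    par (SuperFn.coord (S₁ := S₁) O (.inl s)) = SuperFn.coord O (.inl s) := by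
  rw [SuperFn.coord, SuperFn.par_tmul, par_one]

theorem par_coord_inr {S₀ S₁ : Type*} (O : Opens (S₀ → ℝ)) (a : S₁) :
    par (SuperFn.coord O (.inr a)) = -SuperFn.coord O (.inr a) := by
  rw [SuperFn.coord, SuperFn.par_tmul, par_ι, SuperFn.tmul_neg]

theorem par_partialLin_inl {S₀ S₁ : Type*} {O : Opens (S₀ → ℝ)} (s : S₀) (a : SuperFn S₁ O) :
    par (SuperFn.partialLin (.inl s) a) = SuperFn.partialLin (.inl s) (par a) := by
  induction a using SuperFn.induction with
  | zero => simp
  | tmul f g => rfl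
  | add a b ha hb => simp only [map_add, ha, hb]

theorem par_partialLin_inr {S₀ S₁ : Type*} {O : Opens (S₀ → ℝ)} (s : S₁) (a : SuperFn S₁ O) :
    par (SuperFn.partialLin (.inr s) a) = -SuperFn.partialLin (.inr s) (par a) := by
  induction a using SuperFn.induction with
  | zero => simp
  | tmul f g =>
    rw [SuperFn.partialLin_inr, SuperFn.par_tmul, SuperFn.par_tmul, SuperFn.partialLin_inr,
      par_oddPartial, SuperFn.tmul_neg]
  | add a b ha hb => simp only [map_add, ha, hb]; abel

theorem par_totalDer (O : Opens (JetEven n m₀ → ℝ)) (i : Fin n)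
    (a : SuperFn (JetOdd n m₁) O) :
    par ((totalDer (m₁ := m₁) O i : Module.End ℂ (SuperFn (JetOdd n m₁) O)) a)
      = (totalDer (m₁ := m₁) O i : Module.End ℂ (SuperFn (JetOdd n m₁) O)) (par a) := by
  change par (SuperFn.fieldLin _ a) = SuperFn.fieldLin _ (par a)
  have e1 : par (SuperFn.fieldLin (totalCoeff O i) a)
      = ∑ᶠ s, par (totalCoeff O i s * SuperFn.partialLin s a) :=
    AddMonoidHom.map_finsum ((par (V := SuperFn (JetOdd n m₁) O)).toAddMonoidHom)
      (SuperFn.summand_support _ a)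
  rw [e1, SuperFn.fieldLin_apply]
  refine finsum_congr fun s => ?_
  rw [par_mul]
  rcases s with (j | s) | s
  · have : par (totalCoeff (m₁ := m₁) O i (.inl (.inl j))) = totalCoeff O i (.inl (.inl j)) := by
      change par (if j = i then (1 : SuperFn (JetOdd n m₁) O) else 0) = if j = i then 1 else 0
      split_ifs <;> simp [par_one]
    rw [this, par_partialLin_inl]
  · have : par (totalCoeff (m₁ := m₁) O i (.inl (.inr s))) = totalCoeff O i (.inl (.inr s)) :=
      par_coord_inl O _
    rw [this, par_partialLin_inl]
  · have : par (totalCoeff (m₁ := m₁) O i (.inr s)) = -totalCoeff O i (.inr s) :=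
      par_coord_inr O _
    rw [this, par_partialLin_inr, neg_mul_neg]

end Jets

/-- A system of partial differential equations `F^ℓ = 0` with `n` even independent variables, `m₀`
even and `m₁` odd unknowns, over an open domain of the infinite jet space. -/
structure PDESystem (n m₀ m₁ : ℕ) where
  domain : Opens (JetEven n m₀ → ℝ)
  size : ℕ
  F : Fin size → SuperFn (JetOdd n m₁) domain
  homogeneous : ∀ ℓ, par (F ℓ) = F ℓ ∨ par (F ℓ) = -F ℓ

namespace PDESystem
variable {n m₀ m₁ : ℕ} (E : PDESystem n m₀ m₁)

/-- The equations `F^ℓ` and all their differential consequences `D_{i₁} ⋯ D_{iₛ} F^ℓ`. -/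
def consequences : Set (SuperFn (JetOdd n m₁) E.domain) :=
  {G | ∃ (ℓ : Fin E.size) (L : List (Fin n)), G = L.foldr
    (fun i H => (totalDer (m₁ := m₁) E.domain i : Module.End ℂ (SuperFn (JetOdd n m₁) E.domain)) H) (E.F ℓ)}

/-- The ideal of the infinite prolongation `E^∞`. -/
def ideal : Ideal (SuperFn (JetOdd n m₁) E.domain) := Ideal.span E.consequences


theorem par_consequences {G : SuperFn (JetOdd n m₁) E.domain} (hG : G ∈ E.consequences) :
    par G = G ∨ par G = -G := by
  obtain ⟨ℓ, L, rfl⟩ := hG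
  induction L with
  | nil => exact E.homogeneous ℓ
  | cons i L ih =>
    rw [List.foldr_cons, par_totalDer]
    rcases ih with h | h
    · rw [h]; exact .inl rfl
    · rw [h, map_neg]; exact .inr rfl

instance : IsSuperIdeal E.ideal := isSuperIdeal_span fun G hG => by
  rcases E.par_consequences hG with h | h
  · rw [h]; exact Ideal.subset_span hG
  · rw [h]; exact neg_mem (Ideal.subset_span hG)

/-- The functions on the infinite prolongation `E^∞`, which is generated by the equations of the
system and all their differential consequences. -/
abbrev Fn : Type := SuperFn (JetOdd n m₁) E.domain ⧸ E.ideal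

theorem totalDer_mem (i : Fin n) : ∀ a ∈ E.ideal,
    (totalDer (m₁ := m₁) E.domain i : Module.End ℂ (SuperFn (JetOdd n m₁) E.domain)) a ∈ E.ideal :=
  haveI : IsSuperIdeal (Ideal.span E.consequences) := inferInstanceAs (IsSuperIdeal E.ideal)
  Der.map_span_mem (totalDer (m₁ := m₁) E.domain i) fun G hG => by
    have h1 : (totalDer (m₁ := m₁) E.domain i : Module.End ℂ (SuperFn (JetOdd n m₁) E.domain)) G
        ∈ Ideal.span E.consequences := by
      obtain ⟨ℓ, L, rfl⟩ := hG
      exact Ideal.subset_span ⟨ℓ, i :: L, rfl⟩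
    refine ⟨h1, ?_⟩
    rcases E.par_consequences hG with h | h
    · rw [h]; exact h1
    · rw [h, map_neg]; exact neg_mem h1

/-- The restriction `D̄_i` of the total derivative to `E^∞`. -/
def dBar (i : Fin n) : Der E.Fn := Der.restrict E.ideal (totalDer E.domain i) (E.totalDer_mem i)

/-! #### The product `W × E^∞` with the superspace `W` of dimension `(k₀ | k₁)` -/

variable (k₀ k₁ : ℕ)

/-- The part of `J^∞ × ℝ^k₀` over the domain of the system. -/
def covDomain : Opens (JetEven n m₀ ⊕ Fin k₀ → ℝ) :=
  ⟨{p | p ∘ Sum.inl ∈ E.domain}, E.domain.isOpen.preimage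
    (continuous_pi fun s => continuous_apply (Sum.inl s))⟩

/-- The functions on `J^∞ × W`. -/
abbrev AmbientFn : Type := SuperFn (JetOdd n m₁ ⊕ Fin k₁) (E.covDomain k₀)

/-- The pull-back of functions along `J^∞ × W → J^∞`. -/
def pullJet : SuperFn (JetOdd n m₁) E.domain →ₐ[ℂ] E.AmbientFn k₀ k₁ :=
  SuperFn.pull E.domain (E.covDomain k₀) Sum.inl Sum.inl fun _ hp => hp

/-- The ideal of `W × E^∞` in `J^∞ × W`. -/
def covIdeal : Ideal (E.AmbientFn k₀ k₁) := Ideal.span (E.pullJet k₀ k₁ '' E.ideal)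

theorem par_pullJet (a : SuperFn (JetOdd n m₁) E.domain) :
    par (E.pullJet k₀ k₁ a) = E.pullJet k₀ k₁ (par a) := SuperFn.par_pull a

instance : IsSuperIdeal (E.covIdeal k₀ k₁) := isSuperIdeal_span fun b hb => by
  obtain ⟨a, ha, rfl⟩ := hb
  rw [par_pullJet]
  exact Ideal.subset_span ⟨_, IsSuperIdeal.par_mem a ha, rfl⟩

/-- The functions on `W × E^∞`. -/
abbrev CovFn : Type := E.AmbientFn k₀ k₁ ⧸ E.covIdeal k₀ k₁

/-- The pull-back of functions along the projection `W × E^∞ → E^∞`. -/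
def pullEq : E.Fn →ₐ[ℂ] E.CovFn k₀ k₁ :=
  Ideal.Quotient.liftₐ E.ideal
    ((Ideal.Quotient.mkₐ ℂ (E.covIdeal k₀ k₁)).comp (E.pullJet k₀ k₁)) fun a ha =>
      Ideal.Quotient.eq_zero_iff_mem.2 (Ideal.subset_span ⟨a, ha, rfl⟩)

/-- The coefficients of the lift of `D_i` to `J^∞ × W` that acts trivially along `W`. -/
def covTotalCoeff (i : Fin n) :
    (JetEven n m₀ ⊕ Fin k₀) ⊕ (JetOdd n m₁ ⊕ Fin k₁) → E.AmbientFn k₀ k₁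
  | .inl (.inl s) => E.pullJet k₀ k₁ (totalCoeff E.domain i (.inl s))
  | .inr (.inl s) => E.pullJet k₀ k₁ (totalCoeff E.domain i (.inr s))
  | .inl (.inr _) => 0
  | .inr (.inr _) => 0

theorem covTotal_mem (i : Fin n) : ∀ a ∈ E.covIdeal k₀ k₁,
    (SuperFn.field (E.covTotalCoeff k₀ k₁ i) : Module.End ℂ (E.AmbientFn k₀ k₁)) a
      ∈ E.covIdeal k₀ k₁ :=
  haveI : IsSuperIdeal (Ideal.span (E.pullJet k₀ k₁ '' E.ideal)) :=
    inferInstanceAs (IsSuperIdeal (E.covIdeal k₀ k₁))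
  Der.map_span_mem _ fun b hb => by
    obtain ⟨a, ha, rfl⟩ := hb
    have h : ∀ c ∈ E.ideal,
        (SuperFn.field (E.covTotalCoeff k₀ k₁ i) : Module.End ℂ (E.AmbientFn k₀ k₁))
          (E.pullJet k₀ k₁ c) ∈ Ideal.span (E.pullJet k₀ k₁ '' E.ideal) := by
      intro c hc
      have e : (SuperFn.field (E.covTotalCoeff k₀ k₁ i) : Module.End ℂ (E.AmbientFn k₀ k₁))
          (E.pullJet k₀ k₁ c) = E.pullJet k₀ k₁ ((totalDer (m₁ := m₁) E.domain i :
            Module.End ℂ (SuperFn (JetOdd n m₁) E.domain)) c) :=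
        SuperFn.field_pull Sum.inl_injective Sum.inl_injective (by rintro (s | s) <;> rfl) c
      rw [e]
      exact Ideal.subset_span ⟨_, E.totalDer_mem i c hc, rfl⟩
    rw [par_pullJet]
    exact ⟨h a ha, h _ (IsSuperIdeal.par_mem a ha)⟩

/-- The lift of `D̄_i` to `W × E^∞` that acts trivially along `W`. -/
def dBarLift (i : Fin n) : Der (E.CovFn k₀ k₁) :=
  Der.restrict (E.covIdeal k₀ k₁) (SuperFn.field (E.covTotalCoeff k₀ k₁ i))
    (E.covTotal_mem k₀ k₁ i)

/-- The partial derivatives `∂/∂w^p` and `∂/∂f^q` on `J^∞ × W`. -/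
def ambientNonlocal (s : Fin k₀ ⊕ Fin k₁) : Der (E.AmbientFn k₀ k₁) :=
  SuperFn.partialDer (Sum.map Sum.inr Sum.inr s)

theorem nonlocal_mem (s : Fin k₀ ⊕ Fin k₁) : ∀ a ∈ E.covIdeal k₀ k₁,
    (E.ambientNonlocal k₀ k₁ s : Module.End ℂ (E.AmbientFn k₀ k₁)) a
      ∈ E.covIdeal k₀ k₁ :=
  haveI : IsSuperIdeal (Ideal.span (E.pullJet k₀ k₁ '' E.ideal)) :=
    inferInstanceAs (IsSuperIdeal (E.covIdeal k₀ k₁))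
  Der.map_span_mem _ fun b hb => by
    obtain ⟨a, ha, rfl⟩ := hb
    have h : ∀ c, (E.ambientNonlocal k₀ k₁ s :
        Module.End ℂ (E.AmbientFn k₀ k₁)) (E.pullJet k₀ k₁ c) = 0 := fun c =>
      SuperFn.partial_pull_of_notMem _ (by rcases s with s | s <;> rintro ⟨t | t, h⟩ <;> simp at h) c
    rw [par_pullJet, h, h]
    exact ⟨zero_mem _, zero_mem _⟩

/-- The derivations `∂/∂w^p` and `∂/∂f^q` along the nonlocal variables. -/
def nonlocalDer (s : Fin k₀ ⊕ Fin k₁) : Der (E.CovFn k₀ k₁) :=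
  Der.restrict (E.covIdeal k₀ k₁) (E.ambientNonlocal k₀ k₁ s)
    (E.nonlocal_mem k₀ k₁ s)

/-- The independent variable `x^i`. -/
def indep (i : Fin n) : E.CovFn k₀ k₁ :=
  Ideal.Quotient.mk _ (SuperFn.coord _ (.inl (.inl (.inl i))))

theorem par_indep (i : Fin n) : par (E.indep k₀ k₁ i) = E.indep k₀ k₁ i :=
  congrArg (Ideal.Quotient.mk (E.covIdeal k₀ k₁)) (par_coord_inl _ _)

end PDESystem

/-- The functions on the superspace `W` of dimension `(k₀ | k₁)`. -/
abbrev WFn (k₀ k₁ : ℕ) : Type := SuperFn (Fin k₁) (⊤ : Opens (Fin k₀ → ℝ))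

/-- The pull-back of functions along `W × E^∞ → W`. -/
def PDESystem.pullW {n m₀ m₁ : ℕ} (E : PDESystem n m₀ m₁) (k₀ k₁ : ℕ) :
    WFn k₀ k₁ →ₐ[ℂ] E.CovFn k₀ k₁ :=
  (Ideal.Quotient.mkₐ ℂ (E.covIdeal k₀ k₁)).comp
    (SuperFn.pull ⊤ (E.covDomain k₀) Sum.inr Sum.inr fun _ _ => trivial)

/-! ### Lie superalgebras and their representations -/

section Matrices
variable {a b : ℕ}

/-- The sign of a row or column of a supermatrix. -/
def blockSign : Fin a ⊕ Fin b → ℂ := Sum.elim (fun _ => 1) (fun _ => -1)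

theorem blockSign_mul_self (i : Fin a ⊕ Fin b) : blockSign i * blockSign i = 1 := by
  rcases i with i | i <;> simp [blockSign]

/-- Supermatrices: the diagonal blocks are even and the off-diagonal blocks are odd. -/
instance : Superalgebra (Matrix (Fin a ⊕ Fin b) (Fin a ⊕ Fin b) ℂ) where
  par :=
    { toFun := fun M => Matrix.of fun i j => blockSign i * M i j * blockSign j
      map_add' := fun M N => by ext i j; simp [mul_add, add_mul]
      map_smul' := fun c M => by ext i j; simp; ring }
  par_par := fun M => by
    ext i j
    change blockSign i * (blockSign i * M i j * blockSign j) * blockSign j = M i j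
    linear_combination (blockSign j * blockSign j * M i j) * blockSign_mul_self i
      + M i j * blockSign_mul_self j
  par_mul := fun M N => by
    ext i j
    change blockSign i * (M * N) i j * blockSign j
      = ∑ l, (blockSign i * M i l * blockSign l) * (blockSign l * N l j * blockSign j)
    rw [Matrix.mul_apply, Finset.mul_sum, Finset.sum_mul]
    refine Finset.sum_congr rfl fun l _ => ?_
    linear_combination (-(blockSign i * M i l * N l j * blockSign j)) * blockSign_mul_self l

end Matrices

/-- The supermatrices `Mat(k₀ + 1 | k₁)`. -/
abbrev SMat (k₀ k₁ : ℕ) : Type :=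
  Matrix (Fin (k₀ + 1) ⊕ Fin k₁) (Fin (k₀ + 1) ⊕ Fin k₁) ℂ

/-- A Lie superalgebra `𝔤 ⊆ 𝔤𝔩(k₀ + 1 | k₁)`. -/
structure MatLieSuperalgebra (k₀ k₁ : ℕ) where
  carrier : Submodule ℂ (SMat k₀ k₁)
  par_mem : ∀ x ∈ carrier, par x ∈ carrier
  bracket_mem : ∀ x ∈ carrier, ∀ y ∈ carrier, superBracket x y ∈ carrier

namespace MatLieSuperalgebra
variable {k₀ k₁ : ℕ} (g : MatLieSuperalgebra k₀ k₁)

/-- The vector superspace of `𝔤`. -/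
abbrev Elt : Type := ↥g.carrier

instance : Superspace g.Elt where
  par := (par (V := SMat k₀ k₁)).restrict g.par_mem
  par_par := fun x => Subtype.ext (par_par (x : SMat k₀ k₁))

/-- The bracket of `𝔤`. -/
def bracket : g.Elt →ₗ[ℂ] g.Elt →ₗ[ℂ] g.Elt :=
  LinearMap.mk₂ ℂ (fun x y => ⟨superBracket (x : SMat k₀ k₁) (y : SMat k₀ k₁),
      g.bracket_mem x x.2 y y.2⟩)
    (fun _ _ _ => Subtype.ext (by simp)) (fun _ _ _ => Subtype.ext (by simp))
    (fun _ _ _ => Subtype.ext (by simp)) (fun _ _ _ => Subtype.ext (by simp))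

end MatLieSuperalgebra

/-- A faithful matrix representation `ρ : 𝔤 → Mat(k₀ + 1 | k₁)`. -/
structure MatRep {k₀ k₁ : ℕ} (g : MatLieSuperalgebra k₀ k₁) where
  toLin : g.Elt →ₗ[ℂ] SMat k₀ k₁
  map_par : ∀ x, toLin (par x) = par (toLin x)
  map_bracket : ∀ x y, toLin (g.bracket x y) = superBracket (toLin x) (toLin y)
  injective : Function.Injective toLin

/-- A representation `ϱ : 𝔤 → Vect(W; poly)` by the vector fields
`∑ X^p ∂/∂w^p + ∑ X^q ∂/∂f^q` on `W` with polynomial coefficients. -/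
structure VectRep {k₀ k₁ : ℕ} (g : MatLieSuperalgebra k₀ k₁) where
  toLin : g.Elt →ₗ[ℂ] (Fin k₀ ⊕ Fin k₁ → WFn k₀ k₁)
  polynomial : ∀ x s, toLin x s ∈
    Algebra.adjoin ℂ (Set.range (SuperFn.coord (S₁ := Fin k₁) (⊤ : Opens (Fin k₀ → ℝ))))
  map_par : ∀ x, SuperFn.field (toLin (par x)) = par (SuperFn.field (toLin x))
  map_bracket : ∀ x y, SuperFn.field (toLin (g.bracket x y))
    = derBracket (SuperFn.field (toLin x)) (SuperFn.field (toLin y))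

/-- The row vector `(μ, w¹, …, w^k₀, f¹, …, f^k₁)`. -/
def projRow (k₀ k₁ : ℕ) (μ : ℝ) : Fin (k₀ + 1) ⊕ Fin k₁ → WFn k₀ k₁
  | .inl i => Fin.cases (algebraMap ℂ _ (μ : ℂ)) (fun p => SuperFn.coord ⊤ (.inl p)) i
  | .inr q => SuperFn.coord ⊤ (.inr q)

/-- The coefficients of the vector field `X_M = 𝒘 M ∂_𝒘` obtained from the matrix `M` by the
projective substitution; here the first entry of the column `∂_𝒘` is
`-(1/μ) (∑ w^p ∂/∂w^p + ∑ f^q ∂/∂f^q)`, and the other ones are `∂/∂w^p` and `∂/∂f^q`. -/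
def projField {k₀ k₁ : ℕ} (μ : ℝ) (M : SMat k₀ k₁) (s : Fin k₀ ⊕ Fin k₁) : WFn k₀ k₁ :=
  (∑ i, projRow k₀ k₁ μ i * algebraMap ℂ _ (M i (Sum.map Fin.succ id s)))
    - (∑ i, projRow k₀ k₁ μ i * algebraMap ℂ _ (M i (.inl 0)))
      * ((μ : ℂ)⁻¹ • SuperFn.coord ⊤ s)

/-! ### The two differentials -/

section Tensor
variable {A L : Type*} [Ring A] [Algebra ℂ A] [Superalgebra A] [AddCommGroup L] [Module ℂ L]
  [Superspace L]

/-- The bracket `[a ⊗ x, b ⊗ y] = (-1)^{p(x)p(b)} a b ⊗ [x, y]` on `A ⊗ L`. -/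
def tensorBracket (br : L →ₗ[ℂ] L →ₗ[ℂ] L) : A ⊗[ℂ] L →ₗ[ℂ] A ⊗[ℂ] L →ₗ[ℂ] A ⊗[ℂ] L :=
  TensorProduct.map₂ (LinearMap.mul ℂ A) (br ∘ₗ ev)
    + TensorProduct.map₂ ((LinearMap.mul ℂ A).compl₂ par) (br ∘ₗ od)

end Tensor

variable {n m₀ m₁ k₀ k₁ : ℕ} {E : PDESystem n m₀ m₁} {g : MatLieSuperalgebra k₀ k₁}

/-- The operator `D̄_i` on functions with values in a vector space. -/
def dBarTensor (E : PDESystem n m₀ m₁) (L : Type*) [AddCommGroup L] [Module ℂ L] (i : Fin n) :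
    E.Fn ⊗[ℂ] L →ₗ[ℂ] E.Fn ⊗[ℂ] L :=
  LinearMap.rTensor L (E.dBar i : Module.End ℂ E.Fn)

variable (E g) in
/-- An even `𝔤`-valued zero-curvature representation `α = ∑ dx^i α_i`, the components of the
Maurer–Cartan condition `d̄_h α = ½ [α, α]` being `D̄_i α_j - D̄_j α_i = [α_i, α_j]`. -/
structure ZCR where
  form : Fin n → E.Fn ⊗[ℂ] g.Elt
  even : ∀ i, TensorProduct.map (par (V := E.Fn)) (par (V := g.Elt)) (form i) = form i
  maurerCartan : ∀ i j, dBarTensor E g.Elt i (form j) - dBarTensor E g.Elt j (form i)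
    = tensorBracket g.bracket (form i) (form j)

/-- `ρ : Λ⁰(E^∞) ⊗ 𝔤 → Λ⁰(E^∞) ⊗ Mat(k₀ + 1 | k₁)`. -/
def MatRep.onFn (ρ : MatRep g) (E : PDESystem n m₀ m₁) :
    E.Fn ⊗[ℂ] g.Elt →ₗ[ℂ] E.Fn ⊗[ℂ] SMat k₀ k₁ := LinearMap.lTensor E.Fn ρ.toLin

theorem MatRep.onFn_injective (ρ : MatRep g) (E : PDESystem n m₀ m₁) :
    Function.Injective (ρ.onFn E) :=
  Module.Flat.lTensor_preserves_injective_linearMap ρ.toLin ρ.injective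

/-- `ρ` on horizontal one-forms `∑ dx^i β_i`, written as the families `β_i` of their
components. -/
def MatRep.onForms (ρ : MatRep g) (E : PDESystem n m₀ m₁) :
    (Fin n → E.Fn ⊗[ℂ] g.Elt) →ₗ[ℂ] (Fin n → E.Fn ⊗[ℂ] SMat k₀ k₁) :=
  (ρ.onFn E).compLeft (Fin n)

theorem MatRep.onForms_injective (ρ : MatRep g) (E : PDESystem n m₀ m₁) :
    Function.Injective (ρ.onForms E) := fun _ _ h =>
  funext fun i => ρ.onFn_injective E (congrFun h i)

/-- The vector field on `W × E^∞` given by the field `ϱ(x)` on `W`. -/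
def VectRep.lift (ϱ : VectRep g) (E : PDESystem n m₀ m₁) : g.Elt →ₗ[ℂ] Der (E.CovFn k₀ k₁) :=
  ∑ s, (derSMul (A := E.CovFn k₀ k₁)).flip (E.nonlocalDer k₀ k₁ s) ∘ₗ (E.pullW k₀ k₁).toLinearMap
    ∘ₗ LinearMap.proj s ∘ₗ ϱ.toLin

/-- `ϱ : Λ⁰(E^∞) ⊗ 𝔤 → D(Λ⁰(W × E^∞))`, `q ⊗ x ↦ q ϱ(x)`. -/
def VectRep.onFn (ϱ : VectRep g) (E : PDESystem n m₀ m₁) :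
    E.Fn ⊗[ℂ] g.Elt →ₗ[ℂ] Der (E.CovFn k₀ k₁) :=
  TensorProduct.lift (((derSMul (A := E.CovFn k₀ k₁)) ∘ₗ (E.pullEq k₀ k₁).toLinearMap).compl₂ (ϱ.lift E))

/-- `ϱ` on horizontal one-forms, `∑ dx^i β_i ↦ ∑ dx^i ϱ(β_i)`. -/
def VectRep.onForms (ϱ : VectRep g) (E : PDESystem n m₀ m₁) :
    (Fin n → E.Fn ⊗[ℂ] g.Elt) →ₗ[ℂ] DerForm (E.CovFn k₀ k₁) :=
  ∑ i, dMulDer (A := E.CovFn k₀ k₁) (E.indep k₀ k₁ i) (E.par_indep k₀ k₁ i) ∘ₗ ϱ.onFn E ∘ₗ LinearMap.proj i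

/-- The switch `∇ = ϱ ∘ ρ⁻¹` on `Λ⁰(E^∞) ⊗ ρ(𝔤)`. -/
def switchFn (E : PDESystem n m₀ m₁) (ρ : MatRep g) (ϱ : VectRep g) :
    LinearMap.range (ρ.onFn E) →ₗ[ℂ] Der (E.CovFn k₀ k₁) :=
  ϱ.onFn E ∘ₗ (LinearEquiv.ofInjective (ρ.onFn E) (ρ.onFn_injective E)).symm.toLinearMap

/-- The switch `∇ = ϱ ∘ ρ⁻¹` on `Λ¹(E^∞) ⊗ ρ(𝔤)`. -/
def switchForms (E : PDESystem n m₀ m₁) (ρ : MatRep g) (ϱ : VectRep g) :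
    LinearMap.range (ρ.onForms E) →ₗ[ℂ] DerForm (E.CovFn k₀ k₁) :=
  ϱ.onForms E ∘ₗ (LinearEquiv.ofInjective (ρ.onForms E) (ρ.onForms_injective E)).symm.toLinearMap

/-- `∂_α = d̄_h - [α, ·]` on `Λ⁰(E^∞) ⊗ Mat(k₀ + 1 | k₁)`, with `α` taken in the
representation `ρ`. -/
def ZCR.partialAlpha (α : ZCR E g) (ρ : MatRep g) :
    E.Fn ⊗[ℂ] SMat k₀ k₁ →ₗ[ℂ] (Fin n → E.Fn ⊗[ℂ] SMat k₀ k₁) :=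
  LinearMap.pi fun i => dBarTensor E (SMat k₀ k₁) i
    - tensorBracket superBracket (ρ.onFn E (α.form i))

/-- The total derivatives `D̃_i = D̄_i + ∑ w^p_i ∂/∂w^p + ∑ f^q_i ∂/∂f^q` of the covering, where
`w^p_i = -ϱ(α_i)(w^p)` and `f^q_i = -ϱ(α_i)(f^q)`. -/
def ZCR.dTilde (α : ZCR E g) (ϱ : VectRep g) (i : Fin n) : Der (E.CovFn k₀ k₁) :=
  E.dBarLift k₀ k₁ i - ϱ.onFn E (α.form i)

/-- The characteristic element of the covering, that is, its connection form
`U(h) = dh - ∑ dx^i D̃_i(h)`; in particular `U(w^p) = dw^p - ∑ w^p_i dx^i`. -/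
def ZCR.charElement (α : ZCR E g) (ϱ : VectRep g) : DerForm (E.CovFn k₀ k₁) :=
  dDer (E.CovFn k₀ k₁) - ∑ i, dMulDer (A := E.CovFn k₀ k₁) (E.indep k₀ k₁ i) (E.par_indep k₀ k₁ i) (α.dTilde ϱ i)

/-- `∂_U = [·, U]` with the Frölicher–Nijenhuis bracket. -/
def ZCR.partialU (α : ZCR E g) (ϱ : VectRep g) (X : Der (E.CovFn k₀ k₁)) :
    E.CovFn k₀ k₁ →ₗ[ℂ] Functional (E.CovFn k₀ k₁) :=
  fnBracket X (α.charElement ϱ)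

end SuperGeom

end

open SuperGeom

/-! Both differentials are images of one operator on Λ⁰(E^∞) ⊗ 𝔤, namely γ ↦ (D̄_i γ - [α_i, γ])_i,
which is `ZCR.differential`. The homomorphism ρ carries it to ∂_α, because D̄_i touches only the
function factor and ρ respects brackets and parity (`ZCR.onForms_differential`). This also places
∂_α(ρ(γ)) in the image of ρ, where ∇ = ϱ ∘ ρ⁻¹ makes sense. What remains is that ϱ carries the same
operator to ∂_U (`ZCR.onForms_differential_eq_partialU`).

Write U = d - ∑ dx^i D̃_i. Lie derivatives commute with d, and a vertical field X annihilates every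
x^i, so [X, U] = ∑ dx^i [D̃_i, X] (`fnBracket_connection`). Take X = ϱ(γ) and D̃_i = D̄_i - ϱ(α_i).
The lifted D̄_i commutes with fields that come from W, hence [D̄_i, ϱ(γ)] = ϱ(D̄_i γ)
(`VectRep.onFn_dBarTensor`). Vertical fields annihilate coefficients that come from E^∞ and ϱ is a
representation, hence [ϱ(α_i), ϱ(γ)] = ϱ([α_i, γ]) (`VectRep.onFn_tensorBracket`).

A smooth function of all the variables need not be a finite sum of products of functions of W and of
E^∞, so an identity between vertical fields cannot be tested on pull-backs as if they generated the
algebra. Instead, combinations of the ∂/∂w^p and ∂/∂f^q are closed under parity and bracket and are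
determined by their values on w^p and f^q (`derBracket_mem_range_frameField`,
`eq_of_mem_range_frameField`). On these coordinates the identities reduce to those on W.

For the projective substitution, X_M w_j = (𝒘M)_j - μ⁻¹ (𝒘M)_0 w_j for all j, including w_0 = μ.
Therefore X_M X_N w_j equals (𝒘MN)_j - μ⁻¹ (𝒘MN)_0 w_j plus terms that are supersymmetric in M and
N, and these drop out of the supercommutator.

Signs for inhomogeneous elements are carried by `ev`, `od` and `par`: for homogeneous v, `par v`
stands for (-1)^{p(v)} v. -/

noncomputable section

namespace SuperGeom

/-! ### Even and odd components -/

section Graded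
variable {V : Type*} [AddCommGroup V] [Module ℂ V] [Superspace V]

theorem ev_of_even {v : V} (h : par v = v) : ev v = v := by rw [ev_apply, h]; module
theorem od_of_even {v : V} (h : par v = v) : od v = 0 := by rw [od_apply, h]; module
theorem ev_of_odd {v : V} (h : par v = -v) : ev v = 0 := by rw [ev_apply, h]; module
theorem od_of_odd {v : V} (h : par v = -v) : od v = v := by rw [od_apply, h]; module

theorem ev_par (v : V) : ev (par v) = ev v := by rw [ev_apply, ev_apply, par_par, add_comm]
theorem od_par (v : V) : od (par v) = -od v := by rw [od_apply, od_apply, par_par]; module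

/-- A linear map that respects parity commutes with taking even and odd components. -/
theorem map_ev {W : Type*} [AddCommGroup W] [Module ℂ W] [Superspace W] {f : V →ₗ[ℂ] W}
    (h : ∀ v, f (par v) = par (f v)) (v : V) : f (ev v) = ev (f v) := by
  rw [ev_apply, ev_apply, map_smul, map_add, h]

theorem map_od {W : Type*} [AddCommGroup W] [Module ℂ W] [Superspace W] {f : V →ₗ[ℂ] W}
    (h : ∀ v, f (par v) = par (f v)) (v : V) : f (od v) = od (f v) := by
  rw [od_apply, od_apply, map_smul, map_sub, h]

end Graded

/-! ### Graded derivations, their brackets and their multiples by functions -/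

section Derivations
variable {A : Type*} [Ring A] [Algebra ℂ A] [Superalgebra A]

theorem coe_par (X : Der A) : ((par X : Der A) : Module.End ℂ A) = par (X : Module.End ℂ A) := rfl
theorem coe_ev (X : Der A) : ((ev X : Der A) : Module.End ℂ A) = ev (X : Module.End ℂ A) := rfl
theorem coe_od (X : Der A) : ((od X : Der A) : Module.End ℂ A) = od (X : Module.End ℂ A) := rfl

theorem derBracket_coe (X Y : Der A) : ((derBracket X Y : Der A) : Module.End ℂ A)
    = superBracket (X : Module.End ℂ A) (Y : Module.End ℂ A) := rfl

theorem par_der_apply (X : Der A) (a : A) :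
    ((par X : Der A) : Module.End ℂ A) a = par ((X : Module.End ℂ A) (par a)) := rfl

theorem der_ext {X Y : Der A}
    (h : ∀ a, (X : Module.End ℂ A) a = (Y : Module.End ℂ A) a) : X = Y :=
  Subtype.ext (LinearMap.ext h)

/-- The bracket of vector fields on functions. -/
theorem derBracket_apply (X Y : Der A) (a : A) :
    ((derBracket X Y : Der A) : Module.End ℂ A) a
      = (X : Module.End ℂ A) ((Y : Module.End ℂ A) a)
        - (Y : Module.End ℂ A) (((ev X : Der A) : Module.End ℂ A) a)
        - ((par Y : Der A) : Module.End ℂ A) (((od X : Der A) : Module.End ℂ A) a) := rfl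

theorem derBracket_apply_of_even {X : Der A} (h : par X = X) (Y : Der A) (a : A) :
    ((derBracket X Y : Der A) : Module.End ℂ A) a
      = (X : Module.End ℂ A) ((Y : Module.End ℂ A) a)
        - (Y : Module.End ℂ A) ((X : Module.End ℂ A) a) := by
  rw [derBracket_apply, ev_of_even h, od_of_even h]; simp

theorem ev_der_apply (X : Der A) (a : A) :
    ((ev X : Der A) : Module.End ℂ A) a = (2⁻¹ : ℂ) • ((X : Module.End ℂ A) a
      + par ((X : Module.End ℂ A) (par a))) := rfl

theorem od_der_apply (X : Der A) (a : A) :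
    ((od X : Der A) : Module.End ℂ A) a = (2⁻¹ : ℂ) • ((X : Module.End ℂ A) a
      - par ((X : Module.End ℂ A) (par a))) := rfl

theorem ev_der_apply_eq_zero {X : Der A} {a : A} (h : (X : Module.End ℂ A) a = 0)
    (h' : (X : Module.End ℂ A) (par a) = 0) : ((ev X : Der A) : Module.End ℂ A) a = 0 := by
  rw [ev_der_apply, h, h']; simp

theorem od_der_apply_eq_zero {X : Der A} {a : A} (h : (X : Module.End ℂ A) a = 0)
    (h' : (X : Module.End ℂ A) (par a) = 0) : ((od X : Der A) : Module.End ℂ A) a = 0 := by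
  rw [od_der_apply, h, h']; simp

theorem der_mul (X : Der A) (a b : A) : (X : Module.End ℂ A) (a * b)
    = (X : Module.End ℂ A) a * b + a * ((ev X : Der A) : Module.End ℂ A) b
      + par a * ((od X : Der A) : Module.End ℂ A) b := X.2 a b

/-- The sign in the Leibniz rule depends on the parities of both X and the first factor. Splitting
the factor instead of X, here and in `der_od_mul`, leaves only X and `par X` on the right. -/
theorem der_ev_mul (X : Der A) (a b : A) : (X : Module.End ℂ A) (ev a * b)
    = (X : Module.End ℂ A) (ev a) * b + ev a * (X : Module.End ℂ A) b := by
  conv_rhs => rw [← ev_add_od X]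
  rw [der_mul, par_ev]
  simp only [Submodule.coe_add, LinearMap.add_apply]
  rw [← LinearMap.add_apply (ev X : Der A).1, ← Submodule.coe_add, ev_add_od]
  noncomm_ring

theorem der_od_mul (X : Der A) (a b : A) : (X : Module.End ℂ A) (od a * b)
    = (X : Module.End ℂ A) (od a) * b + od a * ((par X : Der A) : Module.End ℂ A) b := by
  rw [der_mul, par_od, par_eq X, Submodule.coe_sub, LinearMap.sub_apply]
  noncomm_ring

theorem der_one (X : Der A) : (X : Module.End ℂ A) 1 = 0 := by
  have h : ∀ X : Der A, (X : Module.End ℂ A) (1 * 1) = (X : Module.End ℂ A) 1 * 1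
    + 1 * (X : Module.End ℂ A) 1 := fun X => by
    have := der_ev_mul X 1 1
    rwa [ev_of_even par_one] at this
  simpa using h X

theorem der_algebraMap (X : Der A) (c : ℂ) : (X : Module.End ℂ A) (algebraMap ℂ A c) = 0 := by
  rw [Algebra.algebraMap_eq_smul_one, map_smul, der_one, smul_zero]

theorem DerForm.coe_sub (Θ Ξ : DerForm A) : ((Θ - Ξ : DerForm A) : A →ₗ[ℂ] Functional A)
    = (Θ : A →ₗ[ℂ] Functional A) - (Ξ : A →ₗ[ℂ] Functional A) := rfl

theorem DerForm.coe_sum {ι : Type*} (s : Finset ι) (Θ : ι → DerForm A) :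
    ((∑ i ∈ s, Θ i : DerForm A) : A →ₗ[ℂ] Functional A)
      = ∑ i ∈ s, (Θ i : A →ₗ[ℂ] Functional A) :=
  map_sum (DerForm A).subtype Θ s

variable [Supercommutative A]

theorem derSMul_apply (a : A) (X : Der A) (b : A) :
    ((derSMul a X : Der A) : Module.End ℂ A) b = a * (X : Module.End ℂ A) b := rfl

theorem par_derSMul (a : A) (X : Der A) : par (derSMul a X) = derSMul (par a) (par X) :=
  der_ext fun b => by
    rw [par_der_apply, derSMul_apply, derSMul_apply, par_mul, par_der_apply]

theorem ev_derSMul (a : A) (X : Der A) :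
    ev (derSMul a X) = derSMul (ev a) (ev X) + derSMul (od a) (od X) := by
  refine der_ext fun b => ?_
  have h : ∀ x y z w : A, (2⁻¹ : ℂ) • (x * z + y * w)
      = ((2⁻¹ : ℂ) • (x + y)) * ((2⁻¹ : ℂ) • (z + w))
        + ((2⁻¹ : ℂ) • (x - y)) * ((2⁻¹ : ℂ) • (z - w)) := fun x y z w => by
    simp only [smul_mul_smul_comm, mul_add, mul_sub, add_mul, sub_mul]; module
  rw [ev_der_apply, derSMul_apply, derSMul_apply, par_mul, Submodule.coe_add,
    LinearMap.add_apply, derSMul_apply, derSMul_apply, ev_der_apply, od_der_apply, ev_apply,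
    od_apply, h]

theorem od_derSMul (a : A) (X : Der A) :
    od (derSMul a X) = derSMul (ev a) (od X) + derSMul (od a) (ev X) := by
  refine der_ext fun b => ?_
  have h : ∀ x y z w : A, (2⁻¹ : ℂ) • (x * z - y * w)
      = ((2⁻¹ : ℂ) • (x + y)) * ((2⁻¹ : ℂ) • (z - w))
        + ((2⁻¹ : ℂ) • (x - y)) * ((2⁻¹ : ℂ) • (z + w)) := fun x y z w => by
    simp only [smul_mul_smul_comm, mul_add, mul_sub, add_mul, sub_mul]; module
  rw [od_der_apply, derSMul_apply, derSMul_apply, par_mul, Submodule.coe_add,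
    LinearMap.add_apply, derSMul_apply, derSMul_apply, od_der_apply, ev_der_apply, ev_apply,
    od_apply, h]

/-- The bracket of multiples of vector fields. -/
theorem derBracket_derSMul (a b : A) (X Y : Der A) :
    derBracket (derSMul a X) (derSMul b Y)
      = derSMul (a * (X : Module.End ℂ A) b) Y + derSMul (a * b) (derBracket (ev X) Y)
        + derSMul (a * par b) (derBracket (od X) Y)
        - derSMul (b * (Y : Module.End ℂ A) (ev a)
            + par b * ((par Y : Der A) : Module.End ℂ A) (od a)) (ev X)
        - derSMul (b * (Y : Module.End ℂ A) (od a)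
            + par b * ((par Y : Der A) : Module.End ℂ A) (ev a)) (od X) := by
  refine der_ext fun c => ?_
  -- Supercommutativity serves to bring every monomial with undifferentiated a and b to a form that
  -- begins with b or `par b`, followed by a component of a. After that the identity is additive.
  have h1 : a * b = b * ev a + par b * od a := Supercommutative.comm a b
  have h2 : a * par b = par b * ev a + b * od a := by
    rw [Supercommutative.comm a (par b), par_par]
  have e1 : par (ev X) = ev X := par_ev X
  have e2 : par (od X) = -od X := par_od X
  simp only [Submodule.coe_add, Submodule.coe_sub, LinearMap.add_apply, LinearMap.sub_apply,
    derSMul_apply, derBracket_apply_of_even e1]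
  have h3 : ((derBracket (od X) Y : Der A) : Module.End ℂ A) c
      = ((od X : Der A) : Module.End ℂ A) ((Y : Module.End ℂ A) c)
        - ((par Y : Der A) : Module.End ℂ A) (((od X : Der A) : Module.End ℂ A) c) := by
    rw [derBracket_apply, ev_of_odd e2, od_of_odd e2]; simp
  rw [h3, derBracket_apply, ev_derSMul, od_derSMul, par_derSMul]
  simp only [Submodule.coe_add, LinearMap.add_apply, derSMul_apply, map_add, der_ev_mul,
    der_od_mul, par_derSMul, der_mul X b]
  have h5 : par (par Y) = Y := par_par Y
  have h6 : ∀ y : A, a * (b * y) = b * (ev a * y) + par b * (od a * y) := fun y => by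
    rw [← mul_assoc, h1]; noncomm_ring
  have h7 : ∀ y : A, a * (par b * y) = par b * (ev a * y) + b * (od a * y) := fun y => by
    rw [← mul_assoc, h2]; noncomm_ring
  have h8 : ∀ z y : A, ev a * (z * y) = z * (ev a * y) := fun z y => by
    rw [← mul_assoc, Supercommutative.comm (ev a), ev_of_even (par_ev a), od_of_even (par_ev a)]
    noncomm_ring
  have h9 : ∀ z y : A, od a * (z * y) = par z * (od a * y) := fun z y => by
    rw [← mul_assoc, Supercommutative.comm (od a), ev_of_odd (par_od a), od_of_odd (par_od a)]
    noncomm_ring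
  simp only [mul_add, mul_sub, add_mul, mul_assoc, h5, h6, h7, h8 b, h8 (par b), h9 b,
    h9 (par b), par_par]
  abel

/-- The bracket of multiples of vector fields that annihilate the coefficients of each other. -/
theorem derBracket_derSMul_of_apply_eq_zero {a b : A} {X Y : Der A}
    (hX : (X : Module.End ℂ A) b = 0) (hY : (Y : Module.End ℂ A) a = 0)
    (hY' : (Y : Module.End ℂ A) (par a) = 0) :
    derBracket (derSMul a X) (derSMul b Y)
      = derSMul (a * b) (derBracket (ev X) Y) + derSMul (a * par b) (derBracket (od X) Y) := by
  have h1 : (Y : Module.End ℂ A) (ev a) = 0 := by rw [ev_apply, map_smul, map_add, hY, hY']; simp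
  have h2 : (Y : Module.End ℂ A) (od a) = 0 := by rw [od_apply, map_smul, map_sub, hY, hY']; simp
  refine der_ext fun c => ?_
  rw [derBracket_derSMul, hX, h1, h2, par_der_apply, par_der_apply, par_ev, par_od, map_neg, h1, h2]
  simp

/-! ### Vector fields spanned by a finite frame -/

section Frame
variable {ι : Type*} [Fintype ι] (D : ι → Der A)

/-- The vector field `∑ c_s D_s`. -/
def frameField : (ι → A) →ₗ[ℂ] Der A :=
  ∑ s, (derSMul (A := A)).flip (D s) ∘ₗ LinearMap.proj s

theorem frameField_eq (c : ι → A) : frameField D c = ∑ s, derSMul (c s) (D s) := by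
  simp [frameField]

theorem frameField_apply (c : ι → A) (a : A) :
    (frameField D c : Module.End ℂ A) a = ∑ s, c s * (D s : Module.End ℂ A) a := by
  rw [frameField_eq, Submodule.coe_sum, LinearMap.sum_apply]; rfl

theorem derSMul_mem_range_frameField (a : A) (s : ι) :
    derSMul a (D s) ∈ LinearMap.range (frameField D) := by
  classical
  refine ⟨Pi.single s a, ?_⟩
  rw [frameField_eq, Finset.sum_eq_single s]
  · rw [Pi.single_eq_same]
  · intro t _ h; rw [Pi.single_eq_of_ne h]; simp
  · simp

variable {D}

theorem par_mem_range_frameField (hD : ∀ s, par (D s) = D s ∨ par (D s) = -D s) {X : Der A}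
    (hX : X ∈ LinearMap.range (frameField D)) : par X ∈ LinearMap.range (frameField D) := by
  obtain ⟨c, rfl⟩ := hX
  rw [frameField_eq, map_sum]
  refine Submodule.sum_mem _ fun s _ => ?_
  rw [par_derSMul]
  rcases hD s with h | h
  · rw [h]; exact derSMul_mem_range_frameField D _ s
  · have e : derSMul (par (c s)) (-D s) = derSMul (-par (c s)) (D s) := by
      refine der_ext fun a => ?_
      rw [derSMul_apply, derSMul_apply, neg_mul]
      exact mul_neg _ _
    rw [h, e]; exact derSMul_mem_range_frameField D _ s

/-- In [c D_s, c' D_t] the terms with [D_s, D_t] vanish, and what is left are function multiples of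
D_t and of D_s, in which one coefficient has been differentiated. -/
theorem derBracket_mem_range_frameField (hD : ∀ s, par (D s) = D s ∨ par (D s) = -D s)
    (hcomm : ∀ s t, derBracket (D s) (D t) = 0) {X Y : Der A}
    (hX : X ∈ LinearMap.range (frameField D)) (hY : Y ∈ LinearMap.range (frameField D)) :
    derBracket X Y ∈ LinearMap.range (frameField D) := by
  obtain ⟨c, rfl⟩ := hX
  obtain ⟨c', rfl⟩ := hY
  simp only [frameField_eq, map_sum, LinearMap.sum_apply]
  refine Submodule.sum_mem _ fun t _ => Submodule.sum_mem _ fun s _ => ?_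
  -- These are the two shapes that `derBracket_derSMul` takes: its last term vanishes if D_s is
  -- even, the one before it if D_s is odd.
  have hsub : ∀ X Y : Der A, X ∈ LinearMap.range (frameField D) →
      Y ∈ LinearMap.range (frameField D) →
      X - Y - 0 ∈ LinearMap.range (frameField D) ∧ X - 0 - Y ∈ LinearMap.range (frameField D) := by
    intro X Y hX hY
    have h : X + (-1 : ℂ) • Y ∈ LinearMap.range (frameField D) :=
      Submodule.add_mem _ hX (Submodule.smul_mem _ _ hY)
    have e : X - Y - 0 = X + (-1 : ℂ) • Y := der_ext fun a => by simp [sub_eq_add_neg]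
    have e' : X - 0 - Y = X + (-1 : ℂ) • Y := der_ext fun a => by simp [sub_eq_add_neg]
    exact ⟨e ▸ h, e' ▸ h⟩
  rw [derBracket_derSMul]
  rcases hD s with h | h
  · rw [ev_of_even h, od_of_even h, hcomm]
    simp only [map_zero, LinearMap.zero_apply, add_zero]
    exact (hsub _ _ (derSMul_mem_range_frameField D _ t) (derSMul_mem_range_frameField D _ s)).1
  · rw [ev_of_odd h, od_of_odd h, hcomm]
    simp only [map_zero, LinearMap.zero_apply, add_zero]
    exact (hsub _ _ (derSMul_mem_range_frameField D _ t) (derSMul_mem_range_frameField D _ s)).2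

/-- Combinations of the `D_s` are determined by their values on coordinates dual to the `D_s`. -/
theorem eq_of_mem_range_frameField [DecidableEq ι] {z : ι → A}
    (hz : ∀ s t, (D s : Module.End ℂ A) (z t) = if s = t then 1 else 0) {X Y : Der A}
    (hX : X ∈ LinearMap.range (frameField D)) (hY : Y ∈ LinearMap.range (frameField D))
    (h : ∀ s, (X : Module.End ℂ A) (z s) = (Y : Module.End ℂ A) (z s)) : X = Y := by
  obtain ⟨c, rfl⟩ := hX
  obtain ⟨c', rfl⟩ := hY
  congr 1
  ext s
  have := h s
  simpa [frameField_apply, hz] using this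

end Frame

/-! ### The Frölicher–Nijenhuis bracket with a connection form -/

section FrolicherNijenhuis

theorem dMulDer_apply {x : A} (hx : par x = x) (X Y : Der A) (g : A) :
    (dMulDer x hx X : A →ₗ[ℂ] Functional A) g Y
      = (Y : Module.End ℂ A) x * (X : Module.End ℂ A) g := rfl

theorem dDer_apply (Y : Der A) (g : A) :
    (dDer A : A →ₗ[ℂ] Functional A) g Y = (Y : Module.End ℂ A) g := mul_one _

/-- The bracket of a vertical field with the connection form `d - ∑ dx^i D_i`. -/
theorem fnBracket_connection {ι : Type*} [Fintype ι] {x : ι → A} (hx : ∀ i, par (x i) = x i)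
    {D : ι → Der A} (hD : ∀ i, par (D i) = D i) {X : Der A}
    (hX : ∀ i, (X : Module.End ℂ A) (x i) = 0) :
    fnBracket X (dDer A - ∑ i, dMulDer (x i) (hx i) (D i))
      = ((∑ i, dMulDer (x i) (hx i) (derBracket (D i) X) : DerForm A) :
          A →ₗ[ℂ] Functional A) := by
  set U : DerForm A := dDer A - ∑ i, dMulDer (x i) (hx i) (D i) with hU
  have hUapp : ∀ g Y, (U : A →ₗ[ℂ] Functional A) g Y = (Y : Module.End ℂ A) g
      - ∑ i, (Y : Module.End ℂ A) (x i) * (D i : Module.End ℂ A) g := fun g Y => by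
    rw [hU, DerForm.coe_sub, DerForm.coe_sum]
    simp only [LinearMap.sub_apply, LinearMap.sum_apply, dMulDer_apply, dDer_apply]
  -- U is even, so the term L_U(X(g)) of the bracket enters without a sign.
  have hparU : par (U : A →ₗ[ℂ] Functional A) = U := by
    ext g Y
    change par ((U : A →ₗ[ℂ] Functional A) (par g) (par Y)) = _
    rw [hUapp, hUapp, map_sub, map_sum, par_der_apply, par_par, par_par]
    congr 1
    refine Finset.sum_congr rfl fun i _ => ?_
    rw [par_mul, par_der_apply, hx, par_par, ← par_der_apply, hD]
  -- Since x^i is even, both parity components of X are vertical along with X.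
  have hev : ∀ i, ((ev X : Der A) : Module.End ℂ A) (x i) = 0 := fun i =>
    ev_der_apply_eq_zero (hX i) (by rw [hx, hX])
  have hod : ∀ i, ((od X : Der A) : Module.End ℂ A) (x i) = 0 := fun i =>
    od_der_apply_eq_zero (hX i) (by rw [hx, hX])
  have e1 : par (ev X) = ev X := par_ev X
  have e2 : par (od X) = -od X := par_od X
  have hsplit : ∀ a, (X : Module.End ℂ A) a = ((ev X : Der A) : Module.End ℂ A) a
      + ((od X : Der A) : Module.End ℂ A) a := fun a => by
    rw [← LinearMap.add_apply, ← Submodule.coe_add, ev_add_od]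
  have hbr : ∀ Y c, ((derBracket (od X) Y : Der A) : Module.End ℂ A) c
      = ((od X : Der A) : Module.End ℂ A) ((Y : Module.End ℂ A) c)
        - ((par Y : Der A) : Module.End ℂ A) (((od X : Der A) : Module.End ℂ A) c) :=
    fun Y c => by
    rw [derBracket_apply, ev_of_odd e2, od_of_odd e2]; simp
  have hmev : ∀ a b, ((ev X : Der A) : Module.End ℂ A) (a * b)
      = ((ev X : Der A) : Module.End ℂ A) a * b + a * ((ev X : Der A) : Module.End ℂ A) b :=
    der_even_mul X.2
  have hmod : ∀ a b, ((od X : Der A) : Module.End ℂ A) (a * b)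
      = ((od X : Der A) : Module.End ℂ A) a * b + par a * ((od X : Der A) : Module.End ℂ A) b :=
    der_odd_mul X.2
  ext g Y
  -- The odd part of X is applied to (`par Y`)(x^i) · D_i(g) and picks up the parity involution of
  -- the first factor. That sign undoes the one in `par Y`.
  have hpx : ∀ i, par (((par Y : Der A) : Module.End ℂ A) (x i)) = (Y : Module.End ℂ A) (x i) :=
    fun i => by rw [par_der_apply, par_par, hx]
  change (((ev X : Der A) : Module.End ℂ A) ((U : A →ₗ[ℂ] Functional A) g Y)
      - (U : A →ₗ[ℂ] Functional A) g (derBracket (ev X) Y)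
      + (((od X : Der A) : Module.End ℂ A) ((U : A →ₗ[ℂ] Functional A) g (par Y))
      - (U : A →ₗ[ℂ] Functional A) g (derBracket (od X) (par Y)))
      - (Y : Module.End ℂ A) ((U : A →ₗ[ℂ] Functional A) g X)
      + (Y : Module.End ℂ A) ((U : A →ₗ[ℂ] Functional A) g X) * 1)
      - ((U : A →ₗ[ℂ] Functional A) (((ev X : Der A) : Module.End ℂ A) g) Y
      + (par (U : A →ₗ[ℂ] Functional A)) (((od X : Der A) : Module.End ℂ A) g) Y) = _
  -- The terms ∓Y(i_X U(g)) of i_X d and d i_X cancel, and the even and odd parts of X recombine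
  -- into U(X(g)). Below, the contributions of d cancel, the derivatives of Y(x^i) along X cancel
  -- against those inside [X, Y], and Y(x^i) (D_i X - X D_i)(g) survives.
  rw [hparU, mul_one, sub_add_cancel, ← LinearMap.add_apply, ← map_add, ← hsplit,
    DerForm.coe_sum, LinearMap.sum_apply, LinearMap.sum_apply]
  simp only [hUapp, dMulDer_apply, derBracket_apply_of_even e1, derBracket_apply_of_even (hD _),
    hbr, par_par, hev, hod, map_zero, sub_zero, map_sub, map_sum, hmev, hmod, hpx,
    Finset.sum_add_distrib]
  simp only [mul_sub, hsplit, map_add, mul_add, Finset.sum_add_distrib, Finset.sum_sub_distrib]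
  abel

end FrolicherNijenhuis
end Derivations

/-! ### Restriction of vector fields to a quotient -/

section Restriction
variable {A : Type*} [Ring A] [Algebra ℂ A] [Superalgebra A] (I : Ideal A) [IsSuperIdeal I]

theorem Der.restrict_mk (X : Der A) (h : ∀ a ∈ I, (X : Module.End ℂ A) a ∈ I) (a : A) :
    (Der.restrict I X h : Module.End ℂ (A ⧸ I)) (Ideal.Quotient.mk I a)
      = Ideal.Quotient.mk I ((X : Module.End ℂ A) a) := rfl

theorem Der.par_restrict_mk (X : Der A) (h : ∀ a ∈ I, (X : Module.End ℂ A) a ∈ I) (a : A) :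
    ((par (Der.restrict I X h) : Der (A ⧸ I)) : Module.End ℂ (A ⧸ I)) (Ideal.Quotient.mk I a)
      = Ideal.Quotient.mk I (((par X : Der A) : Module.End ℂ A) a) := rfl

theorem Der.par_restrict_of_even {X : Der A} (h : ∀ a ∈ I, (X : Module.End ℂ A) a ∈ I)
    (hX : par X = X) : par (Der.restrict I X h) = Der.restrict I X h := der_ext fun a => by
  obtain ⟨a, rfl⟩ := Ideal.Quotient.mk_surjective a
  rw [Der.par_restrict_mk, hX, Der.restrict_mk]

theorem Der.par_restrict_of_odd {X : Der A} (h : ∀ a ∈ I, (X : Module.End ℂ A) a ∈ I)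
    (hX : par X = -X) : par (Der.restrict I X h) = -Der.restrict I X h := der_ext fun a => by
  obtain ⟨a, rfl⟩ := Ideal.Quotient.mk_surjective a
  rw [Der.par_restrict_mk, hX]
  exact map_neg _ _

theorem Der.derBracket_restrict {X Y : Der A} (h : ∀ a ∈ I, (X : Module.End ℂ A) a ∈ I)
    (h' : ∀ a ∈ I, (Y : Module.End ℂ A) a ∈ I) (hXY : derBracket X Y = 0) :
    derBracket (Der.restrict I X h) (Der.restrict I Y h') = 0 := der_ext fun a => by
  obtain ⟨a, rfl⟩ := Ideal.Quotient.mk_surjective a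
  have := congrArg (fun Z : Der A => Ideal.Quotient.mk I ((Z : Module.End ℂ A) a)) hXY
  exact this.trans (map_zero _)

end Restriction

/-! ### Partial derivatives of superfunctions and vector fields with given coefficients -/

section PartialDerivatives
variable {S S₀ S₁ : Type*}

-- The presenting set T does not grow under differentiation along one of its members, so second
-- derivatives can be computed on the same finite-dimensional space.
open Classical in
theorem Presents.partialAt {O : Opens (S → ℝ)} {T : Finset S} {g : (T → ℝ) → ℂ} {f : O → ℂ}
    (h : Presents T g f) (t : T) :
    Presents T (fun q => fderiv ℝ g q (Pi.single t 1)) (partialAt (t : S) f) := fun p =>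
  ⟨((h p).1.fderiv_right (by simp)).clm_apply contDiffAt_const, (h.hasDerivAt t p).deriv⟩

/-- This is the symmetry of the second derivative of a smooth function of finitely many real
variables. -/
theorem smoothPartial_comm {O : Opens (S → ℝ)} (s t : S) (f : smoothFn O) :
    smoothPartial s (smoothPartial t f) = smoothPartial t (smoothPartial s f) := by
  classical
  obtain ⟨T, g, h⟩ := f.2
  -- The presentation is enlarged so that both coordinates are among its variables; otherwise
  -- `Presents.partialAt` does not apply to them.
  obtain ⟨T, g, h, hs, ht⟩ : ∃ (T : Finset S) (g : (T → ℝ) → ℂ), Presents T g (f : O → ℂ) ∧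
      s ∈ T ∧ t ∈ T :=
    ⟨_, _, h.mono ((Finset.subset_insert t T).trans (Finset.subset_insert s _)), by simp, by simp⟩
  ext p
  have key : ∀ u v : T, partialAt (u : S) (partialAt (v : S) (f : O → ℂ)) p
      = fderiv ℝ (fderiv ℝ g) (T.restrict (p : S → ℝ)) (Pi.single u 1) (Pi.single v 1) := by
    intro u v
    rw [(((h.partialAt v).partialAt u) p).2]
    have hd : DifferentiableAt ℝ (fderiv ℝ g) (T.restrict (p : S → ℝ)) :=
      ((h p).1.fderiv_right (m := ((⊤ : ℕ∞) : WithTop ℕ∞)) (by simp)).differentiableAt (by simp)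
    have e := (hd.hasFDerivAt.clm_apply
      (hasFDerivAt_const (Pi.single v (1 : ℝ) : T → ℝ) (T.restrict (p : S → ℝ)))).fderiv
    beta_reduce at e
    refine (congrArg (fun F : (T → ℝ) →L[ℝ] ℂ => F (Pi.single u 1)) ?_).trans
      ((congrArg (fun F : (T → ℝ) →L[ℝ] ℂ => F (Pi.single u 1)) e).trans ?_)
    · congr!
    · simp
  have hsymm : IsSymmSndFDerivAt ℝ g (T.restrict (p : S → ℝ)) :=
    (h p).1.isSymmSndFDerivAt (by
      rw [minSmoothness_of_isRCLikeNormedField]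
      exact WithTop.coe_le_coe.2 (le_top : (2 : ℕ∞) ≤ ⊤))
  exact (key ⟨s, hs⟩ ⟨t, ht⟩).trans ((hsymm _ _).trans (key ⟨t, ht⟩ ⟨s, hs⟩).symm)

theorem smoothPartial_coord_self {O : Opens (S → ℝ)} (s : S) :
    smoothPartial s (smoothCoord O s) = 1 := by
  classical
  ext p
  have e : (fun x : ℝ => extendZero (smoothCoord O s : O → ℂ)
      (Function.update (p : S → ℝ) s x)) =ᶠ[nhds ((p : S → ℝ) s)] fun x => (x : ℂ) := by
    filter_upwards [line_eventually s p] with x hx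
    rw [extendZero, dif_pos hx]
    change ((Function.update (p : S → ℝ) s x s : ℝ) : ℂ) = _
    rw [Function.update_self]
  change deriv _ _ = _
  rw [Filter.EventuallyEq.deriv_eq (by convert e)]
  exact (Complex.ofRealCLM.hasDerivAt (x := (p : S → ℝ) s)).deriv.trans (by simp)

theorem smoothPartial_coord_of_ne {O : Opens (S → ℝ)} {s t : S} (h : s ≠ t) :
    smoothPartial s (smoothCoord O t) = 0 := by
  have hP : Presents (O := O) {t} (fun q => ((q ⟨t, Finset.mem_singleton_self t⟩ : ℝ) : ℂ))
      (smoothCoord O t : O → ℂ) := fun _ =>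
    ⟨(Complex.ofRealCLM.contDiff.comp (contDiff_apply ℝ ℝ _)).contDiffAt, rfl⟩
  exact Subtype.ext (funext fun p => hP.partialAt_of_notMem (by simpa using h) p)

theorem smoothPartial_one {O : Opens (S → ℝ)} (s : S) : smoothPartial s (1 : smoothFn O) = 0 := by
  have h := smoothPartial_mul s (1 : smoothFn O) 1
  simpa using h

theorem oddPartial_one (a : S₁) : oddPartial a (1 : Grassmann S₁) = 0 := by
  rw [← map_one (algebraMap ℂ (Grassmann S₁)), oddPartial_algebraMap]

theorem oddPartial_comm (a b : S₁) (g : Grassmann S₁) :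
    oddPartial a (oddPartial b g) = -oddPartial b (oddPartial a g) :=
  CliffordAlgebra.contractLeft_comm _ _ _

namespace SuperFn

/-- The sign `(-1)^p` of a coordinate of parity `p`. -/
def coordSign : S₀ ⊕ S₁ → ℂ := Sum.elim (fun _ => 1) (fun _ => -1)

variable {O : Opens (S₀ → ℝ)}

theorem par_coord (s : S₀ ⊕ S₁) : par (coord O s) = coordSign s • coord O s := by
  cases s with
  | inl s => rw [par_coord_inl]; simp [coordSign]
  | inr s => rw [par_coord_inr]; simp [coordSign]

theorem par_partialLin (s : S₀ ⊕ S₁) (a : SuperFn S₁ O) :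
    par (partialLin s a) = coordSign s • partialLin s (par a) := by
  cases s with
  | inl s => rw [par_partialLin_inl]; simp [coordSign]
  | inr s => rw [par_partialLin_inr]; simp [coordSign]

theorem coordSign_mul_self (s : S₀ ⊕ S₁) : coordSign s * coordSign s = 1 := by
  cases s <;> simp [coordSign]

theorem coe_partialDer (s : S₀ ⊕ S₁) :
    ((partialDer s : Der (SuperFn S₁ O)) : Module.End ℂ (SuperFn S₁ O)) = partialLin s := rfl

theorem partialLin_coord [DecidableEq S₀] [DecidableEq S₁] (s t : S₀ ⊕ S₁) :
    partialLin s (coord O t) = if s = t then 1 else 0 := by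
  rcases s with s | s <;> rcases t with t | t
  · rw [coord, partialLin_inl]
    by_cases h : s = t
    · subst h; rw [smoothPartial_coord_self, if_pos rfl]; rfl
    · rw [smoothPartial_coord_of_ne h, if_neg (by simpa using h), zero_tmul]
  · rw [coord, partialLin_inl, smoothPartial_one, zero_tmul]; simp
  · rw [coord, partialLin_inr, oddPartial_one, tmul_zero]; simp
  · rw [coord, partialLin_inr, oddPartial_ι]
    by_cases h : s = t
    · subst h; simp only [if_true, Finsupp.single_eq_same, map_one]; rfl
    · rw [if_neg (by simpa using h), Finsupp.single_eq_of_ne h, map_zero, tmul_zero]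

theorem par_partialDer_inl (s : S₀) :
    par (partialDer (.inl s) : Der (SuperFn S₁ O)) = partialDer (.inl s) := der_ext fun a => by
  rw [par_der_apply, coe_partialDer, par_partialLin_inl, par_par]

theorem par_partialDer_inr (s : S₁) :
    par (partialDer (.inr s) : Der (SuperFn S₁ O)) = -partialDer (.inr s) := der_ext fun a => by
  rw [par_der_apply, coe_partialDer, par_partialLin_inr, par_par]
  rfl

theorem par_partialDer (s : S₀ ⊕ S₁) :
    par (partialDer s : Der (SuperFn S₁ O)) = partialDer s
      ∨ par (partialDer s : Der (SuperFn S₁ O)) = -partialDer s := by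
  rcases s with s | s
  · exact .inl (par_partialDer_inl s)
  · exact .inr (par_partialDer_inr s)

theorem partialLin_inl_comm (s : S₀) (t : S₀ ⊕ S₁) (a : SuperFn S₁ O) :
    partialLin (.inl s) (partialLin t a) = partialLin t (partialLin (.inl s) a) := by
  induction a using SuperFn.induction with
  | zero => simp
  | tmul f g =>
    rcases t with t | t
    · simp only [partialLin_inl, smoothPartial_comm s t]
    · simp only [partialLin_inl, partialLin_inr]
  | add a b ha hb => simp only [map_add, ha, hb]

theorem partialLin_inr_comm (s t : S₁) (a : SuperFn S₁ O) :
    partialLin (.inr s) (partialLin (.inr t) a) = -partialLin (.inr t) (partialLin (.inr s) a) := by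
  induction a using SuperFn.induction with
  | zero => simp
  | tmul f g => simp only [partialLin_inr, oddPartial_comm s t, tmul_neg]
  | add a b ha hb => simp only [map_add, ha, hb]; abel

/-- The partial derivatives supercommute. -/
theorem derBracket_partialDer (s t : S₀ ⊕ S₁) :
    derBracket (partialDer s) (partialDer t : Der (SuperFn S₁ O)) = 0 := der_ext fun a => by
  rcases s with s | s
  · rw [derBracket_apply_of_even (par_partialDer_inl s), coe_partialDer, coe_partialDer,
      partialLin_inl_comm, sub_self]
    rfl
  · rw [derBracket_apply, ev_of_odd (par_partialDer_inr s), od_of_odd (par_partialDer_inr s)]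
    rcases t with t | t
    · rw [par_partialDer_inl, coe_partialDer, coe_partialDer, partialLin_inl_comm]
      simp
    · rw [par_partialDer_inr, coe_partialDer, coe_partialDer, partialLin_inr_comm]
      simp [coe_partialDer]

theorem coe_field (X : S₀ ⊕ S₁ → SuperFn S₁ O) :
    (field X : Module.End ℂ (SuperFn S₁ O)) = fieldLin X := rfl

/-- The factor `coordSign s` is the parity of ∂_s. Conjugation by the parity involution acts on each
summand X^s ∂_s through both factors. -/
theorem par_field (X : S₀ ⊕ S₁ → SuperFn S₁ O) :
    par (field X) = field fun s => coordSign s • par (X s) := der_ext fun a => by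
  rw [par_der_apply, coe_field, coe_field, fieldLin_apply, fieldLin_apply]
  refine (AddMonoidHom.map_finsum ((par (V := SuperFn S₁ O)).toAddMonoidHom)
    (summand_support X _)).trans (finsum_congr fun s => ?_)
  change par (X s * partialLin s (par a)) = _
  rw [par_mul, par_partialLin, par_par, smul_mul_assoc, mul_smul_comm]

/-- A vector field whose coefficients have the parity of their coordinates is even. -/
theorem par_field_of_coeff {X : S₀ ⊕ S₁ → SuperFn S₁ O}
    (hX : ∀ s, par (X s) = coordSign s • X s) : par (field X) = field X := by
  rw [par_field]
  congr 1
  funext s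
  rw [hX, smul_smul, coordSign_mul_self, one_smul]

/-- The sign is (-1)^{p(s)p(t)}, written as in `partialLin_mul_of_eq_zero` with σ = `coordSign s`.
Moving ∂_t past X^s and then past ∂_s thus produces the square of one sign when X^s has the parity
of s. -/
theorem partialLin_comm (s t : S₀ ⊕ S₁) (a : SuperFn S₁ O) :
    partialLin t (partialLin s a)
      = partialLin s (((if t.isLeft then 1 else coordSign s : ℂ)) • partialLin t a) := by
  rcases t with t | t
  · rw [partialLin_inl_comm]; simp
  · rcases s with s | s
    · rw [← partialLin_inl_comm]; simp [coordSign]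
    · rw [partialLin_inr_comm]; simp [coordSign]

theorem partialLin_mul_of_eq_zero {t : S₀ ⊕ S₁} {a b : SuperFn S₁ O} {σ : ℂ}
    (ha : par a = σ • a) (h : partialLin t a = 0) :
    partialLin t (a * b) = (if t.isLeft then 1 else σ : ℂ) • (a * partialLin t b) := by
  have e := der_mul (partialDer (O := O) t) a b
  rw [coe_partialDer, h, zero_mul, zero_add] at e
  rw [e]
  rcases t with t | t
  · rw [ev_of_even (par_partialDer_inl t), od_of_even (par_partialDer_inl t)]
    simp [coe_partialDer]
  · rw [ev_of_odd (par_partialDer_inr t), od_of_odd (par_partialDer_inr t), ha]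
    simp [coe_partialDer]

/-- An even vector field with coefficients independent of a coordinate commutes with the partial
derivative along that coordinate. -/
theorem derBracket_field_partialDer {X : S₀ ⊕ S₁ → SuperFn S₁ O}
    (hX : ∀ s, par (X s) = coordSign s • X s) {t : S₀ ⊕ S₁} (ht : ∀ s, partialLin t (X s) = 0) :
    derBracket (field X) (partialDer t) = 0 := der_ext fun a => by
  rw [derBracket_apply_of_even (par_field_of_coeff hX), coe_field, coe_partialDer, fieldLin_apply,
    fieldLin_apply]
  have e : partialLin t (∑ᶠ s, X s * partialLin s a) = ∑ᶠ s, partialLin t (X s * partialLin s a) :=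
    AddMonoidHom.map_finsum ((partialLin (O := O) t).toAddMonoidHom) (summand_support X a)
  rw [e]
  -- X^s and ∂_s have the same parity, so the signs from moving ∂_t past each of them cancel, and
  -- the two sums agree term by term.
  refine sub_eq_zero.2 (finsum_congr fun s => ?_)
  rw [partialLin_mul_of_eq_zero (hX s) (ht s)]
  rw [partialLin_comm s t a, map_smul, mul_smul_comm, smul_smul]
  split_ifs
  · simp
  · rw [coordSign_mul_self, one_smul]

/-- A pull-back depends only on the coordinates in the image of the injections j₀, j₁ or of whatever
maps stand in their place, and along those the field has no component. -/
theorem fieldLin_pull_eq_zero {S₀' S₁' : Type*} {O' : Opens (S₀' → ℝ)} {j₀ : S₀ → S₀'}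
    {j₁ : S₁ → S₁'} {hO : ∀ p ∈ O', p ∘ j₀ ∈ O} {X : S₀' ⊕ S₁' → SuperFn S₁' O'}
    (hX : ∀ s, X (Sum.map j₀ j₁ s) = 0) (a : SuperFn S₁ O) :
    fieldLin X (pull O O' j₀ j₁ hO a) = 0 := by
  rw [fieldLin_apply, ← finsum_zero]
  refine finsum_congr fun s => ?_
  by_cases hs : s ∈ Set.range (Sum.map j₀ j₁)
  · obtain ⟨t, rfl⟩ := hs
    rw [hX, zero_mul]
  · rw [partial_pull_of_notMem s hs, mul_zero]

theorem field_eq_frameField [Fintype S₀] [Fintype S₁] (X : S₀ ⊕ S₁ → SuperFn S₁ O) :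
    field X = frameField partialDer X := der_ext fun a => by
  rw [frameField_apply, coe_field, fieldLin_apply, finsum_eq_sum_of_fintype]
  rfl

theorem field_coord [Fintype S₀] [Fintype S₁] (X : S₀ ⊕ S₁ → SuperFn S₁ O) (s : S₀ ⊕ S₁) :
    (field X : Module.End ℂ (SuperFn S₁ O)) (coord O s) = X s := by
  classical
  rw [field_eq_frameField, frameField_apply]
  simp [coe_partialDer, partialLin_coord]

end SuperFn
end PartialDerivatives

/-! ### The product W × E^∞: total derivatives and derivatives along the fibre -/

namespace PDESystem
variable {n m₀ m₁ : ℕ} (E : PDESystem n m₀ m₁) (k₀ k₁ : ℕ)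

theorem par_covTotalCoeff (i : Fin n)
    (s : (JetEven n m₀ ⊕ Fin k₀) ⊕ (JetOdd n m₁ ⊕ Fin k₁)) :
    par (E.covTotalCoeff k₀ k₁ i s) = SuperFn.coordSign s • E.covTotalCoeff k₀ k₁ i s := by
  have h : ∀ s : JetEven n m₀ ⊕ JetOdd n m₁, par (totalCoeff E.domain i s)
      = SuperFn.coordSign s • totalCoeff E.domain i s := by
    rintro ((j | s) | s)
    · change par (if j = i then (1 : SuperFn (JetOdd n m₁) E.domain) else 0)
        = (1 : ℂ) • (if j = i then 1 else 0)
      split_ifs <;> simp [par_one]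
    · exact (par_coord_inl E.domain _).trans (one_smul ℂ _).symm
    · exact (par_coord_inr E.domain _).trans (neg_one_smul ℂ _).symm
  rcases s with (s | s) | (s | s)
  · exact (par_pullJet E k₀ k₁ _).trans ((congrArg _ (h (.inl s))).trans (map_smul _ _ _))
  · exact (map_zero _).trans (smul_zero _).symm
  · exact (par_pullJet E k₀ k₁ _).trans ((congrArg _ (h (.inr s))).trans (map_smul _ _ _))
  · exact (map_zero _).trans (smul_zero _).symm

theorem ambientNonlocal_pullJet (s : Fin k₀ ⊕ Fin k₁) (a : SuperFn (JetOdd n m₁) E.domain) :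
    (E.ambientNonlocal k₀ k₁ s : Module.End ℂ (E.AmbientFn k₀ k₁)) (E.pullJet k₀ k₁ a) = 0 :=
  SuperFn.partial_pull_of_notMem _
    (by rcases s with s | s <;> rintro ⟨t | t, h⟩ <;> simp at h) a

theorem ambientNonlocal_covTotalCoeff (s : Fin k₀ ⊕ Fin k₁) (i : Fin n)
    (t : (JetEven n m₀ ⊕ Fin k₀) ⊕ (JetOdd n m₁ ⊕ Fin k₁)) :
    (E.ambientNonlocal k₀ k₁ s : Module.End ℂ (E.AmbientFn k₀ k₁))
      (E.covTotalCoeff k₀ k₁ i t) = 0 := by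
  rcases t with (t | t) | (t | t)
  · exact E.ambientNonlocal_pullJet k₀ k₁ s _
  · exact map_zero _
  · exact E.ambientNonlocal_pullJet k₀ k₁ s _
  · exact map_zero _

theorem par_dBarLift (i : Fin n) : par (E.dBarLift k₀ k₁ i) = E.dBarLift k₀ k₁ i :=
  Der.par_restrict_of_even _ _ (SuperFn.par_field_of_coeff (E.par_covTotalCoeff k₀ k₁ i))

theorem par_nonlocalDer (s : Fin k₀ ⊕ Fin k₁) :
    par (E.nonlocalDer k₀ k₁ s) = E.nonlocalDer k₀ k₁ s
      ∨ par (E.nonlocalDer k₀ k₁ s) = -E.nonlocalDer k₀ k₁ s := by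
  rcases SuperFn.par_partialDer (O := E.covDomain k₀)
    (Sum.map Sum.inr Sum.inr s : (JetEven n m₀ ⊕ Fin k₀) ⊕ (JetOdd n m₁ ⊕ Fin k₁)) with h | h
  · exact .inl (Der.par_restrict_of_even _ _ h)
  · exact .inr (Der.par_restrict_of_odd _ _ h)

theorem derBracket_nonlocalDer (s t : Fin k₀ ⊕ Fin k₁) :
    derBracket (E.nonlocalDer k₀ k₁ s) (E.nonlocalDer k₀ k₁ t) = 0 :=
  Der.derBracket_restrict _ _ _ (SuperFn.derBracket_partialDer _ _)

theorem derBracket_dBarLift_nonlocalDer (i : Fin n) (s : Fin k₀ ⊕ Fin k₁) :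
    derBracket (E.dBarLift k₀ k₁ i) (E.nonlocalDer k₀ k₁ s) = 0 :=
  Der.derBracket_restrict _ _ _ (SuperFn.derBracket_field_partialDer
    (E.par_covTotalCoeff k₀ k₁ i) (E.ambientNonlocal_covTotalCoeff k₀ k₁ s i))

theorem pullEq_mk (a : SuperFn (JetOdd n m₁) E.domain) :
    E.pullEq k₀ k₁ (Ideal.Quotient.mk E.ideal a)
      = Ideal.Quotient.mk (E.covIdeal k₀ k₁) (E.pullJet k₀ k₁ a) := rfl

theorem par_pullEq (b : E.Fn) : par (E.pullEq k₀ k₁ b) = E.pullEq k₀ k₁ (par b) := by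
  obtain ⟨a, rfl⟩ := Ideal.Quotient.mk_surjective b
  rw [pullEq_mk, par_mk, par_pullJet, par_mk, pullEq_mk]

/-- Together with `nonlocalDer_pullEq`, `nonlocalDer_pullW` and `dBarLift_pullW` this expresses the
product structure: each kind of derivation acts on its own factor and annihilates functions of the
other. With the vanishing brackets above, these rules replace computations in jet coordinates. -/
theorem dBarLift_pullEq (i : Fin n) (b : E.Fn) :
    (E.dBarLift k₀ k₁ i : Module.End ℂ (E.CovFn k₀ k₁)) (E.pullEq k₀ k₁ b)
      = E.pullEq k₀ k₁ ((E.dBar i : Module.End ℂ E.Fn) b) := by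
  obtain ⟨a, rfl⟩ := Ideal.Quotient.mk_surjective b
  exact congrArg (Ideal.Quotient.mk (E.covIdeal k₀ k₁))
    (SuperFn.field_pull Sum.inl_injective Sum.inl_injective (by rintro (s | s) <;> rfl) a)

theorem nonlocalDer_pullEq (s : Fin k₀ ⊕ Fin k₁) (b : E.Fn) :
    (E.nonlocalDer k₀ k₁ s : Module.End ℂ (E.CovFn k₀ k₁)) (E.pullEq k₀ k₁ b) = 0 := by
  obtain ⟨a, rfl⟩ := Ideal.Quotient.mk_surjective b
  exact (congrArg (Ideal.Quotient.mk (E.covIdeal k₀ k₁))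
    (E.ambientNonlocal_pullJet k₀ k₁ s a)).trans (map_zero _)

theorem nonlocalDer_indep (s : Fin k₀ ⊕ Fin k₁) (i : Fin n) :
    (E.nonlocalDer k₀ k₁ s : Module.End ℂ (E.CovFn k₀ k₁)) (E.indep k₀ k₁ i) = 0 := by
  have h : SuperFn.partialLin (Sum.map Sum.inr Sum.inr s)
      (SuperFn.coord (E.covDomain k₀) (.inl (.inl (.inl i))) : E.AmbientFn k₀ k₁) = 0 := by
    rw [SuperFn.partialLin_coord, if_neg]
    rcases s with s | s <;> simp
  exact (congrArg (Ideal.Quotient.mk (E.covIdeal k₀ k₁)) h).trans (map_zero _)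

theorem par_pullW (c : WFn k₀ k₁) : par (E.pullW k₀ k₁ c) = E.pullW k₀ k₁ (par c) :=
  congrArg (Ideal.Quotient.mk (E.covIdeal k₀ k₁)) (SuperFn.par_pull c)

theorem nonlocalDer_pullW (s : Fin k₀ ⊕ Fin k₁) (c : WFn k₀ k₁) :
    (E.nonlocalDer k₀ k₁ s : Module.End ℂ (E.CovFn k₀ k₁)) (E.pullW k₀ k₁ c)
      = E.pullW k₀ k₁ (SuperFn.partialLin s c) :=
  congrArg (Ideal.Quotient.mk (E.covIdeal k₀ k₁))
    (SuperFn.partial_pull Sum.inr_injective Sum.inr_injective s c)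

theorem nonlocalDer_pullW_coord (s t : Fin k₀ ⊕ Fin k₁) :
    (E.nonlocalDer k₀ k₁ s : Module.End ℂ (E.CovFn k₀ k₁))
      (E.pullW k₀ k₁ (SuperFn.coord ⊤ t)) = if s = t then 1 else 0 := by
  rw [nonlocalDer_pullW, SuperFn.partialLin_coord]
  split_ifs <;> simp

theorem dBarLift_pullW (i : Fin n) (c : WFn k₀ k₁) :
    (E.dBarLift k₀ k₁ i : Module.End ℂ (E.CovFn k₀ k₁)) (E.pullW k₀ k₁ c) = 0 := by
  have h : SuperFn.fieldLin (E.covTotalCoeff k₀ k₁ i)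
      (SuperFn.pull ⊤ (E.covDomain k₀) Sum.inr Sum.inr (fun _ _ => trivial) c) = 0 :=
    SuperFn.fieldLin_pull_eq_zero (by rintro (s | s) <;> rfl) c
  exact (congrArg (Ideal.Quotient.mk (E.covIdeal k₀ k₁)) h).trans (map_zero _)

end PDESystem

/-! ### The extension of ϱ to functions on E^∞ with values in 𝔤 -/

namespace VectRep
variable {n m₀ m₁ k₀ k₁ : ℕ} {g : MatLieSuperalgebra k₀ k₁} (ϱ : VectRep g)
  (E : PDESystem n m₀ m₁)

theorem lift_eq_frameField (x : g.Elt) :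
    ϱ.lift E x = frameField (E.nonlocalDer k₀ k₁) (fun s => E.pullW k₀ k₁ (ϱ.toLin x s)) := by
  rw [lift, frameField_eq, LinearMap.sum_apply]
  rfl

theorem lift_apply (x : g.Elt) (a : E.CovFn k₀ k₁) :
    (ϱ.lift E x : Module.End ℂ (E.CovFn k₀ k₁)) a
      = ∑ s, E.pullW k₀ k₁ (ϱ.toLin x s) * (E.nonlocalDer k₀ k₁ s : Module.End ℂ _) a := by
  rw [lift_eq_frameField, frameField_apply]

theorem lift_mem (x : g.Elt) : ϱ.lift E x ∈ LinearMap.range (frameField (E.nonlocalDer k₀ k₁)) :=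
  ⟨_, (ϱ.lift_eq_frameField E x).symm⟩

/-- The lifted field projects to the field on W. This is what transfers the axioms of `VectRep`,
which live on W, to the covering. -/
theorem lift_pullW (x : g.Elt) (c : WFn k₀ k₁) :
    (ϱ.lift E x : Module.End ℂ (E.CovFn k₀ k₁)) (E.pullW k₀ k₁ c)
      = E.pullW k₀ k₁ ((SuperFn.field (ϱ.toLin x) : Module.End ℂ (WFn k₀ k₁)) c) := by
  rw [lift_apply, SuperFn.field_eq_frameField, frameField_apply, map_sum]
  refine Finset.sum_congr rfl fun s _ => ?_
  rw [E.nonlocalDer_pullW, map_mul]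
  rfl

theorem lift_pullEq (x : g.Elt) (b : E.Fn) :
    (ϱ.lift E x : Module.End ℂ (E.CovFn k₀ k₁)) (E.pullEq k₀ k₁ b) = 0 := by
  rw [lift_apply]
  exact Finset.sum_eq_zero fun s _ => by rw [E.nonlocalDer_pullEq, mul_zero]

theorem lift_indep (x : g.Elt) (i : Fin n) :
    (ϱ.lift E x : Module.End ℂ (E.CovFn k₀ k₁)) (E.indep k₀ k₁ i) = 0 := by
  rw [lift_apply]
  exact Finset.sum_eq_zero fun s _ => by rw [E.nonlocalDer_indep, mul_zero]

theorem lift_par (x : g.Elt) : ϱ.lift E (par x) = par (ϱ.lift E x) := by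
  refine eq_of_mem_range_frameField (E.nonlocalDer_pullW_coord k₀ k₁) (ϱ.lift_mem E _)
    (par_mem_range_frameField (E.par_nonlocalDer k₀ k₁) (ϱ.lift_mem E x)) fun s => ?_
  rw [lift_pullW, ϱ.map_par, par_der_apply, par_der_apply, E.par_pullW, lift_pullW, E.par_pullW]

theorem lift_ev (x : g.Elt) : ϱ.lift E (ev x) = ev (ϱ.lift E x) :=
  Subtype.ext (map_ev (f := (Der (E.CovFn k₀ k₁)).subtype ∘ₗ ϱ.lift E)
    (fun x => congrArg Subtype.val (ϱ.lift_par E x)) x)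

theorem lift_od (x : g.Elt) : ϱ.lift E (od x) = od (ϱ.lift E x) :=
  Subtype.ext (map_od (f := (Der (E.CovFn k₀ k₁)).subtype ∘ₗ ϱ.lift E)
    (fun x => congrArg Subtype.val (ϱ.lift_par E x)) x)

/-- Both sides are combinations of the fibre derivatives, which supercommute, so it suffices to
compare them on w^p and f^q. These are functions on W, where the claim is the bracket axiom of ϱ. -/
theorem lift_bracket (x y : g.Elt) :
    ϱ.lift E (g.bracket x y) = derBracket (ϱ.lift E x) (ϱ.lift E y) := by
  refine eq_of_mem_range_frameField (E.nonlocalDer_pullW_coord k₀ k₁) (ϱ.lift_mem E _)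
    (derBracket_mem_range_frameField (E.par_nonlocalDer k₀ k₁) (E.derBracket_nonlocalDer k₀ k₁)
      (ϱ.lift_mem E x) (ϱ.lift_mem E y)) fun s => ?_
  rw [lift_pullW, ϱ.map_bracket, derBracket_apply, derBracket_apply]
  simp only [ev_der_apply, od_der_apply, par_der_apply, lift_pullW, E.par_pullW, map_sub,
    map_add, map_smul]

/-- D̄_i annihilates the coefficients, which are functions on W, and commutes with the fibre
derivatives. -/
theorem derBracket_dBarLift_lift (i : Fin n) (x : g.Elt) :
    derBracket (E.dBarLift k₀ k₁ i) (ϱ.lift E x) = 0 := by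
  have h : ∀ s, derBracket (E.dBarLift k₀ k₁ i)
      (derSMul (E.pullW k₀ k₁ (ϱ.toLin x s)) (E.nonlocalDer k₀ k₁ s)) = 0 := fun s => by
    refine der_ext fun a => ?_
    have e := E.derBracket_dBarLift_nonlocalDer k₀ k₁ i s
    have e' := congrArg (fun Z : Der (E.CovFn k₀ k₁) => (Z : Module.End ℂ (E.CovFn k₀ k₁)) a) e
    beta_reduce at e'
    rw [derBracket_apply_of_even (E.par_dBarLift k₀ k₁ i)] at e' ⊢
    rw [derSMul_apply, derSMul_apply, der_mul, E.dBarLift_pullW,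
      ev_of_even (E.par_dBarLift k₀ k₁ i), od_of_even (E.par_dBarLift k₀ k₁ i), zero_mul, zero_add]
    -- D̄_i is even, so the odd part in the Leibniz rule is the zero derivation and its value is
    -- replaced by the number zero.
    change _ + _ * (0 : E.CovFn k₀ k₁) - _ = 0
    rw [mul_zero, add_zero, ← mul_sub, e']
    exact mul_zero _
  rw [lift_eq_frameField, frameField_eq, map_sum]
  exact Finset.sum_eq_zero fun s _ => h s

theorem onFn_tmul (b : E.Fn) (x : g.Elt) :
    ϱ.onFn E (b ⊗ₜ x) = derSMul (E.pullEq k₀ k₁ b) (ϱ.lift E x) := rfl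

theorem onFn_indep (γ : E.Fn ⊗[ℂ] g.Elt) (i : Fin n) :
    (ϱ.onFn E γ : Module.End ℂ (E.CovFn k₀ k₁)) (E.indep k₀ k₁ i) = 0 := by
  induction γ using TensorProduct.induction_on with
  | zero => rw [map_zero]; rfl
  | tmul b x => rw [onFn_tmul, derSMul_apply, lift_indep, mul_zero]
  | add γ γ' h h' => rw [map_add, Submodule.coe_add, LinearMap.add_apply, h, h', add_zero]

theorem par_onFn (γ : E.Fn ⊗[ℂ] g.Elt) :
    par (ϱ.onFn E γ)
      = ϱ.onFn E (TensorProduct.map (par (V := E.Fn)) (par (V := g.Elt)) γ) := by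
  induction γ using TensorProduct.induction_on with
  | zero => simp only [map_zero]
  | tmul b x =>
    rw [TensorProduct.map_tmul, onFn_tmul, onFn_tmul, par_derSMul, E.par_pullEq, lift_par]
  | add γ γ' h h' => simp only [map_add, h, h']

/-- In [D̄_i, b ϱ(x)] = D̄_i(b) ϱ(x) + b [D̄_i, ϱ(x)] the last term vanishes by
`derBracket_dBarLift_lift`. -/
theorem onFn_dBarTensor (i : Fin n) (γ : E.Fn ⊗[ℂ] g.Elt) :
    ϱ.onFn E (dBarTensor E g.Elt i γ) = derBracket (E.dBarLift k₀ k₁ i) (ϱ.onFn E γ) := by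
  induction γ using TensorProduct.induction_on with
  | zero => simp only [map_zero]
  | tmul b x =>
    have e := ϱ.derBracket_dBarLift_lift E i x
    refine der_ext fun a => ?_
    have e' := congrArg (fun Z : Der (E.CovFn k₀ k₁) => (Z : Module.End ℂ (E.CovFn k₀ k₁)) a) e
    beta_reduce at e'
    rw [derBracket_apply_of_even (E.par_dBarLift k₀ k₁ i)] at e' ⊢
    rw [dBarTensor, LinearMap.rTensor_tmul, onFn_tmul, onFn_tmul, derSMul_apply, derSMul_apply,
      derSMul_apply, der_mul, E.dBarLift_pullEq,
      ev_of_even (E.par_dBarLift k₀ k₁ i), od_of_even (E.par_dBarLift k₀ k₁ i)]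
    change _ = _ + _ + _ * (0 : E.CovFn k₀ k₁) - _
    rw [mul_zero, add_zero, add_sub_assoc, ← mul_sub, e']
    exact ((congrArg _ (mul_zero _)).trans (add_zero _)).symm
  | add γ γ' h h' => simp only [map_add, h, h']

/-- The coefficients b and c come from E^∞ and are annihilated by the vertical fields ϱ(x), ϱ(y).
Only the sign (-1)^{p(x)p(c)} of moving ϱ(x) past c is left, and it is the sign in `tensorBracket`.
-/
theorem derBracket_derSMul_lift (b c : E.Fn) (x y : g.Elt) :
    derBracket (derSMul (E.pullEq k₀ k₁ b) (ϱ.lift E x)) (derSMul (E.pullEq k₀ k₁ c) (ϱ.lift E y))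
      = derSMul (E.pullEq k₀ k₁ b * E.pullEq k₀ k₁ c) (ϱ.lift E (g.bracket (ev x) y))
        + derSMul (E.pullEq k₀ k₁ b * par (E.pullEq k₀ k₁ c)) (ϱ.lift E (g.bracket (od x) y)) := by
  have h : (ϱ.lift E y : Module.End ℂ (E.CovFn k₀ k₁)) (par (E.pullEq k₀ k₁ b)) = 0 :=
    (congrArg _ (E.par_pullEq k₀ k₁ b)).trans (ϱ.lift_pullEq E y (par b))
  have e := derBracket_derSMul_of_apply_eq_zero (ϱ.lift_pullEq E x c) (ϱ.lift_pullEq E y b) h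
  rw [← lift_ev, ← lift_od, ← lift_bracket, ← lift_bracket] at e
  exact e

theorem onFn_tensorBracket_tmul (b c : E.Fn) (x y : g.Elt) :
    ϱ.onFn E (tensorBracket g.bracket (b ⊗ₜ x) (c ⊗ₜ y))
      = derBracket (ϱ.onFn E (b ⊗ₜ x)) (ϱ.onFn E (c ⊗ₜ y)) := by
  have h : tensorBracket g.bracket (b ⊗ₜ[ℂ] x) (c ⊗ₜ[ℂ] y)
      = (b * c) ⊗ₜ g.bracket (ev x) y + (b * par c) ⊗ₜ g.bracket (od x) y := rfl
  have hm : E.pullEq k₀ k₁ (b * c) = E.pullEq k₀ k₁ b * E.pullEq k₀ k₁ c := map_mul _ b c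
  have hm' : E.pullEq k₀ k₁ (b * par c) = E.pullEq k₀ k₁ b * par (E.pullEq k₀ k₁ c) := by
    rw [map_mul, E.par_pullEq]
  rw [h, map_add, onFn_tmul, onFn_tmul, hm, hm', ← derBracket_derSMul_lift]
  rfl

theorem onFn_tensorBracket (β γ : E.Fn ⊗[ℂ] g.Elt) :
    ϱ.onFn E (tensorBracket g.bracket β γ) = derBracket (ϱ.onFn E β) (ϱ.onFn E γ) := by
  induction β using TensorProduct.induction_on with
  | zero => simp only [map_zero, LinearMap.zero_apply]
  | tmul b x =>
    induction γ using TensorProduct.induction_on with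
    | zero => simp only [map_zero]
    | tmul c y => exact ϱ.onFn_tensorBracket_tmul E b c x y
    | add γ γ' h h' => rw [map_add, map_add, map_add, map_add, h, h']
  | add β β' h h' =>
    rw [map_add, map_add, map_add, LinearMap.add_apply, LinearMap.add_apply, map_add, h, h']

end VectRep

/-! ### The extension of ρ to functions on E^∞ with values in 𝔤 -/

namespace MatRep
variable {n m₀ m₁ k₀ k₁ : ℕ} {g : MatLieSuperalgebra k₀ k₁} (ρ : MatRep g)
  (E : PDESystem n m₀ m₁)

theorem onFn_dBarTensor (i : Fin n) (γ : E.Fn ⊗[ℂ] g.Elt) :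
    ρ.onFn E (dBarTensor E g.Elt i γ) = dBarTensor E (SMat k₀ k₁) i (ρ.onFn E γ) := by
  induction γ using TensorProduct.induction_on with
  | zero => simp only [map_zero]
  | tmul b x => rfl
  | add γ γ' h h' => simp only [map_add, h, h']

theorem onFn_tensorBracket (β γ : E.Fn ⊗[ℂ] g.Elt) :
    ρ.onFn E (tensorBracket g.bracket β γ)
      = tensorBracket superBracket (ρ.onFn E β) (ρ.onFn E γ) := by
  induction β using TensorProduct.induction_on with
  | zero => simp only [map_zero, LinearMap.zero_apply]
  | tmul b x =>
    induction γ using TensorProduct.induction_on with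
    | zero => simp only [map_zero]
    | tmul c y =>
      change (b * c) ⊗ₜ[ℂ] ρ.toLin (g.bracket (ev x) y) + (b * par c) ⊗ₜ[ℂ]
          ρ.toLin (g.bracket (od x) y)
        = (b * c) ⊗ₜ[ℂ] superBracket (ev (ρ.toLin x)) (ρ.toLin y)
          + (b * par c) ⊗ₜ[ℂ] superBracket (od (ρ.toLin x)) (ρ.toLin y)
      rw [ρ.map_bracket, ρ.map_bracket, map_ev ρ.map_par, map_od ρ.map_par]
    | add γ γ' h h' => simp only [map_add, h, h']
  | add β β' h h' => simp only [map_add, LinearMap.add_apply, h, h']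

end MatRep

/-! ### The differential of the zero-curvature representation and its two images -/

namespace ZCR
variable {n m₀ m₁ k₀ k₁ : ℕ} {E : PDESystem n m₀ m₁} {g : MatLieSuperalgebra k₀ k₁} (α : ZCR E g)

/-- The differential `d̄_h - [α, ·]` on `Λ⁰(E^∞) ⊗ 𝔤`. -/
def differential (γ : E.Fn ⊗[ℂ] g.Elt) (i : Fin n) : E.Fn ⊗[ℂ] g.Elt :=
  dBarTensor E g.Elt i γ - tensorBracket g.bracket (α.form i) γ

theorem onForms_differential (ρ : MatRep g) (γ : E.Fn ⊗[ℂ] g.Elt) :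
    ρ.onForms E (α.differential γ) = α.partialAlpha ρ (ρ.onFn E γ) := by
  funext i
  change ρ.onFn E (dBarTensor E g.Elt i γ - tensorBracket g.bracket (α.form i) γ)
    = dBarTensor E (SMat k₀ k₁) i (ρ.onFn E γ)
      - tensorBracket superBracket (ρ.onFn E (α.form i)) (ρ.onFn E γ)
  rw [map_sub, ρ.onFn_dBarTensor, ρ.onFn_tensorBracket]

/-- Evenness of α makes D̃_i an even field. Brackets with it are then ordinary commutators, and
`fnBracket_connection` applies. -/
theorem par_onFn_form (ϱ : VectRep g) (i : Fin n) :
    par (ϱ.onFn E (α.form i)) = ϱ.onFn E (α.form i) := by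
  rw [ϱ.par_onFn, α.even]

theorem dTilde_apply (ϱ : VectRep g) (i : Fin n) (a : E.CovFn k₀ k₁) :
    (α.dTilde ϱ i : Module.End ℂ (E.CovFn k₀ k₁)) a
      = (E.dBarLift k₀ k₁ i : Module.End ℂ (E.CovFn k₀ k₁)) a
        - (ϱ.onFn E (α.form i) : Module.End ℂ (E.CovFn k₀ k₁)) a := rfl

theorem par_dTilde (ϱ : VectRep g) (i : Fin n) : par (α.dTilde ϱ i) = α.dTilde ϱ i :=
  der_ext fun a => by
    rw [par_der_apply, dTilde_apply, dTilde_apply, map_sub, ← par_der_apply, ← par_der_apply,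
      E.par_dBarLift, par_onFn_form]

/-- The two summands of D̃_i account for the two terms of the differential: D̄_i differentiates the
coefficients of γ, and -ϱ(α_i) contributes -ϱ([α_i, γ]). -/
theorem derBracket_dTilde (ϱ : VectRep g) (i : Fin n) (γ : E.Fn ⊗[ℂ] g.Elt) :
    derBracket (α.dTilde ϱ i) (ϱ.onFn E γ) = ϱ.onFn E (α.differential γ i) :=
  der_ext fun a => by
    have e : ϱ.onFn E (α.differential γ i) = ϱ.onFn E (dBarTensor E g.Elt i γ)
      + (-1 : ℂ) • ϱ.onFn E (tensorBracket g.bracket (α.form i) γ) := by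
      rw [← map_smul, ← map_add, differential, sub_eq_add_neg]
      exact congrArg (fun β => ϱ.onFn E (dBarTensor E g.Elt i γ + β)) (neg_one_smul ℂ _).symm
    rw [e, ϱ.onFn_dBarTensor, ϱ.onFn_tensorBracket, Submodule.coe_add, LinearMap.add_apply,
      Submodule.coe_smul, LinearMap.smul_apply,
      derBracket_apply_of_even (α.par_dTilde ϱ i),
      derBracket_apply_of_even (E.par_dBarLift k₀ k₁ i),
      derBracket_apply_of_even (α.par_onFn_form ϱ i), dTilde_apply, dTilde_apply, map_sub,
      neg_one_smul]
    abel

/-- The field ϱ(γ) is vertical, so its bracket with U is ∑ dx^i [D̃_i, ϱ(γ)], and each component is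
given by `derBracket_dTilde`. -/
theorem onForms_differential_eq_partialU (ϱ : VectRep g) (γ : E.Fn ⊗[ℂ] g.Elt) :
    (ϱ.onForms E (α.differential γ) : E.CovFn k₀ k₁ →ₗ[ℂ] Functional (E.CovFn k₀ k₁))
      = α.partialU ϱ (ϱ.onFn E γ) := by
  have h := fnBracket_connection (E.par_indep k₀ k₁) (α.par_dTilde ϱ) (ϱ.onFn_indep E γ)
  rw [partialU, charElement, h, VectRep.onForms, LinearMap.sum_apply]
  simp only [derBracket_dTilde]
  rfl

end ZCR

theorem switchFn_onFn {n m₀ m₁ k₀ k₁ : ℕ} {g : MatLieSuperalgebra k₀ k₁} (E : PDESystem n m₀ m₁)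
    (ρ : MatRep g) (ϱ : VectRep g) (γ : E.Fn ⊗[ℂ] g.Elt)
    (h : ρ.onFn E γ ∈ LinearMap.range (ρ.onFn E)) :
    switchFn E ρ ϱ ⟨ρ.onFn E γ, h⟩ = ϱ.onFn E γ := by
  have e := (LinearEquiv.ofInjective (ρ.onFn E) (ρ.onFn_injective E)).symm_apply_apply γ
  exact congrArg (ϱ.onFn E) e

/-- The value β' is kept as a variable with an equation, so that the lemma can be used for
∂_α(ρ(γ)), which is an image under ρ by a theorem and not by its form. -/
theorem switchForms_onForms {n m₀ m₁ k₀ k₁ : ℕ} {g : MatLieSuperalgebra k₀ k₁}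
    (E : PDESystem n m₀ m₁) (ρ : MatRep g) (ϱ : VectRep g) (β : Fin n → E.Fn ⊗[ℂ] g.Elt)
    {β' : Fin n → E.Fn ⊗[ℂ] SMat k₀ k₁} (h : β' ∈ LinearMap.range (ρ.onForms E))
    (hβ : ρ.onForms E β = β') :
    switchForms E ρ ϱ ⟨β', h⟩ = ϱ.onForms E β := by
  subst hβ
  have e := (LinearEquiv.ofInjective (ρ.onForms E) (ρ.onForms_injective E)).symm_apply_apply β
  exact congrArg (ϱ.onForms E) e

/-! ### The projective substitution M ↦ 𝒘 M ∂_𝒘 -/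

section Projective
variable {k₀ k₁ : ℕ} (μ : ℝ)

/-- The entries of the row vector `𝒘 M`. -/
def projRowMul (M : SMat k₀ k₁) (j : Fin (k₀ + 1) ⊕ Fin k₁) : WFn k₀ k₁ :=
  ∑ i, M i j • projRow k₀ k₁ μ i

theorem projRow_map_succ (s : Fin k₀ ⊕ Fin k₁) :
    projRow k₀ k₁ μ (Sum.map Fin.succ id s) = SuperFn.coord ⊤ s := by
  rcases s with s | s <;> rfl

theorem projField_eq (M : SMat k₀ k₁) (s : Fin k₀ ⊕ Fin k₁) :
    projField μ M s = projRowMul μ M (Sum.map Fin.succ id s)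
      - (μ : ℂ)⁻¹ • (projRowMul μ M (.inl 0) * SuperFn.coord ⊤ s) := by
  have h : ∀ j, ∑ i, projRow k₀ k₁ μ i * algebraMap ℂ _ (M i j) = projRowMul μ M j := fun j =>
    Finset.sum_congr rfl fun i _ => by rw [← Algebra.commutes, Algebra.smul_def]
  rw [projField, h, h, mul_smul_comm]

theorem projRowMul_add (M N : SMat k₀ k₁) (j : Fin (k₀ + 1) ⊕ Fin k₁) :
    projRowMul μ (M + N) j = projRowMul μ M j + projRowMul μ N j := by
  simp only [projRowMul, Matrix.add_apply, add_smul, Finset.sum_add_distrib]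

theorem projRowMul_smul (c : ℂ) (M : SMat k₀ k₁) (j : Fin (k₀ + 1) ⊕ Fin k₁) :
    projRowMul μ (c • M) j = c • projRowMul μ M j := by
  simp only [projRowMul, Matrix.smul_apply, smul_assoc, Finset.smul_sum]

theorem projRowMul_sub (M N : SMat k₀ k₁) (j : Fin (k₀ + 1) ⊕ Fin k₁) :
    projRowMul μ (M - N) j = projRowMul μ M j - projRowMul μ N j := by
  simp only [projRowMul, Matrix.sub_apply, sub_smul, Finset.sum_sub_distrib]

theorem projRowMul_neg (M : SMat k₀ k₁) (j : Fin (k₀ + 1) ⊕ Fin k₁) :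
    projRowMul μ (-M) j = -projRowMul μ M j := by
  simp only [projRowMul, Matrix.neg_apply, neg_smul, Finset.sum_neg_distrib]

theorem projRowMul_mul (M N : SMat k₀ k₁) (j : Fin (k₀ + 1) ⊕ Fin k₁) :
    projRowMul μ (M * N) j = ∑ i, N i j • projRowMul μ M i := by
  simp only [projRowMul, Matrix.mul_apply, Finset.sum_smul, Finset.smul_sum, smul_smul]
  rw [Finset.sum_comm]
  simp only [mul_comm]

theorem par_projRow (j : Fin (k₀ + 1) ⊕ Fin k₁) :
    par (projRow k₀ k₁ μ j) = blockSign j • projRow k₀ k₁ μ j := by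
  rcases j with j | j
  · refine Eq.trans ?_ (one_smul ℂ _).symm
    refine Fin.cases ?_ (fun p => par_coord_inl _ _) j
    change par (algebraMap ℂ (WFn k₀ k₁) (μ : ℂ)) = algebraMap ℂ (WFn k₀ k₁) (μ : ℂ)
    rw [Algebra.algebraMap_eq_smul_one, map_smul, par_one]
  · exact (par_coord_inr _ _).trans (neg_one_smul ℂ _).symm

/-- The entries of M are complex numbers, so the parity of w_i M_{ij} is that of row i. The parity
of M itself is the product of the row and column signs, which leaves the sign of the column. -/
theorem par_projRowMul (M : SMat k₀ k₁) (j : Fin (k₀ + 1) ⊕ Fin k₁) :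
    par (projRowMul μ M j) = blockSign j • projRowMul μ (par M) j := by
  simp only [projRowMul, map_sum, map_smul, par_projRow, Finset.smul_sum]
  refine Finset.sum_congr rfl fun i _ => ?_
  change M i j • blockSign i • projRow k₀ k₁ μ i
    = blockSign j • (blockSign i * M i j * blockSign j) • projRow k₀ k₁ μ i
  rw [smul_smul, smul_smul]
  congr 1
  linear_combination (-(M i j * blockSign i)) * blockSign_mul_self j

/-- The linear map `M ↦ 𝒘 M ∂_𝒘` to the coefficients of vector fields. -/
def projFieldLin : SMat k₀ k₁ →ₗ[ℂ] (Fin k₀ ⊕ Fin k₁ → WFn k₀ k₁) where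
  toFun := projField μ
  map_add' M N := by
    funext s
    simp only [projField_eq, projRowMul_add, add_mul, Pi.add_apply]
    module
  map_smul' c M := by
    funext s
    simp only [projField_eq, projRowMul_smul, smul_mul_assoc, Pi.smul_apply, RingHom.id_apply]
    module

theorem projField_mem_adjoin (M : SMat k₀ k₁) (s : Fin k₀ ⊕ Fin k₁) : projField μ M s ∈
    Algebra.adjoin ℂ (Set.range (SuperFn.coord (S₁ := Fin k₁) (⊤ : Opens (Fin k₀ → ℝ)))) := by
  have hc : ∀ t, SuperFn.coord ⊤ t ∈
      Algebra.adjoin ℂ (Set.range (SuperFn.coord (S₁ := Fin k₁) (⊤ : Opens (Fin k₀ → ℝ)))) :=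
    fun t => Algebra.subset_adjoin ⟨t, rfl⟩
  have hv : ∀ j, projRowMul μ M j ∈
      Algebra.adjoin ℂ (Set.range (SuperFn.coord (S₁ := Fin k₁) (⊤ : Opens (Fin k₀ → ℝ)))) := by
    refine fun j => Subalgebra.sum_mem _ fun i _ => Subalgebra.smul_mem _ ?_ _
    rcases i with i | i
    · exact Fin.cases (Subalgebra.algebraMap_mem _ _) (fun p => hc (.inl p)) i
    · exact hc (.inr i)
  rw [projField_eq]
  exact Subalgebra.sub_mem _ (hv _)
    (Subalgebra.smul_mem _ (Subalgebra.mul_mem _ (hv _) (hc s)) _)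

/-- The action of the vector field `𝒘 M ∂_𝒘`. -/
def projEnd : SMat k₀ k₁ →ₗ[ℂ] Module.End ℂ (WFn k₀ k₁) :=
  (Der (WFn k₀ k₁)).subtype ∘ₗ frameField SuperFn.partialDer ∘ₗ projFieldLin μ

theorem projEnd_eq (M : SMat k₀ k₁) : projEnd μ M = SuperFn.field (projField μ M) := by
  rw [SuperFn.field_eq_frameField]; rfl

/-- The sign of column j in `par_projRowMul` is the sign of the derivative ∂_{w_j} that multiplies
this entry, so the two cancel. The distinguished index 0 is even and contributes no sign. -/
theorem field_projField_par (M : SMat k₀ k₁) :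
    SuperFn.field (projField μ (par M)) = par (SuperFn.field (projField μ M)) := by
  rw [SuperFn.par_field]
  congr 1
  funext s
  have hs : blockSign (Sum.map Fin.succ id s : Fin (k₀ + 1) ⊕ Fin k₁)
      = SuperFn.coordSign s := by rcases s with s | s <;> rfl
  rw [projField_eq, projField_eq, map_sub, map_smul, par_mul, par_projRowMul, par_projRowMul,
    SuperFn.par_coord, hs, smul_sub, smul_smul, SuperFn.coordSign_mul_self, one_smul]
  congr 1
  have h0 : blockSign (.inl 0 : Fin (k₀ + 1) ⊕ Fin k₁) = 1 := rfl
  rw [h0, one_smul, mul_smul_comm, smul_comm, smul_smul (SuperFn.coordSign s),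
    SuperFn.coordSign_mul_self, one_smul]

theorem projEnd_par (M : SMat k₀ k₁) : projEnd μ (par M) = par (projEnd μ M) := by
  rw [projEnd_eq, projEnd_eq, field_projField_par]; rfl

variable {μ}

/-- Including the constant entry w_0 = μ makes the formula uniform in j, so that it extends by
linearity to the entries of 𝒘N. -/
theorem projEnd_projRow (hμ : μ ≠ 0) (M : SMat k₀ k₁) (j : Fin (k₀ + 1) ⊕ Fin k₁) :
    projEnd μ M (projRow k₀ k₁ μ j) = projRowMul μ M j
      - (μ : ℂ)⁻¹ • (projRowMul μ M (.inl 0) * projRow k₀ k₁ μ j) := by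
  have hs : ∀ s, projEnd μ M (projRow k₀ k₁ μ (Sum.map Fin.succ id s))
      = projRowMul μ M (Sum.map Fin.succ id s) - (μ : ℂ)⁻¹ •
        (projRowMul μ M (.inl 0) * projRow k₀ k₁ μ (Sum.map Fin.succ id s)) := fun s => by
    rw [projEnd_eq, projRow_map_succ, SuperFn.field_coord, projField_eq]
  rcases j with j | j
  · refine Fin.cases ?_ (fun p => hs (.inl p)) j
    -- For j = 0 a derivation annihilates the constant μ, while the right side is (𝒘M)_0 - μ⁻¹
    -- (𝒘M)_0 μ = 0. This is where μ ≠ 0 is needed.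
    have h0 : projRow k₀ k₁ μ (.inl 0) = algebraMap ℂ _ (μ : ℂ) := rfl
    rw [projEnd_eq, h0, der_algebraMap, ← Algebra.commutes, ← Algebra.smul_def, smul_smul,
      inv_mul_cancel₀ (by exact_mod_cast hμ), one_smul, sub_self]
  · exact hs (.inr j)

/-- The entries of N are constants and pass through X_M without a sign, so the linear part is 𝒘MN.
Matrices act on the row 𝒘 from the right, hence the products keep their order and a homomorphism
results, not an antihomomorphism. -/
theorem projEnd_projRowMul (hμ : μ ≠ 0) (M N : SMat k₀ k₁) (j : Fin (k₀ + 1) ⊕ Fin k₁) :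
    projEnd μ M (projRowMul μ N j) = projRowMul μ (M * N) j
      - (μ : ℂ)⁻¹ • (projRowMul μ M (.inl 0) * projRowMul μ N j) := by
  rw [projRowMul_mul]
  conv_lhs => rw [projRowMul, map_sum]
  conv_rhs => enter [2, 2, 2]; rw [projRowMul]
  rw [Finset.mul_sum, Finset.smul_sum, ← Finset.sum_sub_distrib]
  refine Finset.sum_congr rfl fun i _ => ?_
  rw [map_smul, projEnd_projRow hμ, mul_smul_comm]
  module

theorem projEnd_projRowMul_mul (M N : SMat k₀ k₁) (a : WFn k₀ k₁) :
    projEnd μ M (projRowMul μ N (.inl 0) * a) = projEnd μ M (projRowMul μ N (.inl 0)) * a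
      + projRowMul μ N (.inl 0) * projEnd μ (ev M) a
      + projRowMul μ (par N) (.inl 0) * projEnd μ (od M) a := by
  have h0 : blockSign (.inl 0 : Fin (k₀ + 1) ⊕ Fin k₁) = 1 := rfl
  have h := der_mul (SuperFn.field (projField μ M)) (projRowMul μ N (.inl 0)) a
  rw [coe_ev, coe_od, ← projEnd_eq, ← map_ev (projEnd_par μ), ← map_od (projEnd_par μ),
    par_projRowMul, h0, one_smul] at h
  exact h

theorem projEnd_projEnd_projRow (hμ : μ ≠ 0) (M N : SMat k₀ k₁) (j : Fin (k₀ + 1) ⊕ Fin k₁) :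
    projEnd μ M (projEnd μ N (projRow k₀ k₁ μ j)) = projRowMul μ (M * N) j
      - (μ : ℂ)⁻¹ • (projRowMul μ M (.inl 0) * projRowMul μ N j)
      - (μ : ℂ)⁻¹ • ((projRowMul μ (M * N) (.inl 0)
          - (μ : ℂ)⁻¹ • (projRowMul μ M (.inl 0) * projRowMul μ N (.inl 0))) * projRow k₀ k₁ μ j
        + projRowMul μ N (.inl 0) * (projRowMul μ (ev M) j
          - (μ : ℂ)⁻¹ • (projRowMul μ (ev M) (.inl 0) * projRow k₀ k₁ μ j))
        + projRowMul μ (par N) (.inl 0) * (projRowMul μ (od M) j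
          - (μ : ℂ)⁻¹ • (projRowMul μ (od M) (.inl 0) * projRow k₀ k₁ μ j))) := by
  rw [projEnd_projRow hμ, map_sub, map_smul, projEnd_projRowMul hμ, projEnd_projRowMul_mul,
    projEnd_projRowMul hμ, projEnd_projRow hμ, projEnd_projRow hμ]

/-- For homogeneous M and N, the terms of X_M X_N w_j other than (𝒘MN)_j - μ⁻¹ (𝒘MN)_0 w_j come in
pairs with M and N exchanged and the sign (-1)^{p(M)p(N)}. They cancel in the supercommutator, and
the two named terms give X_{[M,N]} w_j. -/
theorem projEnd_superBracket_projRow (hμ : μ ≠ 0) (M N : SMat k₀ k₁)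
    (j : Fin (k₀ + 1) ⊕ Fin k₁) :
    projEnd μ (superBracket M N) (projRow k₀ k₁ μ j)
      = superBracket (projEnd μ M) (projEnd μ N) (projRow k₀ k₁ μ j) := by
  have hM : ∀ j, projRowMul μ M j = projRowMul μ (ev M) j + projRowMul μ (od M) j := fun j => by
    rw [← projRowMul_add, ev_add_od]
  have hN : ∀ j, projRowMul μ N j = projRowMul μ (ev N) j + projRowMul μ (od N) j := fun j => by
    rw [← projRowMul_add, ev_add_od]
  have hpN : ∀ j, projRowMul μ (par N) j = projRowMul μ (ev N) j - projRowMul μ (od N) j :=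
    fun j => by rw [← projRowMul_sub, ← par_eq]
  have e : superBracket (projEnd μ M) (projEnd μ N) (projRow k₀ k₁ μ j)
      = projEnd μ M (projEnd μ N (projRow k₀ k₁ μ j))
        - projEnd μ N (projEnd μ (ev M) (projRow k₀ k₁ μ j))
        - projEnd μ (par N) (projEnd μ (od M) (projRow k₀ k₁ μ j)) := by
    rw [superBracket_apply, map_ev (projEnd_par μ), map_od (projEnd_par μ), projEnd_par]
    rfl
  rw [e, projEnd_projRow hμ, superBracket_apply, projEnd_projEnd_projRow hμ,
    projEnd_projEnd_projRow hμ, projEnd_projEnd_projRow hμ, par_ev, par_od, ev_par, od_par]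
  simp only [projRowMul_sub, projRowMul_neg, hpN, hM, hN, mul_add, mul_sub, add_mul, sub_mul,
    smul_add, smul_sub, mul_smul_comm, smul_mul_assoc, mul_assoc, neg_mul, mul_neg, smul_neg]
  -- Once M and N are split into parity components, the cancellation takes place between equal
  -- ordered monomials. No factors have to be commuted.
  abel

-- On W the partial derivatives form a frame dual to the coordinates, so equality on the
-- coordinates, which are entries of 𝒘, is enough.
variable (μ) in
theorem field_projField_superBracket (hμ : μ ≠ 0) (M N : SMat k₀ k₁) :
    SuperFn.field (projField μ (superBracket M N))
      = derBracket (SuperFn.field (projField μ M)) (SuperFn.field (projField μ N)) := by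
  have hmem : ∀ M : SMat k₀ k₁, SuperFn.field (projField μ M)
      ∈ LinearMap.range (frameField SuperFn.partialDer) := fun M => by
    rw [SuperFn.field_eq_frameField]; exact ⟨_, rfl⟩
  refine eq_of_mem_range_frameField (z := SuperFn.coord ⊤)
    (fun s t => SuperFn.partialLin_coord s t) (hmem _)
    (derBracket_mem_range_frameField SuperFn.par_partialDer SuperFn.derBracket_partialDer
      (hmem M) (hmem N)) fun s => ?_
  rw [derBracket_coe, ← projEnd_eq, ← projEnd_eq, ← projEnd_eq, ← projRow_map_succ μ,
    projEnd_superBracket_projRow hμ]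

/-- The projective substitution `M ↦ 𝒘 M ∂_𝒘` as a representation of a Lie superalgebra of
matrices. -/
def VectRep.projective (g : MatLieSuperalgebra k₀ k₁) (hμ : μ ≠ 0) : VectRep g where
  toLin := projFieldLin μ ∘ₗ g.carrier.subtype
  polynomial x s := by
    change projField μ (x : SMat k₀ k₁) s ∈ _
    exact projField_mem_adjoin μ (x : SMat k₀ k₁) s
  map_par x := field_projField_par μ (x : SMat k₀ k₁)
  map_bracket x y := field_projField_superBracket μ hμ (x : SMat k₀ k₁) (y : SMat k₀ k₁)

end Projective

end SuperGeom

end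

theorem lemma1 {n m₀ m₁ k₀ k₁ : ℕ} (E : PDESystem n m₀ m₁)
    (g : MatLieSuperalgebra k₀ k₁) (ρ : MatRep g) (α : ZCR E g) :
    (∀ (ϱ : VectRep g) (γ : E.Fn ⊗[ℂ] g.Elt),
      switchFn E ρ ϱ ⟨ρ.onFn E γ, LinearMap.mem_range_self _ γ⟩ = ϱ.onFn E γ ∧
      ∃ h : α.partialAlpha ρ (ρ.onFn E γ) ∈ LinearMap.range (ρ.onForms E),
        (switchForms E ρ ϱ ⟨α.partialAlpha ρ (ρ.onFn E γ), h⟩ :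
            E.CovFn k₀ k₁ →ₗ[ℂ] Functional (E.CovFn k₀ k₁))
          = α.partialU ϱ (ϱ.onFn E γ)) ∧
    ∀ μ : ℝ, μ ≠ 0 → ∃ ϱ : VectRep g, ∀ x : g.Elt, ϱ.toLin x = projField μ (x : SMat k₀ k₁) := by
  refine ⟨fun ϱ γ => ?_, fun μ hμ => ⟨VectRep.projective g hμ, fun _ => rfl⟩⟩
  -- The preimage under ρ is the differential of γ. Applying ϱ to this same preimage yields
  -- ∂_U(ϱ(γ)).
  have h : α.partialAlpha ρ (ρ.onFn E γ) ∈ LinearMap.range (ρ.onForms E) :=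
    ⟨α.differential γ, α.onForms_differential ρ γ⟩
  have e := switchForms_onForms E ρ ϱ (α.differential γ) h (α.onForms_differential ρ γ)
  exact ⟨switchFn_onFn E ρ ϱ γ _, h,
    (congrArg Subtype.val e).trans (α.onForms_differential_eq_partialU ϱ γ)⟩
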